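/- Let $G$ be a finite abelian group with dual group $\widehat G=\mathrm{Hom}(G,\mathbb T)$, and let $\alpha=((A_g)_{g\in G},(\alpha_g)_{g\in G})$ be a partial action of $G$ on a separable $C^*$-algebra $A$; that is, the $A_g\lhd A$ are closed two-sided ideals, the $\alpha_g\colon A_{g^{-1}}\to A_g$ are $*$-isomorphisms, $A_e=A$, $\alpha_e=\mathrm{id}_A$, and $\alpha_{gh}$ extends $\alpha_g\circ\alpha_h$ wherever the composition is defined. Let $A\rtimes_\alpha G$ be the partial crossed product, i.e. the space of formal sums $\sum_{g\in G}a_gu_g$ with $a_g\in A_g$, with product and involution determined by $(a_gu_g)(b_hu_h)=\alpha_g(\alpha_{g^{-1}}(a_g)b_h)u_{gh}$ and $(a_gu_g)^*=\alpha_{g^{-1}}(a_g^*)u_{g^{-1}}$, and with its universal $C^*$-norm, and let $\widehat\alpha$ be the dual (global) action of $\widehat G$ on $A\rtimes_\alpha G$, given by $\widehat\alpha_\chi(a_gu_g)=\chi(g)a_gu_g$. Then $$\dim_{\mathrm{Rok}}(\widehat\alpha)=\dim_{\mathrm{rep}}(\alpha)$$ in $\{0,1,2,\dots\}\cup\{\infty\}$,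 where the two dimensions are defined as follows for a partial action $\beta=((B_g)_{g\in H},(\beta_g)_{g\in H})$ of a finite group $H$ on a $C^*$-algebra $B$. (1) $\dim_{\mathrm{Rok}}(\beta)$ is the least $d\in\mathbb N=\{0,1,2,\dots\}$ (and $\infty$ if there is none) such that for every $\varepsilon>0$ and every finite $F\subseteq B$ there are positive contractions $f_g^{(j)}\in B_g$ ($g\in H$, $0\le j\le d$) with: (i) $\|f_g^{(j)}f_h^{(j)}a\|<\varepsilon$ for all $j$, $g\ne h$, $a\in F$; (ii) $\|(f_g^{(j)}b-bf_g^{(j)})a\|<\varepsilon$ for all $j$, $g$ and $a,b\in F$; (iii) $\|(\sum_{j=0}^d\sum_{g\in H} f_g^{(j)})a-a\|<\varepsilon$ for all $a\in F$; (iv) $\|(\beta_g(f_h^{(j)}x)-f_{gh}^{(j)}\beta_g(x))a\|<\varepsilon$ for all $j$, $g,h$, $a\in F$ and $x\in B_{g^{-1}}\cap F$. (2) $\dim_{\mathrm{rep}}(\beta)$ is the least $d\in\mathbb N$ (and $\infty$ if there is none) such that for every $\varepsilon>0$ and every finite $F\subseteq B$ there are contractions $x_g^{(j)}\in B_{g^{-1}}$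 ($g\in H$, $0\le j\le d$) with every $x_e^{(j)}$ positive and: (i) $\|((x_g^{(j)})^*x_g^{(j)}-x_g^{(j)}(x_g^{(j)})^*)b\|<\varepsilon$ for all $j$, $g$, $b\in F$; (ii) $\|(x_g^{(j)}x_h^{(j)}-x_e^{(j)}x_{gh}^{(j)})b\|<\varepsilon$ for all $j$, $g,h$, $b\in F$; (iii) $\|(\beta_g(ax_h^{(j)})-\beta_g(a)x_{ghg^{-1}}^{(j)})b\|<\varepsilon$ for all $j$, $g,h$, $a\in B_{g^{-1}}\cap F$, $b\in F$; (iv) $\|(\sum_{j=0}^d x_e^{(j)})b-b\|<\varepsilon$ for all $b\in F$; (v) $\|x_g^{(j)}b-\beta_g(b)x_g^{(j)}\|<\varepsilon$ for all $j$, $g$, $b\in B_{g^{-1}}\cap F$. -/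

import Mathlib

universe u v

/-- A partial action of a group `G` on a C⋆-algebra `A`: closed two-sided ideals `A_g` (being
closed, they are automatically star-invariant, so that they are bundled as C⋆-subalgebras) and
star-isomorphisms `α_g : A_{g⁻¹} → A_g`, such that `A_e = A`, `α_e = id` and `α_{gh}` extends
`α_g ∘ α_h` wherever the composition is defined. -/
structure PartialAction (G : Type*) (A : Type*) [Group G] [NonUnitalCStarAlgebra A] where
  ideal : G → NonUnitalStarSubalgebra ℂ A
  isClosed_ideal : ∀ g, IsClosed (ideal g : Set A)
  mul_mem_left : ∀ g (a x : A), x ∈ ideal g → a * x ∈ ideal g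
  mul_mem_right : ∀ g (a x : A), x ∈ ideal g → x * a ∈ ideal g
  equiv : ∀ g, ideal g⁻¹ ≃⋆ₐ[ℂ] ideal g
  ideal_one : ideal 1 = ⊤
  equiv_one : ∀ x : ideal (1 : G)⁻¹, (equiv 1 x : A) = x
  equiv_mul : ∀ (g h : G) (x : ideal h⁻¹) (y : ideal g⁻¹), (equiv h x : A) = y →
    ∃ hx : (x : A) ∈ ideal (g * h)⁻¹, (equiv (g * h) ⟨x, hx⟩ : A) = equiv g y

namespace PartialAction

section Basic

variable {G : Type*} {A : Type*} [Group G] [NonUnitalCStarAlgebra A] (α : PartialAction G A)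

open scoped Classical in
/-- The map `α_g : A_{g⁻¹} → A_g ⊆ A`, extended by zero to all of `A`. It is only ever used on
elements of its domain `A_{g⁻¹}`. -/
noncomputable def act (g : G) (x : A) : A :=
  if hx : x ∈ α.ideal g⁻¹ then (α.equiv g ⟨x, hx⟩ : A) else 0

lemma act_of_mem {g : G} {x : A} (hx : x ∈ α.ideal g⁻¹) :
    α.act g x = (α.equiv g ⟨x, hx⟩ : A) := dif_pos hx

lemma act_mem (g : G) (x : A) : α.act g x ∈ α.ideal g := by
  unfold act
  split_ifs
  · exact SetLike.coe_mem _
  · exact zero_mem _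

@[simp] lemma act_zero (g : G) : α.act g 0 = 0 := by
  rw [α.act_of_mem (zero_mem _)]
  exact congrArg Subtype.val (map_zero (α.equiv g))

lemma act_add {g : G} {x y : A} (hx : x ∈ α.ideal g⁻¹) (hy : y ∈ α.ideal g⁻¹) :
    α.act g (x + y) = α.act g x + α.act g y := by
  rw [α.act_of_mem hx, α.act_of_mem hy, α.act_of_mem (add_mem hx hy)]
  exact congrArg Subtype.val (map_add (α.equiv g) ⟨x, hx⟩ ⟨y, hy⟩)

lemma act_mul {g : G} {x y : A} (hx : x ∈ α.ideal g⁻¹) (hy : y ∈ α.ideal g⁻¹) :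
    α.act g (x * y) = α.act g x * α.act g y := by
  rw [α.act_of_mem hx, α.act_of_mem hy, α.act_of_mem (mul_mem hx hy)]
  exact congrArg Subtype.val (map_mul (α.equiv g) ⟨x, hx⟩ ⟨y, hy⟩)

lemma act_smul {g : G} (c : ℂ) {x : A} (hx : x ∈ α.ideal g⁻¹) :
    α.act g (c • x) = c • α.act g x := by
  rw [α.act_of_mem hx, α.act_of_mem (SMulMemClass.smul_mem c hx)]
  exact congrArg Subtype.val (map_smul (α.equiv g) c ⟨x, hx⟩)

lemma act_star {g : G} {x : A} (hx : x ∈ α.ideal g⁻¹) :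
    α.act g (star x) = star (α.act g x) := by
  rw [α.act_of_mem hx, α.act_of_mem (star_mem hx)]
  exact congrArg Subtype.val (map_star (α.equiv g) ⟨x, hx⟩)

lemma act_sum {ι : Type*} {g : G} (s : Finset ι) (f : ι → A) (hf : ∀ i, f i ∈ α.ideal g⁻¹) :
    α.act g (∑ i ∈ s, f i) = ∑ i ∈ s, α.act g (f i) := by
  classical
  induction s using Finset.induction_on with
  | empty => simp
  | insert i s hi ih =>
    rw [Finset.sum_insert hi, Finset.sum_insert hi, α.act_add (hf i) (sum_mem fun j _ => hf j), ih]

lemma norm_act {g : G} {x : A} (hx : x ∈ α.ideal g⁻¹) : ‖α.act g x‖ = ‖x‖ := by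
  rw [α.act_of_mem hx]
  have := α.isClosed_ideal g
  have := α.isClosed_ideal g⁻¹
  exact StarAlgEquiv.norm_map (α.equiv g) ⟨x, hx⟩

lemma mem_one (x : A) : x ∈ α.ideal 1 := by rw [α.ideal_one]; trivial

@[simp] lemma act_one (x : A) : α.act 1 x = x := by
  have hx : x ∈ α.ideal (1 : G)⁻¹ := by rw [inv_one]; exact α.mem_one x
  rw [α.act_of_mem hx]
  exact α.equiv_one ⟨x, hx⟩

lemma act_comp {g h : G} {x : A} (hx : x ∈ α.ideal h⁻¹) (hy : α.act h x ∈ α.ideal g⁻¹) :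
    x ∈ α.ideal (g * h)⁻¹ ∧ α.act (g * h) x = α.act g (α.act h x) := by
  obtain ⟨h1, h2⟩ := α.equiv_mul g h ⟨x, hx⟩ ⟨α.act h x, hy⟩ (α.act_of_mem hx).symm
  exact ⟨h1, by rw [α.act_of_mem h1, α.act_of_mem hy]; exact h2⟩

lemma act_inv_act {g : G} {x : A} (hx : x ∈ α.ideal g⁻¹) : α.act g⁻¹ (α.act g x) = x := by
  have h := (α.act_comp (g := g⁻¹) hx (by rw [inv_inv]; exact α.act_mem g x)).2
  rw [← h, inv_mul_cancel, act_one]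

lemma act_act_inv {g : G} {x : A} (hx : x ∈ α.ideal g) : α.act g (α.act g⁻¹ x) = x := by
  have h := α.act_inv_act (g := g⁻¹) (x := x) (by rwa [inv_inv])
  rwa [inv_inv] at h

/-- `α_g (A_{g⁻¹} ∩ A_h) ⊆ A_{gh}`. -/
lemma act_mem_mul {g h : G} {x : A} (hx : x ∈ α.ideal g⁻¹) (hx' : x ∈ α.ideal h) :
    α.act g x ∈ α.ideal (g * h) := by
  have h1 := α.act_comp (g := g) (h := h) (α.act_mem h⁻¹ x)
    (by rw [α.act_act_inv hx']; exact hx)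
  rw [α.act_act_inv hx'] at h1
  rw [← h1.2]
  exact α.act_mem _ _

/-- The coefficient of the product `(x u_g) (y u_h)`, which does not depend on `h`. -/
noncomputable def conv (g : G) (x y : A) : A := α.act g (α.act g⁻¹ x * y)

lemma conv_dom (g : G) (x y : A) : α.act g⁻¹ x * y ∈ α.ideal g⁻¹ :=
  α.mul_mem_right _ _ _ (α.act_mem _ _)

lemma conv_mem (g h : G) (x : A) {y : A} (hy : y ∈ α.ideal h) :
    α.conv g x y ∈ α.ideal (g * h) :=
  α.act_mem_mul (α.conv_dom g x y) (α.mul_mem_left _ _ _ hy)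

lemma conv_mem_left (g : G) (x y : A) : α.conv g x y ∈ α.ideal g := α.act_mem _ _

lemma conv_add_right (g : G) (x y z : A) : α.conv g x (y + z) = α.conv g x y + α.conv g x z := by
  unfold conv
  rw [mul_add, α.act_add (α.conv_dom g x y) (α.conv_dom g x z)]

@[simp] lemma conv_zero_right (g : G) (x : A) : α.conv g x 0 = 0 := by simp [conv]

@[simp] lemma conv_zero_left (g : G) (x : A) : α.conv g 0 x = 0 := by simp [conv]

lemma conv_add_left {g : G} {x y : A} (z : A) (hx : x ∈ α.ideal g) (hy : y ∈ α.ideal g) :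
    α.conv g (x + y) z = α.conv g x z + α.conv g y z := by
  unfold conv
  rw [α.act_add (by rwa [inv_inv]) (by rwa [inv_inv]), add_mul,
    α.act_add (α.conv_dom g x z) (α.conv_dom g y z)]

lemma conv_smul_right (g : G) (c : ℂ) (x y : A) : α.conv g x (c • y) = c • α.conv g x y := by
  unfold conv
  rw [mul_smul_comm, α.act_smul c (α.conv_dom g x y)]

lemma conv_smul_left {g : G} (c : ℂ) {x : A} (y : A) (hx : x ∈ α.ideal g) :
    α.conv g (c • x) y = c • α.conv g x y := by
  unfold conv
  rw [α.act_smul c (by rwa [inv_inv]), smul_mul_assoc, α.act_smul c (α.conv_dom g x y)]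

lemma conv_sum_right {ι : Type*} (g : G) (x : A) (s : Finset ι) (f : ι → A) :
    α.conv g x (∑ i ∈ s, f i) = ∑ i ∈ s, α.conv g x (f i) := by
  unfold conv
  rw [Finset.mul_sum, α.act_sum _ _ fun i => α.conv_dom g x (f i)]

lemma conv_sum_left {ι : Type*} (g : G) (y : A) (s : Finset ι) (f : ι → A)
    (hf : ∀ i, f i ∈ α.ideal g) :
    α.conv g (∑ i ∈ s, f i) y = ∑ i ∈ s, α.conv g (f i) y := by
  unfold conv
  rw [α.act_sum _ _ (fun i => by rw [inv_inv]; exact hf i), Finset.sum_mul,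
    α.act_sum _ _ fun i => α.conv_dom g (f i) y]

lemma norm_conv_le {g : G} {x : A} (y : A) (hx : x ∈ α.ideal g) :
    ‖α.conv g x y‖ ≤ ‖x‖ * ‖y‖ := by
  unfold conv
  rw [α.norm_act (α.conv_dom g x y)]
  refine (norm_mul_le _ _).trans ?_
  rw [α.norm_act (by rwa [inv_inv])]

lemma conv_one (x y : A) : α.conv 1 x y = x * y := by simp [conv]

/-- `A_g` is a bimodule with a compatible right multiplication. -/
lemma mul_conv_of_mem {g : G} {t x : A} (y : A) (ht : t ∈ α.ideal g) (hx : x ∈ α.ideal g) :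
    t * α.conv g x y = α.conv g (t * x) y := by
  unfold conv
  have ht' : t ∈ α.ideal g⁻¹⁻¹ := by rwa [inv_inv]
  have hx' : x ∈ α.ideal g⁻¹⁻¹ := by rwa [inv_inv]
  rw [α.act_mul ht' hx', mul_assoc, α.act_mul (α.act_mem _ _) (α.conv_dom g x y),
    α.act_act_inv ht]

lemma mul_conv {g : G} (t : A) {x : A} (y : A) (hx : x ∈ α.ideal g) :
    t * α.conv g x y = α.conv g (t * x) y := by
  have hd : t * α.conv g x y - α.conv g (t * x) y ∈ α.ideal g :=
    sub_mem (α.mul_mem_left _ _ _ (α.conv_mem_left _ _ _)) (α.conv_mem_left _ _ _)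
  have key : ∀ s ∈ α.ideal g, s * (t * α.conv g x y - α.conv g (t * x) y) = 0 := by
    intro s hs
    rw [mul_sub, ← mul_assoc, α.mul_conv_of_mem y (α.mul_mem_right _ _ _ hs) hx,
      α.mul_conv_of_mem y hs (α.mul_mem_left _ _ _ hx), mul_assoc, sub_self]
  have := key _ (star_mem hd)
  rw [CStarRing.star_mul_self_eq_zero_iff] at this
  exact sub_eq_zero.1 this

/-- Associativity of the convolution product, on coefficients. -/
lemma conv_assoc {g h : G} {x y : A} (z : A) (hy : y ∈ α.ideal h) :
    α.conv (g * h) (α.conv g x y) z = α.conv g x (α.conv h y z) := by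
  set c := α.act g⁻¹ x with hc
  have hcy : c * y ∈ α.ideal g⁻¹ := α.conv_dom g x y
  have hcy' : c * y ∈ α.ideal h := α.mul_mem_left _ _ _ hy
  set w := α.act h⁻¹ (c * y) with hw
  have hwd : w ∈ α.ideal h⁻¹ := α.act_mem _ _
  have hww : α.act h w = c * y := α.act_act_inv hcy'
  obtain ⟨hw1, hw2⟩ := α.act_comp (g := g) hwd (by rw [hww]; exact hcy)
  have e1 : α.act (g * h)⁻¹ (α.conv g x y) = w := by
    have : α.conv g x y = α.act (g * h) w := by rw [hw2, hww]; rfl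
    rw [this, α.act_inv_act hw1]
  have e2 : α.act h (w * z) = c * α.conv h y z := by
    rw [α.mul_conv c z hy]; rfl
  have e3 : c * α.conv h y z ∈ α.ideal g⁻¹ := α.mul_mem_right _ _ _ (α.act_mem _ _)
  change α.act (g * h) (α.act (g * h)⁻¹ (α.conv g x y) * z) = α.act g (c * α.conv h y z)
  rw [e1, (α.act_comp (g := g) (α.mul_mem_right _ _ _ hwd) (by rw [e2]; exact e3)).2, e2]

/-- Compatibility of the convolution product with the involution, on coefficients. -/
lemma act_star_conv {g h : G} {x y : A} (hx : x ∈ α.ideal g) (hy : y ∈ α.ideal h) :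
    α.act (g * h)⁻¹ (star (α.conv g x y)) =
      α.conv h⁻¹ (α.act h⁻¹ (star y)) (α.act g⁻¹ (star x)) := by
  set c := α.act g⁻¹ x with hc
  have hcy : c * y ∈ α.ideal g⁻¹ := α.conv_dom g x y
  have hcy' : c * y ∈ α.ideal h := α.mul_mem_left _ _ _ hy
  have hx' : x ∈ α.ideal g⁻¹⁻¹ := by rwa [inv_inv]
  set w := α.act h⁻¹ (star (c * y)) with hw
  have hwd : w ∈ α.ideal h⁻¹ := α.act_mem _ _
  have hww : α.act h w = star (c * y) := α.act_act_inv (star_mem hcy')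
  obtain ⟨hw1, hw2⟩ := α.act_comp (g := g) hwd (by rw [hww]; exact star_mem hcy)
  have e1 : star (α.conv g x y) = α.act (g * h) w := by
    rw [hw2, hww, α.act_star hcy]; rfl
  rw [e1, α.act_inv_act hw1, hw, star_mul, conv, inv_inv, α.act_act_inv (star_mem hy),
    α.act_star hx']

/-- `(x u_g) (y u_g)^* = x y^*`, on coefficients. -/
lemma conv_act_star {g : G} {x y : A} (hx : x ∈ α.ideal g) (hy : y ∈ α.ideal g) :
    α.conv g x (α.act g⁻¹ (star y)) = x * star y := by
  have hx' : x ∈ α.ideal g⁻¹⁻¹ := by rwa [inv_inv]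
  have hy' : star y ∈ α.ideal g⁻¹⁻¹ := by rw [inv_inv]; exact star_mem hy
  unfold conv
  rw [α.act_mul (α.act_mem _ _) (α.act_mem _ _), α.act_act_inv hx, α.act_act_inv (star_mem hy)]

end Basic

section CrossedProduct

variable {G : Type u} {A : Type v} [Group G] [NonUnitalCStarAlgebra A]

/-- The underlying space of the partial crossed product `A ⋊_α G` by a finite group: formal sums
`∑_g a_g u_g` with `a_g ∈ A_g`, given by their families of coefficients. -/
def CrossedProduct (α : PartialAction G A) := ∀ g, α.ideal g

variable {α : PartialAction G A}

namespace CrossedProduct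

/-- The coefficient `a_g ∈ A_g ⊆ A` of `∑_g a_g u_g`. -/
def coeff (x : CrossedProduct α) (g : G) : A := (x g : A)

/-- The formal sum with given coefficients. -/
def ofCoeff (f : G → A) (hf : ∀ g, f g ∈ α.ideal g) : CrossedProduct α := fun g => ⟨f g, hf g⟩

@[simp] lemma coeff_ofCoeff (f : G → A) (hf : ∀ g, f g ∈ α.ideal g) (g : G) :
    (ofCoeff f hf : CrossedProduct α).coeff g = f g := rfl

lemma coeff_mem (x : CrossedProduct α) (g : G) : x.coeff g ∈ α.ideal g := (x g).2

@[ext] lemma ext {x y : CrossedProduct α} (h : ∀ g, x.coeff g = y.coeff g) : x = y :=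
  funext fun g => Subtype.ext (h g)

noncomputable instance : AddCommGroup (CrossedProduct α) :=
  inferInstanceAs (AddCommGroup (∀ g, α.ideal g))

noncomputable instance : Module ℂ (CrossedProduct α) :=
  inferInstanceAs (Module ℂ (∀ g, α.ideal g))

@[simp] lemma coeff_zero (g : G) : (0 : CrossedProduct α).coeff g = 0 := rfl
@[simp] lemma coeff_add (x y : CrossedProduct α) (g : G) :
    (x + y).coeff g = x.coeff g + y.coeff g := rfl
@[simp] lemma coeff_sub (x y : CrossedProduct α) (g : G) :
    (x - y).coeff g = x.coeff g - y.coeff g := rfl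
@[simp] lemma coeff_neg (x : CrossedProduct α) (g : G) : (-x).coeff g = -x.coeff g := rfl
@[simp] lemma coeff_smul (c : ℂ) (x : CrossedProduct α) (g : G) :
    (c • x).coeff g = c • x.coeff g := rfl

/-- The element `a u_g`, for `a ∈ A_g`. -/
noncomputable def single (g : G) (a : A) (ha : a ∈ α.ideal g) : CrossedProduct α :=
  letI := Classical.decEq G
  ofCoeff (Pi.single g a) fun h => by
    let := Classical.decEq G
    rcases eq_or_ne h g with rfl | hne
    · rwa [Pi.single_eq_same]
    · rw [Pi.single_eq_of_ne hne]; exact zero_mem _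

lemma coeff_single_same (g : G) (a : A) (ha : a ∈ α.ideal g) :
    (single g a ha).coeff g = a := by
  classical
  simp [single]

lemma coeff_single_of_ne {g h : G} (hne : h ≠ g) (a : A) (ha : a ∈ α.ideal g) :
    (single g a ha).coeff h = 0 := by
  classical
  simp [single, hne]

/-- The convolution product, determined by
`(a_g u_g) (b_h u_h) = α_g (α_{g⁻¹} (a_g) b_h) u_{gh}`. -/
noncomputable instance [Fintype G] : Mul (CrossedProduct α) where
  mul x y := ofCoeff
    (fun k => ∑ g, α.act g (α.act g⁻¹ (x.coeff g) * y.coeff (g⁻¹ * k)))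
    fun k => sum_mem fun g _ => by
      have := α.conv_mem g (g⁻¹ * k) (x.coeff g) (y.coeff_mem _)
      rwa [mul_inv_cancel_left] at this

/-- The involution, determined by `(a_g u_g)^* = α_{g⁻¹} (a_g^*) u_{g⁻¹}`. -/
noncomputable instance : Star (CrossedProduct α) where
  star x := ofCoeff (fun k => α.act k (star (x.coeff k⁻¹))) fun _ => α.act_mem _ _

lemma coeff_mul [Fintype G] (x y : CrossedProduct α) (k : G) :
    (x * y).coeff k = ∑ g, α.conv g (x.coeff g) (y.coeff (g⁻¹ * k)) := rfl

lemma coeff_star (x : CrossedProduct α) (k : G) :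
    (star x).coeff k = α.act k (star (x.coeff k⁻¹)) := rfl

variable [Fintype G]

protected lemma mul_assoc (x y z : CrossedProduct α) : x * y * z = x * (y * z) := by
  ext k
  simp only [coeff_mul]
  have h1 : ∀ m, α.conv m (∑ g, α.conv g (x.coeff g) (y.coeff (g⁻¹ * m))) (z.coeff (m⁻¹ * k)) =
      ∑ g, α.conv m (α.conv g (x.coeff g) (y.coeff (g⁻¹ * m))) (z.coeff (m⁻¹ * k)) := fun m =>
    α.conv_sum_left m _ _ _ fun g => by
      have := α.conv_mem g (g⁻¹ * m) (x.coeff g) (y.coeff_mem _)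
      rwa [mul_inv_cancel_left] at this
  simp only [h1, α.conv_sum_right]
  rw [Finset.sum_comm]
  refine Finset.sum_congr rfl fun g _ => ?_
  rw [← Equiv.sum_comp (Equiv.mulLeft g)]
  refine Finset.sum_congr rfl fun h _ => ?_
  simp only [Equiv.coe_mulLeft, inv_mul_cancel_left, mul_inv_rev, mul_assoc]
  exact α.conv_assoc _ (y.coeff_mem h)

protected lemma star_mul (x y : CrossedProduct α) : star (x * y) = star y * star x := by
  ext k
  simp only [coeff_mul, coeff_star, star_sum]
  rw [α.act_sum]
  · rw [← Equiv.sum_comp (Equiv.mulLeft k⁻¹)]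
    refine Finset.sum_congr rfl fun h _ => ?_
    have := α.act_star_conv (x.coeff_mem (k⁻¹ * h)) (y.coeff_mem h⁻¹)
    simpa only [Equiv.coe_mulLeft, mul_inv_rev, inv_inv, mul_inv_cancel_right] using this
  · intro g
    have := α.conv_mem g (g⁻¹ * k⁻¹) (x.coeff g) (y.coeff_mem _)
    rw [mul_inv_cancel_left] at this
    exact star_mem this


/-! #### A C⋆-norm from the Hilbert `A`-module `⨁_g A_g` -/

lemma coeff_mul_star_one (x y : CrossedProduct α) :
    (x * star y).coeff 1 = ∑ g, x.coeff g * star (y.coeff g) := by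
  rw [coeff_mul]
  refine Finset.sum_congr rfl fun g _ => ?_
  rw [coeff_star, mul_one, inv_inv, α.conv_act_star (x.coeff_mem g) (y.coeff_mem g)]

/-- The norm of the Hilbert module `⨁_g A_g`. -/
noncomputable def hnorm (x : CrossedProduct α) : ℝ := √‖∑ g, x.coeff g * star (x.coeff g)‖

lemma hnorm_nonneg (x : CrossedProduct α) : 0 ≤ hnorm x := Real.sqrt_nonneg _

lemma hnorm_sq (x : CrossedProduct α) : hnorm x ^ 2 = ‖(x * star x).coeff 1‖ := by
  rw [coeff_mul_star_one, hnorm, Real.sq_sqrt (norm_nonneg _)]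

lemma norm_inner_le_hnorm (x y : CrossedProduct α) :
    ‖(x * star y).coeff 1‖ ≤ hnorm x * hnorm y := by
  let := CStarAlgebra.spectralOrder A
  have := CStarAlgebra.spectralOrderedRing A
  have h := CStarModule.norm_inner_le (A := A) (WithCStarModule A (G → A))
    (x := (WithCStarModule.equiv A (G → A)).symm y.coeff)
    (y := (WithCStarModule.equiv A (G → A)).symm x.coeff)
  rw [coeff_mul_star_one, mul_comm]
  exact h

lemma hnorm_add_le (x y : CrossedProduct α) : hnorm (x + y) ≤ hnorm x + hnorm y := by
  let := CStarAlgebra.spectralOrder A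
  have := CStarAlgebra.spectralOrderedRing A
  exact CStarModule.norm_triangle A (E := WithCStarModule A (G → A))
    ((WithCStarModule.equiv A (G → A)).symm x.coeff)
    ((WithCStarModule.equiv A (G → A)).symm y.coeff)

lemma norm_coeff_le_hnorm (x : CrossedProduct α) (g : G) : ‖x.coeff g‖ ≤ hnorm x := by
  let := CStarAlgebra.spectralOrder A
  have := CStarAlgebra.spectralOrderedRing A
  exact WithCStarModule.norm_apply_le_norm ((WithCStarModule.equiv A (G → A)).symm x.coeff) g

lemma hnorm_le_sum (x : CrossedProduct α) : hnorm x ≤ ∑ g, ‖x.coeff g‖ := by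
  let := CStarAlgebra.spectralOrder A
  have := CStarAlgebra.spectralOrderedRing A
  exact WithCStarModule.pi_norm_le_sum_norm ((WithCStarModule.equiv A (G → A)).symm x.coeff)

lemma hnorm_smul (c : ℂ) (x : CrossedProduct α) : hnorm (c • x) = ‖c‖ * hnorm x := by
  have : ∑ g, (c • x).coeff g * star ((c • x).coeff g) =
      (c * star c) • ∑ g, x.coeff g * star (x.coeff g) := by
    rw [Finset.smul_sum]
    refine Finset.sum_congr rfl fun g _ => ?_
    rw [coeff_smul, star_smul, smul_mul_assoc, mul_smul_comm, smul_smul]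
  rw [hnorm, this, norm_smul, norm_mul, norm_star, Real.sqrt_mul (by positivity),
    Real.sqrt_mul_self (norm_nonneg c), hnorm]

noncomputable instance : NonUnitalRing (CrossedProduct α) where
  left_distrib x y z := by
    ext k; simp [coeff_mul, conv_add_right, Finset.sum_add_distrib]
  right_distrib x y z := by
    ext k
    simp only [coeff_mul, coeff_add, ← Finset.sum_add_distrib]
    exact Finset.sum_congr rfl fun g _ => α.conv_add_left _ (x.coeff_mem g) (y.coeff_mem g)
  zero_mul x := by ext k; simp [coeff_mul]
  mul_zero x := by ext k; simp [coeff_mul]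
  mul_assoc := CrossedProduct.mul_assoc

noncomputable instance : StarRing (CrossedProduct α) where
  star_involutive x := by
    ext k
    rw [coeff_star, coeff_star, ← α.act_star (star_mem (by rw [inv_inv]; exact x.coeff_mem _)),
      star_star, inv_inv, α.act_act_inv (x.coeff_mem k)]
  star_mul := CrossedProduct.star_mul
  star_add x y := by
    ext k
    rw [coeff_star, coeff_add, coeff_add, star_add,
      α.act_add (star_mem (x.coeff_mem _)) (star_mem (y.coeff_mem _)), coeff_star, coeff_star]

instance : StarModule ℂ (CrossedProduct α) where
  star_smul c x := by
    ext k
    rw [coeff_star, coeff_smul, star_smul, α.act_smul _ (star_mem (x.coeff_mem _)), coeff_smul,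
      coeff_star]

instance : IsScalarTower ℂ (CrossedProduct α) (CrossedProduct α) where
  smul_assoc c x y := by
    ext k
    simp only [smul_eq_mul, coeff_mul, coeff_smul, Finset.smul_sum]
    exact Finset.sum_congr rfl fun g _ => α.conv_smul_left c _ (x.coeff_mem g)

instance : SMulCommClass ℂ (CrossedProduct α) (CrossedProduct α) where
  smul_comm c x y := by
    ext k
    simp only [smul_eq_mul, coeff_mul, coeff_smul, Finset.smul_sum, conv_smul_right]

lemma hnorm_mul_le (x b : CrossedProduct α) :
    hnorm (x * b) ≤ (Fintype.card G * ∑ g, ‖b.coeff g‖) * hnorm x := by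
  refine (hnorm_le_sum _).trans ?_
  have h1 : ∀ k, ‖(x * b).coeff k‖ ≤ ∑ g, hnorm x * ‖b.coeff (g⁻¹ * k)‖ := by
    intro k
    rw [coeff_mul]
    refine (norm_sum_le _ _).trans (Finset.sum_le_sum fun g _ => ?_)
    refine (α.norm_conv_le _ (x.coeff_mem g)).trans ?_
    gcongr
    exact norm_coeff_le_hnorm x g
  refine (Finset.sum_le_sum fun k _ => h1 k).trans (le_of_eq ?_)
  rw [Finset.sum_comm]
  have h2 : ∀ g : G, ∑ k, hnorm x * ‖b.coeff (g⁻¹ * k)‖ = hnorm x * ∑ k, ‖b.coeff k‖ := by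
    intro g
    rw [← Finset.mul_sum]
    congr 1
    exact Equiv.sum_comp (Equiv.mulLeft g⁻¹) (fun k => ‖b.coeff k‖)
  simp only [h2, Finset.sum_const, Finset.card_univ, nsmul_eq_mul]
  ring

/-- The norm of right multiplication by `b` on the Hilbert module `⨁_g A_g`. -/
noncomputable def redNorm (b : CrossedProduct α) : ℝ :=
  sInf {c : ℝ | 0 ≤ c ∧ ∀ x : CrossedProduct α, hnorm (x * b) ≤ c * hnorm x}

lemma redNorm_nonempty (b : CrossedProduct α) :
    {c : ℝ | 0 ≤ c ∧ ∀ x : CrossedProduct α, hnorm (x * b) ≤ c * hnorm x}.Nonempty :=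
  ⟨_, by positivity, fun x => hnorm_mul_le x b⟩

lemma redNorm_nonneg (b : CrossedProduct α) : 0 ≤ redNorm b :=
  Real.sInf_nonneg fun _ h => h.1

lemma redNorm_le {b : CrossedProduct α} {c : ℝ} (hc : 0 ≤ c)
    (h : ∀ x : CrossedProduct α, hnorm (x * b) ≤ c * hnorm x) : redNorm b ≤ c :=
  csInf_le ⟨0, fun _ h => h.1⟩ ⟨hc, h⟩

lemma hnorm_mul_le_redNorm (x b : CrossedProduct α) : hnorm (x * b) ≤ redNorm b * hnorm x := by
  rcases (hnorm_nonneg x).eq_or_lt with h0 | hpos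
  · have := hnorm_mul_le x b
    rwa [← h0, mul_zero] at this ⊢
  · rw [← div_le_iff₀ hpos]
    refine le_csInf (redNorm_nonempty b) fun c hc => ?_
    rw [div_le_iff₀ hpos]
    exact hc.2 x

lemma redNorm_add_le (a b : CrossedProduct α) : redNorm (a + b) ≤ redNorm a + redNorm b := by
  refine redNorm_le (add_nonneg (redNorm_nonneg a) (redNorm_nonneg b)) fun x => ?_
  rw [mul_add, add_mul]
  exact (hnorm_add_le _ _).trans (add_le_add (hnorm_mul_le_redNorm x a) (hnorm_mul_le_redNorm x b))

lemma redNorm_smul_le (c : ℂ) (a : CrossedProduct α) : redNorm (c • a) ≤ ‖c‖ * redNorm a := by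
  refine redNorm_le (mul_nonneg (norm_nonneg c) (redNorm_nonneg a)) fun x => ?_
  rw [mul_smul_comm, hnorm_smul, mul_assoc]
  exact mul_le_mul_of_nonneg_left (hnorm_mul_le_redNorm x a) (norm_nonneg c)

lemma redNorm_mul_le (a b : CrossedProduct α) : redNorm (a * b) ≤ redNorm a * redNorm b := by
  refine redNorm_le (mul_nonneg (redNorm_nonneg a) (redNorm_nonneg b)) fun x => ?_
  rw [← mul_assoc]
  refine (hnorm_mul_le_redNorm _ b).trans ?_
  rw [mul_comm (redNorm a), mul_assoc]
  exact mul_le_mul_of_nonneg_left (hnorm_mul_le_redNorm x a) (redNorm_nonneg b)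

lemma redNorm_sq_le (b : CrossedProduct α) : redNorm b ^ 2 ≤ redNorm (b * star b) := by
  rw [← Real.le_sqrt (redNorm_nonneg b) (redNorm_nonneg _)]
  refine redNorm_le (Real.sqrt_nonneg _) fun x => ?_
  refine le_of_sq_le_sq ?_ (mul_nonneg (Real.sqrt_nonneg _) (hnorm_nonneg x))
  rw [mul_pow, Real.sq_sqrt (redNorm_nonneg _), hnorm_sq]
  have h : x * b * star (x * b) = (x * (b * star b)) * star x := by
    simp only [StarMul.star_mul, _root_.mul_assoc]
  rw [h]
  refine (norm_inner_le_hnorm _ _).trans ?_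
  rw [sq, ← _root_.mul_assoc (redNorm _)]
  exact mul_le_mul_of_nonneg_right (hnorm_mul_le_redNorm _ _) (hnorm_nonneg x)

lemma redNorm_star (b : CrossedProduct α) : redNorm (star b) = redNorm b := by
  have key : ∀ b : CrossedProduct α, redNorm b ≤ redNorm (star b) := by
    intro b
    rcases (redNorm_nonneg b).eq_or_lt with h0 | hpos
    · rw [← h0]; exact redNorm_nonneg _
    · have := (redNorm_sq_le b).trans (redNorm_mul_le b (star b))
      rw [sq] at this
      exact le_of_mul_le_mul_left this hpos
  refine le_antisymm ?_ (key b)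
  simpa using key (star b)

lemma redNorm_le_sum (b : CrossedProduct α) :
    redNorm b ≤ Fintype.card G * ∑ g, ‖b.coeff g‖ :=
  redNorm_le (by positivity) fun x => hnorm_mul_le x b

lemma norm_coeff_le_redNorm (b : CrossedProduct α) (g : G) : ‖b.coeff g‖ ≤ redNorm b := by
  set a := b.coeff g with ha
  rcases (norm_nonneg a).eq_or_lt with h0 | hpos
  · rw [← h0]; exact redNorm_nonneg b
  set ξ : CrossedProduct α := single 1 (star a) (α.mem_one _) with hξ
  have h1 : hnorm ξ ≤ ‖a‖ := by
    refine (hnorm_le_sum ξ).trans (le_of_eq ?_)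
    rw [Finset.sum_eq_single 1]
    · rw [hξ, coeff_single_same, norm_star]
    · intro h _ hne
      rw [hξ, coeff_single_of_ne hne, norm_zero]
    · simp
  have h2 : (ξ * b).coeff g = star a * a := by
    rw [coeff_mul, Finset.sum_eq_single 1]
    · rw [hξ, coeff_single_same, conv_one, inv_one, one_mul]
    · intro h _ hne
      rw [hξ, coeff_single_of_ne hne, conv_zero_left]
    · simp
  have h3 := (norm_coeff_le_hnorm (ξ * b) g).trans (hnorm_mul_le_redNorm ξ b)
  rw [h2, CStarRing.norm_star_mul_self] at h3
  refine le_of_mul_le_mul_right (h3.trans ?_) hpos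
  exact mul_le_mul_of_nonneg_left h1 (redNorm_nonneg b)

/-- The axioms of a C⋆-norm on the crossed product, equivalent to the maximum of the norms of the
coefficients. -/
structure IsCStarNorm (N : CrossedProduct α → ℝ) : Prop where
  smul : ∀ (c : ℂ) x, N (c • x) = ‖c‖ * N x
  add_le : ∀ x y, N (x + y) ≤ N x + N y
  mul_le : ∀ x y, N (x * y) ≤ N x * N y
  star_mul_self : ∀ x, N x * N x ≤ N (star x * x)
  coeff_le : ∀ x g, ‖x.coeff g‖ ≤ N x
  le_sum : ∀ x, N x ≤ Fintype.card G * ∑ g, ‖x.coeff g‖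

lemma isCStarNorm_redNorm : IsCStarNorm (redNorm : CrossedProduct α → ℝ) where
  smul c x := by
    refine le_antisymm (redNorm_smul_le c x) ?_
    rcases eq_or_ne c 0 with rfl | hc
    · simpa using redNorm_nonneg _
    · have := redNorm_smul_le c⁻¹ (c • x)
      rw [smul_smul, inv_mul_cancel₀ hc, one_smul, norm_inv] at this
      rwa [← le_inv_mul_iff₀ (norm_pos_iff.2 hc)]
  add_le := redNorm_add_le
  mul_le := redNorm_mul_le
  star_mul_self x := by
    have := redNorm_sq_le (star x)
    rwa [redNorm_star, star_star, sq] at this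
  coeff_le := norm_coeff_le_redNorm
  le_sum := redNorm_le_sum

/-- A C⋆-norm turns the crossed product into a C⋆-algebra: it is automatically complete. -/
@[reducible] noncomputable def IsCStarNorm.cstarAlgebra {N : CrossedProduct α → ℝ}
    (hN : IsCStarNorm N) : NonUnitalCStarAlgebra (CrossedProduct α) :=
  letI : Norm (CrossedProduct α) := ⟨N⟩
  have core : NormedSpace.Core ℂ (CrossedProduct α) :=
    { norm_nonneg := fun x => (norm_nonneg _).trans (hN.coeff_le x 1)
      norm_smul := hN.smul
      norm_triangle := hN.add_le
      norm_eq_zero_iff := fun x => by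
        constructor
        · intro h
          ext g
          have := hN.coeff_le x g
          rw [show N x = 0 from h] at this
          simpa using this
        · rintro rfl
          have := hN.smul 0 0
          rwa [norm_zero, zero_mul, zero_smul] at this }
  letI n : NormedAddCommGroup (CrossedProduct α) := NormedAddCommGroup.ofCore core
  letI : NormedSpace ℂ (CrossedProduct α) := NormedSpace.ofCore core
  haveI : CompleteSpace (CrossedProduct α) := by
    have := fun g => α.isClosed_ideal g
    have := fun g => (α.isClosed_ideal g).completeSpace_coe
    let e : CrossedProduct α ≃ₗ[ℂ] (∀ g, α.ideal g) :=
      { toFun := fun x => x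
        invFun := fun x => x
        map_add' := fun _ _ => rfl
        map_smul' := fun _ _ => rfl
        left_inv := fun _ => rfl
        right_inv := fun _ => rfl }
    let E := e.toContinuousLinearEquivOfBounds 1 (Fintype.card G * Fintype.card G)
      (fun x => by
        rw [one_mul, pi_norm_le_iff_of_nonneg (norm_nonneg x)]
        exact fun g => hN.coeff_le x g)
      (fun x => by
        refine (hN.le_sum _).trans ?_
        rw [_root_.mul_assoc]
        refine mul_le_mul_of_nonneg_left ?_ (by positivity)
        refine (Finset.sum_le_sum fun g _ => norm_le_pi_norm x g).trans ?_
        simp)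
    exact (completeSpace_congr (e := E.toEquiv) E.isUniformEmbedding).2 inferInstance
  { n, (inferInstance : NonUnitalRing (CrossedProduct α)),
    (inferInstance : StarRing (CrossedProduct α)),
    (inferInstance : NormedSpace ℂ (CrossedProduct α)) with
    norm_mul_le := hN.mul_le
    norm_mul_self_le := hN.star_mul_self
    complete := CompleteSpace.complete
    smul_assoc := smul_assoc
    smul_comm := smul_comm
    star_smul := star_smul }

/-- The universal C⋆-norm of the crossed product: the supremum of `‖φ x‖` over all
star-homomorphisms `φ` from the convolution algebra to C⋆-algebras. As `G` is finite, the
convolution algebra is already complete in it and carries no other C⋆-norm, so that this is at the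
same time the norm from covariant representations and the reduced norm. -/
noncomputable def univNorm {G : Type u} {A : Type v} [Group G] [NonUnitalCStarAlgebra A]
    {α : PartialAction G A} [Fintype G] (x : CrossedProduct α) : ℝ :=
  sSup {r : ℝ | ∃ (B : Type (max u v)) (_ : NonUnitalCStarAlgebra B)
    (φ : CrossedProduct α →⋆ₙₐ[ℂ] B), ‖φ x‖ = r}

lemma univNorm_eq_redNorm : (univNorm : CrossedProduct α → ℝ) = redNorm := by
  funext x
  let I : NonUnitalCStarAlgebra (CrossedProduct α) := isCStarNorm_redNorm.cstarAlgebra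
  refine le_antisymm (csSup_le ⟨_, CrossedProduct α, I, NonUnitalStarAlgHom.id ℂ _, rfl⟩ ?_)
    (le_csSup ⟨redNorm x, ?_⟩ ⟨CrossedProduct α, I, NonUnitalStarAlgHom.id ℂ _, rfl⟩)
  · rintro r ⟨B, hB, φ, rfl⟩
    exact NonUnitalStarAlgHom.norm_apply_le φ x
  · rintro r ⟨B, hB, φ, rfl⟩
    exact NonUnitalStarAlgHom.norm_apply_le φ x

lemma isCStarNorm_univNorm : IsCStarNorm (univNorm : CrossedProduct α → ℝ) := by
  rw [univNorm_eq_redNorm]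
  exact isCStarNorm_redNorm

/-- The partial crossed product `A ⋊_α G` of a C⋆-algebra by a partial action of a finite group,
as a C⋆-algebra. -/
noncomputable instance : NonUnitalCStarAlgebra (CrossedProduct α) :=
  isCStarNorm_univNorm.cstarAlgebra

lemma norm_eq_univNorm (x : CrossedProduct α) : ‖x‖ = univNorm x := rfl

end CrossedProduct

end CrossedProduct

section DualAction

variable {G : Type*} {A : Type*} [CommGroup G] [Fintype G] [NonUnitalCStarAlgebra A]
  (α : PartialAction G A)

/-- The map `α̂_χ (a_g u_g) = χ(g) a_g u_g` on the partial crossed product. -/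
noncomputable def dualFun (χ : G →* Circle) (x : CrossedProduct α) : CrossedProduct α :=
  CrossedProduct.ofCoeff (fun g => (χ g : ℂ) • x.coeff g)
    fun g => SMulMemClass.smul_mem _ (x.coeff_mem g)

@[simp] lemma coeff_dualFun (χ : G →* Circle) (x : CrossedProduct α) (g : G) :
    (α.dualFun χ x).coeff g = (χ g : ℂ) • x.coeff g := rfl

/-- The automorphism `α̂_χ (a_g u_g) = χ(g) a_g u_g` of the partial crossed product. -/
noncomputable def dualAut (χ : G →* Circle) : CrossedProduct α ≃⋆ₐ[ℂ] CrossedProduct α where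
  toFun := α.dualFun χ
  invFun := α.dualFun χ⁻¹
  left_inv x := by ext g; simp [smul_smul]
  right_inv x := by ext g; simp [smul_smul]
  map_add' x y := by
    ext g
    rw [coeff_dualFun, CrossedProduct.coeff_add, smul_add]
    rfl
  map_mul' x y := by
    ext k
    rw [coeff_dualFun, CrossedProduct.coeff_mul, CrossedProduct.coeff_mul, Finset.smul_sum]
    refine Finset.sum_congr rfl fun g _ => ?_
    rw [coeff_dualFun, coeff_dualFun, α.conv_smul_left _ _ (x.coeff_mem g), α.conv_smul_right,
      smul_smul, ← Circle.coe_mul, ← map_mul, mul_inv_cancel_left]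
  map_smul' c x := by
    ext g
    rw [coeff_dualFun, CrossedProduct.coeff_smul, smul_comm]
    rfl
  map_star' x := by
    ext k
    rw [coeff_dualFun, CrossedProduct.coeff_star, CrossedProduct.coeff_star, coeff_dualFun,
      star_smul, α.act_smul _ (star_mem (x.coeff_mem _)), map_inv, Circle.coe_inv_eq_conj]
    simp

@[simp] lemma coeff_dualAut (χ : G →* Circle) (x : CrossedProduct α) (g : G) :
    (α.dualAut χ x).coeff g = (χ g : ℂ) • x.coeff g := rfl

/-- The dual action of the group `Ĝ` of characters of `G` on `A ⋊_α G`, a global action: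
all its ideals are the whole algebra. -/
noncomputable def dualAction : PartialAction (G →* Circle) (CrossedProduct α) where
  ideal _ := ⊤
  isClosed_ideal _ := by rw [NonUnitalStarAlgebra.coe_top]; exact isClosed_univ
  mul_mem_left _ _ _ _ := NonUnitalStarAlgebra.mem_top
  mul_mem_right _ _ _ _ := NonUnitalStarAlgebra.mem_top
  equiv χ :=
    { toFun := fun x => ⟨α.dualAut χ x, NonUnitalStarAlgebra.mem_top⟩
      invFun := fun x => ⟨(α.dualAut χ).symm x, NonUnitalStarAlgebra.mem_top⟩
      left_inv := fun x => Subtype.ext ((α.dualAut χ).symm_apply_apply x)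
      right_inv := fun x => Subtype.ext ((α.dualAut χ).apply_symm_apply x)
      map_mul' := fun x y => Subtype.ext (map_mul (α.dualAut χ) (x : CrossedProduct α) y)
      map_add' := fun x y => Subtype.ext (map_add (α.dualAut χ) (x : CrossedProduct α) y)
      map_star' := fun x => Subtype.ext (map_star (α.dualAut χ) (x : CrossedProduct α))
      map_smul' := fun c x => Subtype.ext (map_smul (α.dualAut χ) c (x : CrossedProduct α)) }
  ideal_one := rfl
  equiv_one x := by
    change α.dualAut 1 (x : CrossedProduct α) = x
    ext g; simp
  equiv_mul χ τ x y h := by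
    refine ⟨NonUnitalStarAlgebra.mem_top, ?_⟩
    change α.dualAut τ (x : CrossedProduct α) = y at h
    change α.dualAut (χ * τ) (x : CrossedProduct α) = α.dualAut χ (y : CrossedProduct α)
    rw [← h]
    ext g
    simp [smul_smul]

lemma dualAction_act (χ : G →* Circle) (x : CrossedProduct α) :
    α.dualAction.act χ x = α.dualAut χ x :=
  α.dualAction.act_of_mem NonUnitalStarAlgebra.mem_top

instance finite_dual (G : Type*) [CommGroup G] [Finite G] : Finite (G →* Circle) := by
  have : Function.Injective fun χ : G →* Circle => (Circle.toUnits.comp χ : G →* ℂˣ) := by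
    intro χ τ h
    ext g
    exact congrArg Units.val (DFunLike.congr_fun h g)
  exact Finite.of_injective _ this

noncomputable instance fintype_dual (G : Type*) [CommGroup G] [Finite G] :
    Fintype (G →* Circle) := Fintype.ofFinite _

end DualAction

section Dimensions

variable {G : Type*} {A : Type*} [Group G] [Fintype G] [NonUnitalCStarAlgebra A]
  (α : PartialAction G A)

/-- `α` has Rokhlin dimension at most `d`. Positivity of an element `f` of a C⋆-algebra is expressed
as `f = b^* b` for some `b`. -/
def RokhlinDimLE (d : ℕ) : Prop :=
  ∀ ε : ℝ, 0 < ε → ∀ F : Finset A, ∃ f : Fin (d + 1) → G → A,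
    (∀ j g, f j g ∈ α.ideal g ∧ (∃ b : A, f j g = star b * b) ∧ ‖f j g‖ ≤ 1) ∧
    (∀ j g h, g ≠ h → ∀ a ∈ F, ‖f j g * f j h * a‖ < ε) ∧
    (∀ j g, ∀ a ∈ F, ∀ b ∈ F, ‖(f j g * b - b * f j g) * a‖ < ε) ∧
    (∀ a ∈ F, ‖(∑ j, ∑ g, f j g) * a - a‖ < ε) ∧
    (∀ j g h, ∀ a ∈ F, ∀ x ∈ F, x ∈ α.ideal g⁻¹ →
      ‖(α.act g (f j h * x) - f j (g * h) * α.act g x) * a‖ < ε)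

/-- The Rokhlin dimension: the least `d` such that `α` has Rokhlin dimension at most `d`, and `∞`
if there is none. -/
noncomputable def rokhlinDim : ℕ∞ := sInf {n : ℕ∞ | ∃ d : ℕ, α.RokhlinDimLE d ∧ n = d}

/-- `α` is approximately representable with `d` colors (indexed by `0, …, d`). -/
def ApproxRepresentable (d : ℕ) : Prop :=
  ∀ ε : ℝ, 0 < ε → ∀ F : Finset A, ∃ x : Fin (d + 1) → G → A,
    (∀ j g, x j g ∈ α.ideal g⁻¹ ∧ ‖x j g‖ ≤ 1) ∧
    (∀ j, ∃ b : A, x j 1 = star b * b) ∧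
    (∀ j g, ∀ b ∈ F, ‖(star (x j g) * x j g - x j g * star (x j g)) * b‖ < ε) ∧
    (∀ j g h, ∀ b ∈ F, ‖(x j g * x j h - x j 1 * x j (g * h)) * b‖ < ε) ∧
    (∀ j g h, ∀ a ∈ F, a ∈ α.ideal g⁻¹ → ∀ b ∈ F,
      ‖(α.act g (a * x j h) - α.act g a * x j (g * h * g⁻¹)) * b‖ < ε) ∧
    (∀ b ∈ F, ‖(∑ j, x j 1) * b - b‖ < ε) ∧
    (∀ j g, ∀ b ∈ F, b ∈ α.ideal g⁻¹ → ‖x j g * b - α.act g b * x j g‖ < ε)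

/-- The representability dimension: the least `d` such that `α` is approximately representable
with `d` colors, and `∞` if there is none. -/
noncomputable def reprDim : ℕ∞ := sInf {n : ℕ∞ | ∃ d : ℕ, α.ApproxRepresentable d ∧ n = d}

end Dimensions

end PartialAction

/-!
The two dimensions agree level by level: for every `d` the dual action has Rokhlin dimension at
most `d` if and only if `α` is approximately representable with `d + 1` colours. Quantifying over a
tolerance and a finite test set is replaced by limits along `ℕ × Finset A`. The bridge between the
two sides is the crossed product `B`: the elements `x_g` of a representation give
`v_g = x_g u_{g⁻¹}`, the elements `f_χ` of a Rokhlin tower give their Fourier transform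
`v_g = ∑_χ χ(g) f_χ`, and in both cases `v` is an *asymptotic representation* (`AsympRep`) of `G`:
asymptotically central, asymptotically normal, with `v_g v_h ≈ v_1 v_{gh}`.

*Asymptotic representations.* Modulo the nets `y` with `y b → 0` for all `b ∈ B`, the bounded
asymptotically central nets in the unitization form a star-ring in which the relations hold
exactly. There `v_g ^ n = v_1 ^ n` for `n = |G|`, whence `v_g⋆ v_g = v_1²` by uniqueness of roots
(`map_star_mul_self_eq_of_pow_eq`), and then `v_g⋆ = v_{g⁻¹}` (`AsympRep.mk_star`). So `v` has
spectral elements `g_χ = |G|⁻¹ ∑_g χ̄(g) v_g`, which are self-adjoint and orthogonal, satisfy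
`g_χ² = v_1 g_χ` and add up to `v_1`.

*From representations to towers.* For `v_g = x_g u_{g⁻¹}` the relation `x_g b ≈ α_g(b) x_g` becomes
centrality (`LimitRep.asympRep_single`), and the dual action permutes the spectral elements. They
need not be positive, but a self-adjoint `r` with `r² ≈ v r` for some `v ≥ 0` is close to its
positive part (`norm_negPart_sq_le`). The relation holds in norm only after cutting down by an
invariant approximate unit, and the positive parts of the cut-down elements form the towers
(`exists_rokhlin_towers`).

*From towers to representations.* A tower may be taken to be an orbit of the dual action
(`exists_limit_towers`), so that its Fourier transform is homogeneous, that is of the form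
`x_g u_{g⁻¹}`. The `x_g` satisfy all relations in the limit, but are contractions only
asymptotically, because of `v_g⋆ v_g ≈ v_1² ≈ ∑_χ f_χ² ≤ v_1` (`eventually_norm_charNet_mul_lt`);
cutting them down by an invariant approximate unit of `A` and rescaling slightly makes them
contractions (`approxRepresentable_of_limitRep`).

Either dimension being finite forces `A_g = A` for all `g`: for every colour `x_1² b` is close to
`x_{g⁻¹} x_g b`, respectively to its analogue in the crossed product, and so to the ideal `A_g`;
hence `x_1 b` is close to `A_g`, and so is `b` itself (`PartialAction.mem_ideal_of_tendsto`). All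
computations in the crossed product therefore take place for a global action.
-/

open Filter Topology

/-! ### Characters of a finite abelian group -/

section Characters

lemma star_character {G : Type*} [CommGroup G] (χ : G →* Circle) (g : G) :
    star (χ g : ℂ) = (χ g⁻¹ : ℂ) := by
  rw [map_inv, Circle.coe_inv_eq_conj]; rfl

variable {G : Type*} [CommGroup G] [Fintype G]

lemma sum_character_eq_ite [DecidableEq (G →* Circle)] (χ : G →* Circle) :
    ∑ g, (χ g : ℂ) = if χ = 1 then (Fintype.card G : ℂ) else 0 := by
  split_ifs with h
  · simp [h]
  · obtain ⟨a, ha⟩ : ∃ a, χ a ≠ 1 := by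
      by_contra! hc
      exact h (MonoidHom.ext hc)
    have h1 : (χ a : ℂ) * ∑ g, (χ g : ℂ) = ∑ g, (χ g : ℂ) := by
      rw [Finset.mul_sum, ← Equiv.sum_comp (Equiv.mulLeft a) (fun g => (χ g : ℂ))]
      simp
    have h2 : (χ a : ℂ) - 1 ≠ 0 := fun h0 => ha (Circle.ext (by simpa using sub_eq_zero.1 h0))
    refine (mul_eq_zero.1 ?_).resolve_left h2
    rw [sub_mul, h1, one_mul, sub_self]

lemma sum_dual_apply_eq_ite [DecidableEq G] (g : G) :
    ∑ χ : G →* Circle, (χ g : ℂ) =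
      if g = 1 then (Fintype.card (G →* Circle) : ℂ) else 0 := by
  split_ifs with h
  · simp [h]
  · obtain ⟨τ, hτ⟩ :=
      CommGroup.exists_apply_ne_one_of_hasEnoughRootsOfUnity G Circle (a := g) h
    set σ : G →* Circle := (Units.coeHom Circle).comp τ with hσ
    have hσg : σ g ≠ 1 := fun h0 => hτ (Units.ext h0)
    have h1 : (σ g : ℂ) * ∑ χ : G →* Circle, (χ g : ℂ) = ∑ χ : G →* Circle, (χ g : ℂ) := by
      rw [Finset.mul_sum,
        ← Equiv.sum_comp (Equiv.mulLeft σ) (fun χ : G →* Circle => (χ g : ℂ))]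
      simp
    have h2 : (σ g : ℂ) - 1 ≠ 0 := fun h0 => hσg (Circle.ext (by simpa using sub_eq_zero.1 h0))
    refine (mul_eq_zero.1 ?_).resolve_left h2
    rw [sub_mul, h1, one_mul, sub_self]

lemma card_dual_eq_card : Fintype.card (G →* Circle) = Fintype.card G := by
  classical
  have h : ∑ χ : G →* Circle, ∑ g, (χ g : ℂ) = ∑ g, ∑ χ : G →* Circle, (χ g : ℂ) :=
    Finset.sum_comm
  simp only [sum_character_eq_ite, sum_dual_apply_eq_ite, Finset.sum_ite_eq',
    Finset.mem_univ, if_true] at h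
  exact_mod_cast h.symm

end Characters

/-! ### Uniqueness of roots -/

section Roots

variable {D R : Type*} [Ring D] [StarRing D] [Ring R]

/-- Uniqueness of positive roots, in a quotient of a star-ring: if `v` is normal and commutes with
the self-adjoint element `q`, and `v ^ m = q ^ m`, then `v⋆ v = q²`. For `z = v⋆ v - q²` the
geometric sum gives `∑ (v ^ k q ^ (m - 1 - k) z)⋆ (v ^ k q ^ (m - 1 - k) z) = 0`, and from the
vanishing of all `v ^ k q ^ l z` with `k + l = j + 1` follows that of those with `k + l = j`. -/
lemma map_star_mul_self_eq_of_pow_eq (π : D →+* R)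
    (hstar : ∀ x, π x = 0 → π (star x) = 0)
    (hpos : ∀ (n : ℕ) (x : ℕ → D), π (∑ k ∈ Finset.range n, star (x k) * x k) = 0 →
      ∀ k < n, π (x k) = 0)
    {v q : D} (hq : star q = q) (hvq : Commute (π v) (π q)) (hvs : Commute (π v) (π (star v)))
    {m : ℕ} (hm : 0 < m) (h : π v ^ m = π q ^ m) : π (star v * v) = π (q * q) := by
  have hstar_eq : ∀ x y, π x = π y → π (star x) = π (star y) := fun x y hxy => by
    have := hstar (x - y) (by rw [map_sub, hxy, sub_self])
    rwa [star_sub, map_sub, sub_eq_zero] at this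
  set V := π v with hV
  set W := π (star v) with hW
  set Q := π q with hQ
  have hWQ : Commute W Q := by
    have := hstar_eq (v * q) (q * v) (by simpa using hvq.eq)
    simp only [star_mul, hq, map_mul] at this
    exact this.symm
  have hWm : W ^ m = Q ^ m := by
    have := hstar_eq (v ^ m) (q ^ m) (by simpa using h)
    simpa only [star_pow, hq, map_pow] using this
  set z := star v * v - q * q with hz
  set Z := π z with hZ
  have hZe : Z = W * V - Q * Q := by simp [hZ, hz, hV, hW, hQ]
  have hzs : star z = z := by simp [hz, hq]
  have hVZ : Commute V Z := by
    rw [hZe]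
    exact (hvs.mul_right (Commute.refl V)).sub_right (hvq.mul_right hvq)
  have hWZ : Commute W Z := by
    rw [hZe]
    exact ((Commute.refl W).mul_right hvs.symm).sub_right (hWQ.mul_right hWQ)
  have hQZ : Commute Q Z := by
    rw [hZe]
    exact (hWQ.symm.mul_right hvq.symm).sub_right
      ((Commute.refl Q).mul_right (Commute.refl Q))
  let x : ℕ → ℕ → D := fun k l => v ^ k * q ^ l * z
  have hx : ∀ k l, π (x k l) = V ^ k * Q ^ l * Z := fun k l => by simp [x, hV, hQ, hZ]
  have hxs : ∀ k l, π (star (x k l)) = Z * (Q ^ l * W ^ k) := fun k l => by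
    simp [x, hzs, hq, hW, hQ, hZ]
  have key : ∀ j, (∀ k l, k + l = j → π (x k l) = 0) → Z = 0 := by
    intro j
    induction j with
    | zero => intro h0; simpa [hx] using h0 0 0 rfl
    | succ j ih =>
      intro h0
      refine ih fun k l hkl => ?_
      have e1 : V ^ k * Q ^ l * Z * Z = 0 := by
        have a1 := h0 (k + 1) l (by omega)
        have a2 := h0 k (l + 1) (by omega)
        rw [hx] at a1 a2
        have b1 : V ^ k * Q ^ l * (W * V) * Z = W * (V ^ (k + 1) * Q ^ l * Z) := by
          have c1 : V ^ k * Q ^ l * (W * V) = W * (V ^ (k + 1) * Q ^ l) := by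
            have d1 : Commute (V ^ k * Q ^ l) W :=
              (hvs.pow_left k).mul_left (hWQ.symm.pow_left l)
            rw [← mul_assoc, d1.eq, mul_assoc, mul_assoc, (hvq.symm.pow_left l).eq,
              ← mul_assoc (V ^ k), ← pow_succ]
          rw [c1, mul_assoc]
        have b2 : V ^ k * Q ^ l * (Q * Q) * Z = Q * (V ^ k * Q ^ (l + 1) * Z) := by
          have c1 : V ^ k * Q ^ l * (Q * Q) = Q * (V ^ k * Q ^ (l + 1)) := by
            have d1 : Commute (V ^ k * Q ^ (l + 1)) Q :=
              (hvq.pow_left k).mul_left ((Commute.refl Q).pow_left _)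
            rw [← d1.eq, pow_succ]
            simp only [mul_assoc]
          rw [c1, mul_assoc]
        have hZZ : V ^ k * Q ^ l * Z * Z =
            V ^ k * Q ^ l * (W * V) * Z - V ^ k * Q ^ l * (Q * Q) * Z := by
          rw [← sub_mul, ← mul_sub, ← hZe]
        rw [hZZ, b1, b2, a1, a2]
        simp
      refine hpos 1 (fun _ => x k l) ?_ 0 one_pos
      rw [Finset.sum_range_one, map_mul, hx, hxs]
      have d2 : Commute Z (Q ^ l * W ^ k) :=
        (hQZ.symm.pow_right l).mul_right (hWZ.symm.pow_right k)
      have d3 : Commute Z (V ^ k * Q ^ l) :=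
        (hVZ.symm.pow_right k).mul_right (hQZ.symm.pow_right l)
      rw [d2.eq, mul_assoc, ← mul_assoc Z, d3.eq, e1, mul_zero]
  have hZ0 : Z = 0 := by
    refine key (m - 1) fun k l hkl => ?_
    have := hpos m (fun k => x k (m - 1 - k)) ?_ k (by omega)
    · simpa [show m - 1 - k = l by omega] using this
    have e2 : ∀ k, π (star (x k (m - 1 - k)) * x k (m - 1 - k)) =
        Z * ((W * V) ^ k * (Q * Q) ^ (m - 1 - k)) * Z := by
      intro k
      generalize m - 1 - k = l
      rw [map_mul, hx, hxs, hvs.symm.mul_pow, (Commute.refl Q).mul_pow]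
      have d1 : Commute (Q ^ l) (W ^ k * V ^ k) :=
        (hWQ.symm.pow_pow l k).mul_right (hvq.symm.pow_pow l k)
      calc Z * (Q ^ l * W ^ k) * (V ^ k * Q ^ l * Z)
          = Z * (Q ^ l * (W ^ k * V ^ k)) * Q ^ l * Z := by simp only [mul_assoc]
        _ = Z * ((W ^ k * V ^ k) * (Q ^ l * Q ^ l)) * Z := by
            rw [d1.eq]; simp only [mul_assoc]
    rw [map_sum, Finset.sum_congr rfl fun k _ => e2 k, ← Finset.sum_mul, ← Finset.mul_sum]
    have d4 : Commute (W * V) (Q * Q) :=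
      (hWQ.mul_right hWQ).mul_left (hvq.mul_right hvq)
    rw [mul_assoc, hZe, d4.geom_sum₂_mul, hvs.symm.mul_pow, (Commute.refl Q).mul_pow, h, hWm,
      sub_self, mul_zero]
  rw [hZ, hz, map_sub, sub_eq_zero] at hZ0
  exact hZ0

end Roots

/-! ### Asymptotically central nets -/

section CentralNets

variable {ι B : Type*} [NonUnitalCStarAlgebra B]

/-- A net in a C⋆-algebra `B` is asymptotically central if it commutes with every element of `B`
in the limit, in norm. -/
def AsympCentral (l : Filter ι) (y : ι → B) : Prop :=
  ∀ b, Tendsto (fun i => y i * b - b * y i) l (𝓝 0)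

/-- A net in a C⋆-algebra `B` is strictly null if its right multiples by elements of `B` tend to
zero in norm. -/
def StrictNull (l : Filter ι) (y : ι → B) : Prop :=
  ∀ b, Tendsto (fun i => y i * b) l (𝓝 0)

/-- The product of a bounded net with a null net is null. -/
lemma tendsto_bdd_mul_zero {E : Type*} [NonUnitalNormedRing E] {l : Filter ι} {x y : ι → E} {C : ℝ}
    (hx : ∀ i, ‖x i‖ ≤ C) (hy : Tendsto y l (𝓝 0)) : Tendsto (fun i => x i * y i) l (𝓝 0) := by
  refine squeeze_zero_norm (a := fun i => C * ‖y i‖)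
    (fun i => (norm_mul_le _ _).trans (mul_le_mul_of_nonneg_right (hx i) (norm_nonneg _))) ?_
  simpa using (tendsto_zero_iff_norm_tendsto_zero.1 hy).const_mul C

lemma tendsto_mul_bdd_zero {E : Type*} [NonUnitalNormedRing E] {l : Filter ι} {x y : ι → E} {C : ℝ}
    (hx : ∀ i, ‖x i‖ ≤ C) (hy : Tendsto y l (𝓝 0)) : Tendsto (fun i => y i * x i) l (𝓝 0) := by
  refine squeeze_zero_norm (a := fun i => ‖y i‖ * C)
    (fun i => (norm_mul_le _ _).trans (mul_le_mul_of_nonneg_left (hx i) (norm_nonneg _))) ?_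
  simpa using (tendsto_zero_iff_norm_tendsto_zero.1 hy).mul_const C

/-- In a C⋆-ring the summands of a null sum of positive elements `x⋆ x` are null. -/
lemma tendsto_zero_of_sum_star_mul_self {E : Type*} [NonUnitalCStarAlgebra E] {l : Filter ι}
    {κ : Type*} {s : Finset κ} {x : κ → ι → E}
    (h : Tendsto (fun i => ∑ k ∈ s, star (x k i) * x k i) l (𝓝 0)) {k : κ} (hk : k ∈ s) :
    Tendsto (x k) l (𝓝 0) := by
  let := CStarAlgebra.spectralOrder E
  have := CStarAlgebra.spectralOrderedRing E
  have h1 : Tendsto (fun i => ‖x k i‖ * ‖x k i‖) l (𝓝 0) := by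
    refine squeeze_zero (fun i => by positivity) (fun i => ?_)
      (tendsto_zero_iff_norm_tendsto_zero.1 h)
    rw [← CStarRing.norm_star_mul_self]
    exact CStarAlgebra.norm_le_norm_of_nonneg_of_le (star_mul_self_nonneg _)
      (Finset.single_le_sum (f := fun k => star (x k i) * x k i)
        (fun k _ => star_mul_self_nonneg _) hk)
  rw [tendsto_zero_iff_norm_tendsto_zero]
  have h2 := h1.sqrt
  simpa using h2

variable (B) in
/-- The star-algebra of bounded nets in the unitization of `B` that are asymptotically central
with respect to `B`. -/
noncomputable def centralNets (l : Filter ι) : StarSubalgebra ℂ (ι → Unitization ℂ B) where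
  carrier := {y | (∃ C : ℝ, ∀ i, ‖y i‖ ≤ C) ∧
    ∀ b : B, Tendsto (fun i => y i * (b : Unitization ℂ B) - b * y i) l (𝓝 0)}
  mul_mem' := by
    rintro x y ⟨⟨C, hC⟩, hx⟩ ⟨⟨C', hC'⟩, hy⟩
    refine ⟨⟨C * C', fun i => (norm_mul_le _ _).trans ?_⟩, fun b => ?_⟩
    · exact mul_le_mul (hC i) (hC' i) (norm_nonneg _) ((norm_nonneg _).trans (hC i))
    · have h := (tendsto_bdd_mul_zero hC (hy b)).add (tendsto_mul_bdd_zero hC' (hx b))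
      rw [add_zero] at h
      refine h.congr fun i => ?_
      simp only [Pi.mul_apply]
      noncomm_ring
  add_mem' := by
    rintro x y ⟨⟨C, hC⟩, hx⟩ ⟨⟨C', hC'⟩, hy⟩
    refine ⟨⟨C + C', fun i => (norm_add_le _ _).trans (add_le_add (hC i) (hC' i))⟩, fun b => ?_⟩
    have h := (hx b).add (hy b)
    rw [add_zero] at h
    refine h.congr fun i => ?_
    simp only [Pi.add_apply]
    noncomm_ring
  algebraMap_mem' c := by
    refine ⟨⟨‖algebraMap ℂ (Unitization ℂ B) c‖, fun i => le_rfl⟩, fun b => ?_⟩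
    refine tendsto_const_nhds.congr fun i => ?_
    simp only [Pi.algebraMap_apply]
    rw [Algebra.commutes, sub_self]
  star_mem' := by
    rintro x ⟨⟨C, hC⟩, hx⟩
    refine ⟨⟨C, fun i => by simpa using hC i⟩, fun b => ?_⟩
    have h := ((hx (star b)).star).neg
    rw [star_zero, neg_zero] at h
    refine h.congr fun i => ?_
    simp only [Unitization.inr_star, star_sub, star_mul, star_star, neg_sub, Pi.star_apply]

variable (B) in
/-- The ideal of strictly null nets in `centralNets`. -/
noncomputable def nullIdeal (l : Filter ι) : Ideal (centralNets B l) where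
  carrier := {y | ∀ b : B, Tendsto (fun i => y.1 i * (b : Unitization ℂ B)) l (𝓝 0)}
  add_mem' := by
    intro x y hx hy b
    have h := (hx b).add (hy b)
    rw [add_zero] at h
    exact h.congr fun i => (add_mul _ _ _).symm
  zero_mem' := fun b => tendsto_const_nhds.congr fun i => (zero_mul _).symm
  smul_mem' := by
    intro x y hy b
    obtain ⟨C, hC⟩ := x.2.1
    exact (tendsto_bdd_mul_zero hC (hy b)).congr fun i => (mul_assoc _ _ _).symm

instance isTwoSided_nullIdeal (l : Filter ι) : (nullIdeal B l).IsTwoSided where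
  mul_mem_of_left := by
    intro x y hx b
    obtain ⟨C, hC⟩ := x.2.1
    obtain ⟨C', hC'⟩ := y.2.1
    have h := (tendsto_bdd_mul_zero hC (y.2.2 b)).add (tendsto_mul_bdd_zero hC' (hx b))
    rw [add_zero] at h
    refine h.congr fun i => ?_
    change x.1 i * (y.1 i * b - b * y.1 i) + x.1 i * b * y.1 i = x.1 i * y.1 i * b
    noncomm_ring

lemma star_mem_nullIdeal {l : Filter ι} {y : centralNets B l} (hy : y ∈ nullIdeal B l) :
    star y ∈ nullIdeal B l := by
  intro b
  have h := ((y.2.2 (star b)).sub (hy (star b))).star.neg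
  rw [sub_zero, star_zero, neg_zero] at h
  refine h.congr fun i => ?_
  change -star (y.1 i * (star b : B) - (star b : B) * y.1 i - y.1 i * (star b : B)) =
    star (y.1 i) * b
  simp only [Unitization.inr_star, star_sub, star_mul, star_star]
  noncomm_ring

lemma mem_nullIdeal_of_sum_star_mul_self {l : Filter ι} {κ : Type*} {s : Finset κ}
    {x : κ → centralNets B l} (h : ∑ k ∈ s, star (x k) * x k ∈ nullIdeal B l) {k : κ}
    (hk : k ∈ s) : x k ∈ nullIdeal B l := by
  intro b
  refine tendsto_zero_of_sum_star_mul_self (s := s)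
    (x := fun k i => (x k).1 i * (b : Unitization ℂ B)) ?_ hk
  have h1 := tendsto_bdd_mul_zero (x := fun _ : ι => star (b : Unitization ℂ B))
    (fun _ => le_rfl) (h b)
  refine h1.congr fun i => ?_
  have h2 : (∑ k ∈ s, star (x k) * x k : centralNets B l).1 i =
      ∑ k ∈ s, star ((x k).1 i) * (x k).1 i := by
    have : (∑ k ∈ s, star (x k) * x k : centralNets B l).1 =
        ∑ k ∈ s, (star (x k) * x k : centralNets B l).1 :=
      map_sum (centralNets B l).subtype _ _
    rw [this, Finset.sum_apply]
    rfl
  rw [h2, Finset.sum_mul, Finset.mul_sum]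
  refine Finset.sum_congr rfl fun k _ => ?_
  simp only [star_mul, mul_assoc]

/-- A bounded asymptotically central net of `B`, as an element of `centralNets`. -/
noncomputable def toCentralNets {l : Filter ι} (y : ι → B) (hb : ∃ C : ℝ, ∀ i, ‖y i‖ ≤ C)
    (hc : AsympCentral l y) : centralNets B l :=
  ⟨fun i => (y i : Unitization ℂ B), by
    obtain ⟨C, hC⟩ := hb
    refine ⟨⟨C, fun i => by rw [Unitization.norm_inr]; exact hC i⟩, fun b => ?_⟩
    have h := (Unitization.isometry_inr (𝕜 := ℂ) (A := B)).continuous.tendsto 0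
    exact (h.comp (hc b)).congr fun i => by simp⟩

lemma tendsto_inr_zero_iff {l : Filter ι} {y : ι → B} :
    Tendsto (fun i => (y i : Unitization ℂ B)) l (𝓝 0) ↔ Tendsto y l (𝓝 0) := by
  rw [tendsto_zero_iff_norm_tendsto_zero, tendsto_zero_iff_norm_tendsto_zero (f := y)]
  simp only [Unitization.norm_inr]

lemma strictNull_of_mem_nullIdeal {l : Filter ι} {y : ι → B} {z : centralNets B l}
    (hz : z ∈ nullIdeal B l) (h : ∀ i, z.1 i = (y i : Unitization ℂ B)) : StrictNull l y := by
  intro b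
  rw [← tendsto_inr_zero_iff]
  refine (hz b).congr fun i => ?_
  rw [h, Unitization.inr_mul]

lemma mem_nullIdeal_of_strictNull {l : Filter ι} {y : ι → B} {z : centralNets B l}
    (hy : StrictNull l y) (h : ∀ i, z.1 i = (y i : Unitization ℂ B)) : z ∈ nullIdeal B l := by
  intro b
  have := tendsto_inr_zero_iff.2 (hy b)
  refine this.congr fun i => ?_
  rw [h, Unitization.inr_mul]

lemma AsympCentral.add {l : Filter ι} {x y : ι → B} (hx : AsympCentral l x)
    (hy : AsympCentral l y) : AsympCentral l fun i => x i + y i := fun b => by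
  have h := (hx b).add (hy b)
  rw [add_zero] at h
  exact h.congr fun i => by noncomm_ring

lemma AsympCentral.smul {l : Filter ι} {x : ι → B} (c : ℂ) (hx : AsympCentral l x) :
    AsympCentral l fun i => c • x i := fun b => by
  have h := (hx b).const_smul c
  rw [smul_zero] at h
  exact h.congr fun i => by rw [smul_sub, smul_mul_assoc, mul_smul_comm]

lemma AsympCentral.sum {l : Filter ι} {κ : Type*} {s : Finset κ} {x : κ → ι → B}
    (hx : ∀ k ∈ s, AsympCentral l (x k)) : AsympCentral l fun i => ∑ k ∈ s, x k i := fun b => by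
  have h := tendsto_finsetSum s fun k hk => hx k hk b
  rw [Finset.sum_const_zero] at h
  exact h.congr fun i => by rw [Finset.sum_sub_distrib, Finset.sum_mul, Finset.mul_sum]

lemma AsympCentral.star {l : Filter ι} {x : ι → B} (hx : AsympCentral l x) :
    AsympCentral l fun i => star (x i) := fun b => by
  have h := ((hx (Star.star b)).star).neg
  rw [star_zero, neg_zero] at h
  refine h.congr fun i => ?_
  simp only [star_sub, star_mul, star_star, neg_sub]

end CentralNets

/-! ### Asymptotic representations and their spectral decomposition -/

section AsympRep

variable {ι B G : Type*} [NonUnitalCStarAlgebra B] [CommGroup G]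

/-- A bounded family of asymptotically central nets `v_g` of normal elements, modulo strictly null
nets, with `v_g v_h = v_1 v_{gh}`: up to the self-adjoint factor `v_1`, a representation of `G`. -/
structure AsympRep (l : Filter ι) (v : G → ι → B) : Prop where
  bdd : ∀ g, ∃ C : ℝ, ∀ i, ‖v g i‖ ≤ C
  central : ∀ g, AsympCentral l (v g)
  star_one : ∀ i, star (v 1 i) = v 1 i
  mul : ∀ g h, StrictNull l fun i => v g i * v h i - v 1 i * v (g * h) i
  normal : ∀ g, StrictNull l fun i => star (v g i) * v g i - v g i * star (v g i)

namespace AsympRep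

variable {l : Filter ι} {v : G → ι → B} (hv : AsympRep l v)

/-- The nets `v_g` as elements of the star-algebra `centralNets`. -/
noncomputable def net (g : G) : centralNets B l := toCentralNets (v g) (hv.bdd g) (hv.central g)

lemma net_apply (g : G) (i : ι) : (hv.net g).1 i = (v g i : Unitization ℂ B) := rfl

lemma star_net_one : star (hv.net 1) = hv.net 1 := by
  apply Subtype.ext
  funext i
  change star (v 1 i : Unitization ℂ B) = v 1 i
  rw [← Unitization.inr_star, hv.star_one]

lemma mk_mul (g h : G) : Ideal.Quotient.mk (nullIdeal B l) (hv.net g) *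
      Ideal.Quotient.mk (nullIdeal B l) (hv.net h) =
    Ideal.Quotient.mk (nullIdeal B l) (hv.net 1) *
      Ideal.Quotient.mk (nullIdeal B l) (hv.net (g * h)) := by
  rw [← map_mul, ← map_mul, Ideal.Quotient.mk_eq_mk_iff_sub_mem]
  refine mem_nullIdeal_of_strictNull (hv.mul g h) fun i => ?_
  change (v g i : Unitization ℂ B) * v h i - v 1 i * v (g * h) i = _
  simp

lemma mk_normal (g : G) : Commute (Ideal.Quotient.mk (nullIdeal B l) (hv.net g))
    (Ideal.Quotient.mk (nullIdeal B l) (star (hv.net g))) := by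
  change _ * _ = _ * _
  rw [← map_mul, ← map_mul, eq_comm, Ideal.Quotient.mk_eq_mk_iff_sub_mem]
  refine mem_nullIdeal_of_strictNull (hv.normal g) fun i => ?_
  change star (v g i : Unitization ℂ B) * v g i - v g i * star (v g i : Unitization ℂ B) = _
  simp

lemma mk_star_eq {l : Filter ι} {x y : centralNets B l}
    (h : Ideal.Quotient.mk (nullIdeal B l) x = Ideal.Quotient.mk (nullIdeal B l) y) :
    Ideal.Quotient.mk (nullIdeal B l) (star x) = Ideal.Quotient.mk (nullIdeal B l) (star y) := by
  rw [Ideal.Quotient.mk_eq_mk_iff_sub_mem] at h ⊢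
  have h' := star_mem_nullIdeal h
  rwa [star_sub] at h'

lemma mk_pow_succ (g : G) (k : ℕ) : Ideal.Quotient.mk (nullIdeal B l) (hv.net g) ^ (k + 1) =
    Ideal.Quotient.mk (nullIdeal B l) (hv.net 1) ^ k *
      Ideal.Quotient.mk (nullIdeal B l) (hv.net (g ^ (k + 1))) := by
  induction k with
  | zero => simp
  | succ k ih =>
    rw [pow_succ, ih, mul_assoc, hv.mk_mul, ← pow_succ, pow_succ _ k, mul_assoc]

variable [Fintype G]

/-- Modulo strictly null nets `v_g⋆ v_g = v_1²`, as the powers of both sides agree. -/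
lemma mk_star_mul_self (g : G) : Ideal.Quotient.mk (nullIdeal B l) (star (hv.net g) * hv.net g) =
    Ideal.Quotient.mk (nullIdeal B l) (hv.net 1 * hv.net 1) := by
  refine map_star_mul_self_eq_of_pow_eq (Ideal.Quotient.mk (nullIdeal B l)) ?_ ?_
    hv.star_net_one ?_ (hv.mk_normal g) Fintype.card_pos (m := Fintype.card G) ?_
  · intro x hx
    rw [Ideal.Quotient.eq_zero_iff_mem] at hx ⊢
    exact star_mem_nullIdeal hx
  · intro n x hx k hk
    rw [Ideal.Quotient.eq_zero_iff_mem] at hx ⊢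
    exact mem_nullIdeal_of_sum_star_mul_self hx (Finset.mem_range.2 hk)
  · change _ * _ = _ * _
    rw [hv.mk_mul, mul_one]
  · obtain ⟨k, hk⟩ : ∃ k, Fintype.card G = k + 1 :=
      ⟨Fintype.card G - 1, (Nat.succ_pred_eq_of_pos Fintype.card_pos).symm⟩
    have h1 : g ^ (k + 1) = 1 := by rw [← hk]; exact pow_card_eq_one
    rw [hk, hv.mk_pow_succ, h1, ← pow_succ]

/-- Modulo strictly null nets `v_g⋆ = v_{g⁻¹}`: for `w = v_{g⁻¹} - v_g⋆` all terms of `w⋆ w` are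
`± v_1²`. -/
lemma mk_star (g : G) : Ideal.Quotient.mk (nullIdeal B l) (star (hv.net g)) =
    Ideal.Quotient.mk (nullIdeal B l) (hv.net g⁻¹) := by
  set π := Ideal.Quotient.mk (nullIdeal B l)
  set Q := π (hv.net 1) with hQ
  have h1 : π (hv.net g) * π (hv.net g⁻¹) = Q * Q := by rw [hv.mk_mul, mul_inv_cancel]
  have h2 : π (star (hv.net g⁻¹)) * π (star (hv.net g)) = Q * Q := by
    have := mk_star_eq (x := hv.net g * hv.net g⁻¹) (y := hv.net 1 * hv.net 1)
      (by rw [map_mul, map_mul]; exact h1)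
    rw [star_mul, star_mul, hv.star_net_one, map_mul, map_mul] at this
    exact this
  have h3 : π (star (hv.net g⁻¹)) * π (hv.net g⁻¹) = Q * Q := by
    rw [← map_mul, hv.mk_star_mul_self, map_mul]
  have h4 : π (hv.net g) * π (star (hv.net g)) = Q * Q := by
    rw [(hv.mk_normal g).eq, ← map_mul, hv.mk_star_mul_self, map_mul]
  have h5 : ∑ k ∈ Finset.range 1, star ((fun _ : ℕ => hv.net g⁻¹ - star (hv.net g)) k) *
      ((fun _ : ℕ => hv.net g⁻¹ - star (hv.net g)) k) ∈ nullIdeal B l := by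
    rw [← Ideal.Quotient.eq_zero_iff_mem, Finset.sum_range_one, star_sub, star_star, map_mul,
      map_sub, map_sub, sub_mul, mul_sub, mul_sub]
    change π _ * π _ - π _ * π _ - (π _ * π _ - π _ * π _) = 0
    rw [h1, h2, h3, h4]
    simp
  have h6 := mem_nullIdeal_of_sum_star_mul_self h5 (k := 0) (by simp)
  exact ((Ideal.Quotient.mk_eq_mk_iff_sub_mem _ _).2 h6).symm

end AsympRep

variable [Fintype G]

/-- The self-adjoint part of `|G|⁻¹ ∑_g χ̄(g) v_g`, which is the spectral element of the asymptotic
representation `v` at the character `χ`. -/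
noncomputable def spectralNet (v : G → ι → B) (χ : G →* Circle) (i : ι) : B :=
  (2 * Fintype.card G : ℂ)⁻¹ • ∑ g, ((χ g⁻¹ : ℂ) • v g i + (χ g : ℂ) • star (v g i))

lemma star_spectralNet (v : G → ι → B) (χ : G →* Circle) (i : ι) :
    star (spectralNet v χ i) = spectralNet v χ i := by
  have h : star ((2 * Fintype.card G : ℂ)⁻¹) = (2 * Fintype.card G : ℂ)⁻¹ := by
    simp
  rw [spectralNet, star_smul, h, star_sum]
  congr 1
  refine Finset.sum_congr rfl fun g _ => ?_
  rw [star_add, star_smul, star_smul, star_star, star_character, star_character, inv_inv, add_comm]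

lemma norm_spectralNet_le {v : G → ι → B} {i : ι} (hv : ∀ g, ‖v g i‖ ≤ 1) (χ : G →* Circle) :
    ‖spectralNet v χ i‖ ≤ 1 := by
  have h0 : (0 : ℝ) < 2 * Fintype.card G := by
    have : (0 : ℝ) < Fintype.card G := by exact_mod_cast Fintype.card_pos
    positivity
  have h1 : ‖∑ g, ((χ g⁻¹ : ℂ) • v g i + (χ g : ℂ) • star (v g i))‖ ≤ 2 * Fintype.card G := by
    refine (norm_sum_le _ _).trans ?_
    have : ∀ g ∈ Finset.univ, ‖(χ g⁻¹ : ℂ) • v g i + (χ g : ℂ) • star (v g i)‖ ≤ (2 : ℝ) := by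
      intro g _
      refine (norm_add_le _ _).trans ?_
      rw [norm_smul, norm_smul, Circle.norm_coe, Circle.norm_coe, norm_star]
      linarith [hv g]
    refine (Finset.sum_le_sum this).trans ?_
    simp [mul_comm]
  rw [spectralNet, norm_smul, norm_inv]
  have h2 : ‖(2 * Fintype.card G : ℂ)‖ = 2 * Fintype.card G := by simp
  rw [h2, inv_mul_le_iff₀ h0, mul_one]
  exact h1

namespace AsympRep

variable {l : Filter ι} {v : G → ι → B} (hv : AsympRep l v)

include hv in
lemma asympCentral_spectralNet (χ : G →* Circle) : AsympCentral l (spectralNet v χ) :=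
  (AsympCentral.sum fun g _ => ((hv.central g).smul _).add ((hv.central g).star.smul _)).smul _

/-- `spectralNet` as an element of the star-algebra `centralNets`. -/
noncomputable def snet (χ : G →* Circle) : centralNets B l :=
  (2 * Fintype.card G : ℂ)⁻¹ •
    ∑ g, ((χ g⁻¹ : ℂ) • hv.net g + (χ g : ℂ) • star (hv.net g))

lemma snet_apply (χ : G →* Circle) (i : ι) :
    (hv.snet χ).1 i = ((spectralNet v χ i : B) : Unitization ℂ B) := by
  have h1 : (hv.snet χ).1 = (2 * Fintype.card G : ℂ)⁻¹ •
      ∑ g, ((χ g⁻¹ : ℂ) • (hv.net g).1 + (χ g : ℂ) • star (hv.net g).1) := by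
    change (centralNets B l).subtype ((2 * Fintype.card G : ℂ)⁻¹ •
      ∑ g, ((χ g⁻¹ : ℂ) • hv.net g + (χ g : ℂ) • star (hv.net g))) = _
    rw [map_smul, map_sum]
    rfl
  rw [h1, spectralNet, Pi.smul_apply, Finset.sum_apply, Unitization.inr_smul]
  congr 1
  have h2 : ∀ f : G → B, ((∑ g, f g : B) : Unitization ℂ B) = ∑ g, (f g : Unitization ℂ B) :=
    fun f => map_sum (Unitization.inrNonUnitalAlgHom ℂ B) f _
  rw [h2]
  refine Finset.sum_congr rfl fun g _ => ?_
  rw [Unitization.inr_add, Unitization.inr_smul, Unitization.inr_smul, Unitization.inr_star]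
  rfl

lemma mk_snet (χ : G →* Circle) : Ideal.Quotient.mkₐ ℂ (nullIdeal B l) (hv.snet χ) =
    (Fintype.card G : ℂ)⁻¹ •
      ∑ g, (χ g⁻¹ : ℂ) • Ideal.Quotient.mkₐ ℂ (nullIdeal B l) (hv.net g) := by
  set π := Ideal.Quotient.mkₐ ℂ (nullIdeal B l)
  have h1 : ∀ g, π (star (hv.net g)) = π (hv.net g⁻¹) := hv.mk_star
  rw [snet, map_smul, map_sum]
  simp only [map_add, map_smul, h1, Finset.sum_add_distrib]
  rw [← Equiv.sum_comp (Equiv.inv G) (fun g => (χ g : ℂ) • π (hv.net g⁻¹))]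
  simp only [Equiv.inv_apply, inv_inv]
  rw [← two_smul ℂ, smul_smul]
  congr 1
  rw [mul_inv, mul_comm, ← mul_assoc, mul_inv_cancel₀ (two_ne_zero), one_mul]

/-- The spectral elements are orthogonal, and `g_χ² = v_1 g_χ`, modulo strictly null nets. -/
lemma mk_snet_mul_snet [DecidableEq (G →* Circle)] (χ τ : G →* Circle) :
    Ideal.Quotient.mkₐ ℂ (nullIdeal B l) (hv.snet χ) *
      Ideal.Quotient.mkₐ ℂ (nullIdeal B l) (hv.snet τ) =
    if χ = τ then Ideal.Quotient.mkₐ ℂ (nullIdeal B l) (hv.net 1) *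
      Ideal.Quotient.mkₐ ℂ (nullIdeal B l) (hv.snet τ) else 0 := by
  set π := Ideal.Quotient.mkₐ ℂ (nullIdeal B l)
  have hm : ∀ g h, π (hv.net g) * π (hv.net h) = π (hv.net 1) * π (hv.net (g * h)) := hv.mk_mul
  have hn : (Fintype.card G : ℂ) ≠ 0 := by exact_mod_cast Fintype.card_ne_zero
  have h1 : ∀ g, (∑ h, (χ g⁻¹ : ℂ) • π (hv.net g) * ((τ h⁻¹ : ℂ) • π (hv.net h))) =
      ∑ k, (((τ * χ⁻¹) g : Circle) : ℂ) • ((τ k⁻¹ : ℂ) • (π (hv.net 1) * π (hv.net k))) := by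
    intro g
    rw [← Equiv.sum_comp (Equiv.mulLeft g)
      (fun k => (((τ * χ⁻¹) g : Circle) : ℂ) • ((τ k⁻¹ : ℂ) • (π (hv.net 1) * π (hv.net k))))]
    refine Finset.sum_congr rfl fun h _ => ?_
    rw [smul_mul_smul_comm, hm, smul_smul, Equiv.coe_mulLeft]
    congr 1
    rw [← Circle.coe_mul, ← Circle.coe_mul]
    congr 1
    simp only [MonoidHom.mul_apply, MonoidHom.inv_apply, map_inv, map_mul, mul_inv_rev]
    rw [mul_comm (τ h)⁻¹, ← mul_assoc, mul_right_comm (τ g), mul_inv_cancel, one_mul]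
  rw [hv.mk_snet χ, hv.mk_snet τ, smul_mul_smul_comm, Finset.sum_mul_sum,
    Finset.sum_congr rfl fun g _ => h1 g, Finset.sum_comm]
  simp only [← Finset.sum_smul, sum_character_eq_ite, mul_inv_eq_one]
  by_cases h : χ = τ
  · subst h
    simp only [if_true]
    rw [← Finset.smul_sum, smul_smul, mul_smul_comm, Finset.mul_sum]
    congr 1
    · field_simp
    · exact Finset.sum_congr rfl fun g _ => (mul_smul_comm _ _ _).symm
  · rw [if_neg h]
    simp only [if_neg (Ne.symm h), zero_smul, Finset.sum_const_zero, smul_zero]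

include hv in
lemma strictNull_spectralNet_mul {χ τ : G →* Circle} (h : χ ≠ τ) :
    StrictNull l fun i => spectralNet v χ i * spectralNet v τ i := by
  classical
  have h1 := hv.mk_snet_mul_snet χ τ
  rw [if_neg h, ← map_mul] at h1
  refine strictNull_of_mem_nullIdeal (Ideal.Quotient.eq_zero_iff_mem.1 h1) fun i => ?_
  change (hv.snet χ).1 i * (hv.snet τ).1 i = _
  rw [snet_apply, snet_apply, Unitization.inr_mul]

include hv in
lemma strictNull_spectralNet_sq (χ : G →* Circle) :
    StrictNull l fun i => spectralNet v χ i * spectralNet v χ i - v 1 i * spectralNet v χ i := by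
  classical
  have h1 := hv.mk_snet_mul_snet χ χ
  rw [if_pos rfl, ← map_mul, ← map_mul] at h1
  refine strictNull_of_mem_nullIdeal
    ((Ideal.Quotient.mk_eq_mk_iff_sub_mem _ _).1 h1) fun i => ?_
  change (hv.snet χ).1 i * (hv.snet χ).1 i - (hv.net 1).1 i * (hv.snet χ).1 i = _
  rw [snet_apply, net_apply, Unitization.inr_sub, Unitization.inr_mul, Unitization.inr_mul]

include hv in
lemma strictNull_sum_spectralNet :
    StrictNull l fun i => ∑ χ : G →* Circle, spectralNet v χ i - v 1 i := by
  classical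
  set π := Ideal.Quotient.mkₐ ℂ (nullIdeal B l) with hπ
  have hn : (Fintype.card G : ℂ) ≠ 0 := by exact_mod_cast Fintype.card_ne_zero
  have h1 : π (∑ χ : G →* Circle, hv.snet χ) = π (hv.net 1) := by
    rw [map_sum]
    simp only [hπ, hv.mk_snet]
    rw [← Finset.smul_sum, Finset.sum_comm]
    simp only [← Finset.sum_smul, sum_dual_apply_eq_ite, inv_eq_one, ite_smul, zero_smul,
      Finset.sum_ite_eq', Finset.mem_univ, if_true, smul_smul, card_dual_eq_card,
      inv_mul_cancel₀ hn, one_smul]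
  refine strictNull_of_mem_nullIdeal
    ((Ideal.Quotient.mk_eq_mk_iff_sub_mem _ _).1 h1) fun i => ?_
  have h2 : (centralNets B l).subtype (∑ χ : G →* Circle, hv.snet χ - hv.net 1) =
      ∑ χ : G →* Circle, (hv.snet χ).1 - (hv.net 1).1 := by
    rw [map_sub, map_sum]
    rfl
  have h3 : ∀ f : (G →* Circle) → B, ((∑ g, f g : B) : Unitization ℂ B) =
      ∑ g, (f g : Unitization ℂ B) :=
    fun f => map_sum (Unitization.inrNonUnitalAlgHom ℂ B) f _
  change (centralNets B l).subtype (∑ χ : G →* Circle, hv.snet χ - hv.net 1) i = _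
  rw [h2, Pi.sub_apply, Finset.sum_apply, Unitization.inr_sub, h3, net_apply]
  simp only [snet_apply]

end AsympRep

end AsympRep

/-! ### From asymptotic representations to Rokhlin towers -/

section Towers

variable {ι B G : Type*} [NonUnitalCStarAlgebra B]

/-- If `v ≥ 0` and `r² ≈ v r` for a self-adjoint `r`, then `r` is almost positive: for `c = r⁻` the
positive elements `c⁵` and `c² v c²` add up to `c² (r² - v r) c`. -/
lemma norm_negPart_sq_le [PartialOrder B] [StarOrderedRing B] {r v : B} (hr : IsSelfAdjoint r)
    (hv : 0 ≤ v) : ‖r⁻‖ * ‖r⁻‖ ≤ ‖r * r - v * r‖ := by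
  set c := r⁻ with hc
  have hc0 : 0 ≤ c := CFC.negPart_nonneg r
  have hcs : IsSelfAdjoint c := IsSelfAdjoint.of_nonneg hc0
  have hccs : IsSelfAdjoint (c * c) := by
    rw [IsSelfAdjoint, star_mul, hcs.star_eq]
  have hrc : r * c = -(c * c) := by
    conv_lhs => rw [← CFC.posPart_sub_negPart r hr]
    rw [sub_mul, ← hc, CFC.posPart_mul_negPart, zero_sub]
  have h1 : c * c * (r * r - v * r) * c = c * c * c * (c * c) + c * c * v * (c * c) := by
    calc c * c * (r * r - v * r) * c = c * c * (r * (r * c)) - c * c * v * (r * c) := by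
          noncomm_ring
      _ = c * c * c * (c * c) + c * c * v * (c * c) := by
          have : r * (c * c) = -(c * c * c) := by rw [← mul_assoc, hrc, neg_mul]
          rw [hrc, mul_neg, this]
          noncomm_ring
  have h2 : 0 ≤ c * c * c * (c * c) := hccs.conjugate_nonneg hc0
  have h3 : 0 ≤ c * c * v * (c * c) := hccs.conjugate_nonneg hv
  have h4 : ‖c * c * c * (c * c)‖ ≤ ‖c * c * (r * r - v * r) * c‖ := by
    refine CStarAlgebra.norm_le_norm_of_nonneg_of_le h2 ?_
    rw [h1]
    exact le_add_of_nonneg_right h3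
  have h5 : ‖c * c * (r * r - v * r) * c‖ ≤ ‖c‖ * ‖c‖ * ‖r * r - v * r‖ * ‖c‖ := by
    refine (norm_mul_le _ _).trans (mul_le_mul_of_nonneg_right ?_ (norm_nonneg _))
    exact (norm_mul_le _ _).trans (mul_le_mul_of_nonneg_right (norm_mul_le _ _) (norm_nonneg _))
  have h6 : ‖c‖ ^ 8 ≤ ‖c * c * c * (c * c)‖ * ‖c‖ ^ 3 := by
    have e1 : ‖c * c‖ = ‖c‖ * ‖c‖ := by
      rw [hcs.norm_mul_self, sq]
    have e2 : ‖c * c * (c * c)‖ = ‖c * c‖ * ‖c * c‖ := by rw [hccs.norm_mul_self, sq]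
    have h4s : IsSelfAdjoint (c * c * (c * c)) := by
      rw [IsSelfAdjoint, star_mul, hccs.star_eq]
    have e3 : ‖c * c * (c * c) * (c * c * (c * c))‖ = ‖c‖ ^ 8 := by
      rw [h4s.norm_mul_self, e2, e1]; ring
    have e4 : c * c * (c * c) * (c * c * (c * c)) = c * c * c * (c * c) * (c * c * c) := by
      noncomm_ring
    rw [← e3, e4]
    refine (norm_mul_le _ _).trans (mul_le_mul_of_nonneg_left ?_ (norm_nonneg _))
    refine (norm_mul_le _ _).trans ?_
    rw [e1]
    exact le_of_eq (by ring)
  rcases (norm_nonneg c).eq_or_lt with h0 | hpos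
  · rw [← h0, zero_mul]; exact norm_nonneg _
  · have h7 : ‖c‖ ^ 6 * (‖c‖ * ‖c‖) ≤ ‖c‖ ^ 6 * ‖r * r - v * r‖ := by
      calc ‖c‖ ^ 6 * (‖c‖ * ‖c‖) = ‖c‖ ^ 8 := by ring
        _ ≤ ‖c * c * c * (c * c)‖ * ‖c‖ ^ 3 := h6
        _ ≤ (‖c‖ * ‖c‖ * ‖r * r - v * r‖ * ‖c‖) * ‖c‖ ^ 3 :=
            mul_le_mul_of_nonneg_right (h4.trans h5) (by positivity)
        _ = ‖c‖ ^ 6 * ‖r * r - v * r‖ := by ring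
    exact le_of_mul_le_mul_left h7 (by positivity)

lemma norm_posPart_le_norm [PartialOrder B] [StarOrderedRing B] {r : B} (hr : IsSelfAdjoint r) :
    ‖r⁺‖ ≤ ‖r‖ := by
  have hs : IsSelfAdjoint r⁺ := IsSelfAdjoint.of_nonneg (CFC.posPart_nonneg r)
  have h1 : r * r⁺ = r⁺ * r⁺ := by
    have h := congrArg (· * r⁺) (CFC.posPart_sub_negPart r hr)
    simpa only [sub_mul, CFC.negPart_mul_posPart, sub_zero] using h.symm
  rcases (norm_nonneg r⁺).eq_or_lt with h0 | hpos
  · rw [← h0]; exact norm_nonneg _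
  · refine le_of_mul_le_mul_right ?_ hpos
    rw [← sq, ← hs.norm_mul_self, ← h1]
    exact norm_mul_le _ _

lemma AsympCentral.symm {l : Filter ι} {y : ι → B} (hy : AsympCentral l y) (b : B) :
    Tendsto (fun i => b * y i - y i * b) l (𝓝 0) := by
  have := (hy b).neg
  rw [neg_zero] at this
  exact this.congr fun i => neg_sub _ _

/-- Squares of the members of an approximate unit by contractions act on the left as an approximate
unit. -/
lemma tendsto_mul_self_mul {L : Filter B} (hL : L.IsApproximateUnit) (hn : ∀ᶠ e in L, ‖e‖ ≤ 1)
    (a : B) : Tendsto (fun e => e * e * a) L (𝓝 a) := by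
  have h1 : Tendsto (fun e => e * (e * a - a)) L (𝓝 0) := by
    have h2 := (hL.tendsto_mul_right a).sub_const a
    rw [sub_self] at h2
    refine squeeze_zero_norm' ?_ (tendsto_zero_iff_norm_tendsto_zero.1 h2)
    filter_upwards [hn] with e he
    exact (norm_mul_le _ _).trans (mul_le_of_le_one_left (norm_nonneg _) he)
  have h3 := h1.add (hL.tendsto_mul_right a)
  rw [zero_add] at h3
  exact h3.congr fun e => by noncomm_ring

lemma tendsto_mul_mul_self {L : Filter B} (hL : L.IsApproximateUnit) (hn : ∀ᶠ e in L, ‖e‖ ≤ 1)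
    (a : B) : Tendsto (fun e => a * e * e) L (𝓝 a) := by
  have h1 : Tendsto (fun e => (a * e - a) * e) L (𝓝 0) := by
    have h2 := (hL.tendsto_mul_left a).sub_const a
    rw [sub_self] at h2
    refine squeeze_zero_norm' ?_ (tendsto_zero_iff_norm_tendsto_zero.1 h2)
    filter_upwards [hn] with e he
    exact (norm_mul_le _ _).trans (mul_le_of_le_one_right (norm_nonneg _) he)
  have h3 := h1.add (hL.tendsto_mul_left a)
  rw [zero_add] at h3
  exact h3.congr fun e => by noncomm_ring

variable [CommGroup G] [Fintype G]

/-- Let `v` be asymptotic representations by contractions that are homogeneous for an action `β` of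
the dual group and whose values at `1` are positive and add up to one. Cutting down the spectral
elements at the trivial character by fixed elements of an approximate unit makes
`g_1² = v_1 g_1` hold in norm, so that the positive parts of the cut-down elements are close to
them; their `β`-orbits are Rokhlin towers. -/
theorem exists_rokhlin_towers {J : Type*} [Fintype J] {l : Filter ι} [l.NeBot]
    {v : J → G → ι → B} (hv : ∀ j, AsympRep l (v j)) (hv1 : ∀ j g i, ‖v j g i‖ ≤ 1)
    (hpos : ∀ j i, ∃ b, v j 1 i = star b * b)
    (hsum : ∀ a, Tendsto (fun i => (∑ j, v j 1 i) * a) l (𝓝 a))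
    (β : (G →* Circle) → B ≃⋆ₐ[ℂ] B)
    (hβ : ∀ j χ g i, β χ (v j g i) = (χ g⁻¹ : ℂ) • v j g i)
    {L : Filter B} (hL : L.IsApproximateUnit)
    (hL' : ∀ᶠ e in L, star e = e ∧ ‖e‖ ≤ 1 ∧ ∀ χ, β χ e = e)
    {ε : ℝ} (hε : 0 < ε) (F : Finset B) :
    ∃ f : J → B, (∀ j, (∃ b, f j = star b * b) ∧ ‖f j‖ ≤ 1) ∧
      (∀ j χ τ, χ ≠ τ → ∀ a ∈ F, ‖β χ (f j) * β τ (f j) * a‖ < ε) ∧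
      (∀ j χ, ∀ a ∈ F, ∀ b ∈ F, ‖(β χ (f j) * b - b * β χ (f j)) * a‖ < ε) ∧
      (∀ a ∈ F, ‖(∑ j, ∑ χ, β χ (f j)) * a - a‖ < ε) := by
  let := CStarAlgebra.spectralOrder B
  have := CStarAlgebra.spectralOrderedRing B
  have := hL.neBot
  -- `e` is far enough in the approximate unit; afterwards it stays fixed as the net index moves
  have hL1 : ∀ᶠ e in L, ‖e‖ ≤ 1 := hL'.mono fun e he => he.2.1
  have hl1 := tendsto_mul_self_mul hL hL1
  have hl2 := tendsto_mul_mul_self hL hL1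
  obtain ⟨e, ⟨hes, hen, heβ⟩, he1, he2⟩ : ∃ e : B, (star e = e ∧ ‖e‖ ≤ 1 ∧ ∀ χ, β χ e = e) ∧
      (∀ a ∈ F, ‖e * e * a - a‖ < ε) ∧
      (∀ a ∈ F, ∀ b ∈ F, ‖e * e * b - b * e * e‖ * ‖a‖ < ε) := by
    refine (hL'.and (((Finset.eventually_all F).2 fun a _ => ?_).and
      ((Finset.eventually_all F).2 fun a _ => (Finset.eventually_all F).2 fun b _ => ?_))).exists
    · have h1 := ((hl1 a).sub_const a).norm
      rw [sub_self, norm_zero] at h1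
      exact h1.eventually_lt_const hε
    · have h1 := (((hl1 b).sub (hl2 b)).norm).mul_const ‖a‖
      rw [sub_self, norm_zero, zero_mul] at h1
      exact h1.eventually_lt_const hε
  -- the spectral elements `γ`, their cut-downs `E` by `e`, and the positive elements `P` near `E`
  set γ : J → (G →* Circle) → ι → B := fun j => spectralNet (v j) with hγ
  have hγc : ∀ j χ, AsympCentral l (γ j χ) := fun j χ => (hv j).asympCentral_spectralNet χ
  have hγn : ∀ j χ i, ‖γ j χ i‖ ≤ 1 := fun j χ i => norm_spectralNet_le (fun g => hv1 j g i) χ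
  have hγβ : ∀ j χ i, β χ (γ j 1 i) = γ j χ i := by
    intro j χ i
    simp only [hγ, spectralNet, map_smul, map_sum, map_add, map_star, hβ, MonoidHom.one_apply,
      Circle.coe_one, one_smul, star_smul, star_character, inv_inv]
  set r : J → ι → B := fun j i => e * γ j 1 i * e with hr
  have hrs : ∀ j i, IsSelfAdjoint (r j i) := fun j i => by
    simp only [hr, IsSelfAdjoint, star_mul, hes, hγ, star_spectralNet, mul_assoc]
  have hen' : ∀ {x : B}, ‖x‖ ≤ 1 → ‖e * x * e‖ ≤ 1 := fun {x} hx => by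
    refine (norm_mul_le _ _).trans (mul_le_one₀ ?_ (norm_nonneg _) hen)
    exact (norm_mul_le _ _).trans (mul_le_one₀ hen (norm_nonneg _) hx)
  set E : J → (G →* Circle) → ι → B := fun j χ i => e * γ j χ i * e with hE
  set P : J → (G →* Circle) → ι → B := fun j χ i => β χ (r j i)⁺ with hP
  have hPn : ∀ j χ i, ‖P j χ i‖ ≤ 1 := fun j χ i => by
    rw [hP, StarAlgEquiv.norm_map]
    exact (norm_posPart_le_norm (hrs j i)).trans (hen' (hγn j 1 i))
  have hEn : ∀ j χ i, ‖E j χ i‖ ≤ 1 := fun j χ i => hen' (hγn j χ i)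
  have hneg : ∀ j, Tendsto (fun i => (r j i)⁻) l (𝓝 0) := by
    intro j
    have hk : Tendsto (fun i => r j i * r j i - e * v j 1 i * e * r j i) l (𝓝 0) := by
      have h1 := tendsto_mul_bdd_zero (x := fun _ : ι => e) (fun _ => le_rfl)
        ((hγc j 1).symm (e * e))
      have h2 := tendsto_bdd_mul_zero (x := fun i => e * (γ j 1 i - v j 1 i)) (C := 2)
        (fun i => (norm_mul_le _ _).trans ?_) h1
      · have h3 := tendsto_bdd_mul_zero (x := fun _ : ι => e) (fun _ => le_rfl)
          ((hv j).strictNull_spectralNet_sq 1 (e * e * e))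
        have h4 := h2.add h3
        rw [add_zero] at h4
        refine h4.congr fun i => ?_
        simp only [hr, hγ]
        noncomm_ring
      · have h5 : ‖γ j 1 i - v j 1 i‖ ≤ 2 :=
          (norm_sub_le _ _).trans (by linarith [hγn j 1 i, hv1 j 1 i])
        nlinarith [norm_nonneg e, norm_nonneg (γ j 1 i - v j 1 i)]
    have h1 : Tendsto (fun i => ‖(r j i)⁻‖ * ‖(r j i)⁻‖) l (𝓝 0) := by
      refine squeeze_zero (fun i => by positivity) (fun i => norm_negPart_sq_le (hrs j i) ?_)
        (tendsto_zero_iff_norm_tendsto_zero.1 hk)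
      obtain ⟨b, hb⟩ := hpos j i
      have hb' : 0 ≤ v j 1 i := hb ▸ star_mul_self_nonneg b
      exact (show IsSelfAdjoint e from hes).conjugate_nonneg hb'
    rw [tendsto_zero_iff_norm_tendsto_zero]
    simpa using h1.sqrt
  have hPE : ∀ j χ, Tendsto (fun i => P j χ i - E j χ i) l (𝓝 0) := by
    intro j χ
    rw [tendsto_zero_iff_norm_tendsto_zero]
    refine (tendsto_zero_iff_norm_tendsto_zero.1 (hneg j)).congr fun i => ?_
    have h1 : E j χ i = β χ (r j i) := by simp only [hE, hr, map_mul, heβ, hγβ]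
    have h2 : (r j i)⁺ - r j i = (r j i)⁻ := by
      rw [sub_eq_iff_eq_add, ← sub_eq_iff_eq_add']
      exact CFC.posPart_sub_negPart _ (hrs j i)
    rw [h1, hP, ← map_sub, StarAlgEquiv.norm_map, h2]
  have horth : ∀ j χ τ, χ ≠ τ → ∀ a, Tendsto (fun i => P j χ i * P j τ i * a) l (𝓝 0) := by
    intro j χ τ hne a
    have h1 := tendsto_mul_bdd_zero (x := fun _ : ι => a) (fun _ => le_rfl)
      (tendsto_mul_bdd_zero (hPn j τ) (hPE j χ))
    have h2 := tendsto_mul_bdd_zero (x := fun _ : ι => a) (fun _ => le_rfl)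
      (tendsto_bdd_mul_zero (hEn j χ) (hPE j τ))
    have h3 := tendsto_mul_bdd_zero (x := fun _ : ι => e * a) (fun _ => le_rfl)
      (tendsto_bdd_mul_zero (x := fun i => e * γ j χ i) (C := 1)
        (fun i => (norm_mul_le _ _).trans (mul_le_one₀ hen (norm_nonneg _) (hγn j χ i)))
        ((hγc j τ).symm (e * e)))
    have h4 := tendsto_bdd_mul_zero (x := fun _ : ι => e) (fun _ => le_rfl)
      ((hv j).strictNull_spectralNet_mul hne (e * e * e * a))
    have h5 := ((h1.add h2).add h3).add h4
    simp only [add_zero] at h5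
    refine h5.congr fun i => ?_
    simp only [hE, hγ]
    noncomm_ring
  have hcomm : ∀ j χ a b, Tendsto (fun i => (P j χ i * b - b * P j χ i) * a -
      γ j χ i * (e * e * b - b * e * e) * a) l (𝓝 0) := by
    intro j χ a b
    have h1 := tendsto_mul_bdd_zero (x := fun _ : ι => b) (fun _ => le_rfl) (hPE j χ)
    have h2 := tendsto_bdd_mul_zero (x := fun _ : ι => b) (fun _ => le_rfl) (hPE j χ)
    have h3 := tendsto_mul_bdd_zero (x := fun _ : ι => e * b) (fun _ => le_rfl)
      ((hγc j χ).symm e)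
    have h4 := tendsto_mul_bdd_zero (x := fun _ : ι => e) (fun _ => le_rfl)
      ((hγc j χ).symm (b * e))
    have h5 := (h1.sub h2).add (h3.sub h4)
    simp only [sub_zero, add_zero] at h5
    refine (tendsto_mul_bdd_zero (x := fun _ : ι => a) (fun _ => le_rfl) h5).congr fun i => ?_
    simp only [hE]
    noncomm_ring
  have hadd : ∀ a, Tendsto (fun i => (∑ j, ∑ χ, P j χ i) * a) l (𝓝 (e * e * a)) := by
    intro a
    have h1 : ∀ j χ, Tendsto (fun i => P j χ i * a - γ j χ i * (e * e * a)) l (𝓝 0) := by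
      intro j χ
      have h2 := tendsto_mul_bdd_zero (x := fun _ : ι => a) (fun _ => le_rfl) (hPE j χ)
      have h3 := tendsto_mul_bdd_zero (x := fun _ : ι => e * a) (fun _ => le_rfl)
        ((hγc j χ).symm e)
      have h4 := h2.add h3
      rw [add_zero] at h4
      refine h4.congr fun i => ?_
      simp only [hE]
      noncomm_ring
    have h2 := tendsto_finsetSum Finset.univ fun j _ =>
      (tendsto_finsetSum Finset.univ fun χ _ => h1 j χ).add
        ((hv j).strictNull_sum_spectralNet (e * e * a))
    simp only [Finset.sum_const_zero, add_zero] at h2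
    have h3 := h2.add (hsum (e * e * a))
    rw [zero_add] at h3
    refine h3.congr fun i => ?_
    simp only [Finset.sum_sub_distrib, Finset.sum_add_distrib, Finset.sum_mul, sub_mul, hγ]
    abel
  have ev1 : ∀ᶠ i in l, ∀ j χ τ, χ ≠ τ → ∀ a ∈ F, ‖P j χ i * P j τ i * a‖ < ε := by
    simp only [eventually_all, Finset.eventually_all]
    intro j χ τ hne a _
    have := (horth j χ τ hne a).norm
    rw [norm_zero] at this
    exact this.eventually_lt_const hε
  have ev2 : ∀ᶠ i in l, ∀ j χ, ∀ a ∈ F, ∀ b ∈ F, ‖(P j χ i * b - b * P j χ i) * a‖ < ε := by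
    simp only [eventually_all, Finset.eventually_all]
    intro j χ a ha b hb
    have h1 := (hcomm j χ a b).norm
    rw [norm_zero] at h1
    have h2 := he2 a ha b hb
    filter_upwards [h1.eventually_lt_const (sub_pos.2 h2)] with i hi
    have h3 : ‖γ j χ i * (e * e * b - b * e * e) * a‖ ≤ ‖e * e * b - b * e * e‖ * ‖a‖ := by
      refine (norm_mul_le _ _).trans (mul_le_mul_of_nonneg_right ?_ (norm_nonneg _))
      exact (norm_mul_le _ _).trans (mul_le_of_le_one_left (norm_nonneg _) (hγn j χ i))
    have h4 := norm_sub_norm_le ((P j χ i * b - b * P j χ i) * a)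
      (γ j χ i * (e * e * b - b * e * e) * a)
    linarith
  have ev3 : ∀ᶠ i in l, ∀ a ∈ F, ‖(∑ j, ∑ χ, P j χ i) * a - a‖ < ε := by
    rw [Finset.eventually_all]
    intro a ha
    have h1 := ((hadd a).sub_const a).norm
    exact h1.eventually_lt_const (he1 a ha)
  obtain ⟨i, h1, h2, h3⟩ := (ev1.and (ev2.and ev3)).exists
  refine ⟨fun j => (r j i)⁺, fun j => ⟨?_, ?_⟩, h1, h2, h3⟩
  · exact CStarAlgebra.nonneg_iff_eq_star_mul_self.1 (CFC.posPart_nonneg _)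
  · exact (norm_posPart_le_norm (hrs j i)).trans (hen' (hγn j 1 i))

end Towers

/-! ### From Rokhlin towers to asymptotic representations -/

section CharNet

variable {ι B G : Type*} [NonUnitalCStarAlgebra B]

/-- Products `b c` are dense in a C⋆-algebra, so that an equicontinuous family of maps that tends
to zero on products tends to zero everywhere. -/
lemma tendsto_zero_of_forall_mul {l : Filter ι} {T : ι → B → B} {C : ℝ}
    (hT : ∀ i x y, ‖T i x - T i y‖ ≤ C * ‖x - y‖)
    (h : ∀ b c, Tendsto (fun i => T i (b * c)) l (𝓝 0)) (b : B) :
    Tendsto (fun i => T i b) l (𝓝 0) := by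
  let := CStarAlgebra.spectralOrder B
  have := CStarAlgebra.spectralOrderedRing B
  rw [Metric.tendsto_nhds]
  intro ε hε
  have h1 : Tendsto (fun e => C * ‖b - b * e‖) (CStarAlgebra.approximateUnit B) (𝓝 0) := by
    have := (((CStarAlgebra.increasingApproximateUnit B).tendsto_mul_left b).const_sub b).norm
    rw [sub_self, norm_zero] at this
    simpa using this.const_mul C
  obtain ⟨e, he⟩ := (h1.eventually_lt_const (half_pos hε)).exists
  have h2 := (h b e).norm
  rw [norm_zero] at h2
  filter_upwards [h2.eventually_lt_const (half_pos hε)] with i hi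
  rw [dist_zero_right]
  have h3 : T i b = (T i b - T i (b * e)) + T i (b * e) := by abel
  rw [h3]
  refine (norm_add_le _ _).trans_lt ?_
  linarith [hT i b (b * e)]

/-- Self-adjointness turns commutation in the limit tested by right multiplication into
commutation in norm. -/
lemma asympCentral_of_star_eq {l : Filter ι} {y : ι → B} {C : ℝ} (hC : ∀ i, ‖y i‖ ≤ C)
    (hs : ∀ i, star (y i) = y i)
    (h : ∀ a b, Tendsto (fun i => (y i * b - b * y i) * a) l (𝓝 0)) : AsympCentral l y := by
  refine tendsto_zero_of_forall_mul (T := fun i b => y i * b - b * y i) (C := 2 * C) ?_ ?_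
  · intro i a b
    have h1 : y i * a - a * y i - (y i * b - b * y i) = y i * (a - b) - (a - b) * y i := by
      noncomm_ring
    rw [h1]
    refine (norm_sub_le _ _).trans ?_
    have h2 := (norm_mul_le (y i) (a - b)).trans
      (mul_le_mul_of_nonneg_right (hC i) (norm_nonneg _))
    have h3 := (norm_mul_le (a - b) (y i)).trans
      (mul_le_mul_of_nonneg_left (hC i) (norm_nonneg _))
    linarith
  · intro a b
    have h1 := (h (star a) (star b)).star
    rw [star_zero] at h1
    have h2 := (h b a).sub h1
    rw [sub_zero] at h2
    refine h2.congr fun i => ?_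
    simp only [star_mul, star_sub, star_star, hs]
    noncomm_ring

variable [CommGroup G] [Fintype G]

/-- The Fourier transform `v_g = ∑_χ χ(g) f_χ` of a tower `f`. -/
noncomputable def charNet (f : (G →* Circle) → ι → B) (g : G) (i : ι) : B :=
  ∑ χ, (χ g : ℂ) • f χ i

lemma star_charNet {f : (G →* Circle) → ι → B} (hs : ∀ χ i, star (f χ i) = f χ i) (g : G) (i : ι) :
    star (charNet f g i) = charNet f g⁻¹ i := by
  simp only [charNet, star_sum, star_smul, star_character, hs]

lemma charNet_one (f : (G →* Circle) → ι → B) (i : ι) : charNet f (1 : G) i = ∑ χ, f χ i := by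
  simp [charNet]

lemma norm_charNet_le {f : (G →* Circle) → ι → B} (hb : ∀ χ i, ‖f χ i‖ ≤ 1) (g : G) (i : ι) :
    ‖charNet f g i‖ ≤ Fintype.card (G →* Circle) := by
  refine (norm_sum_le _ _).trans
    ((Finset.sum_le_sum (g := fun _ => (1 : ℝ)) fun χ _ => ?_).trans ?_)
  · rw [norm_smul, Circle.norm_coe, one_mul]
    exact hb χ i
  · simp

/-- If the `f_χ` are orthogonal, then only the diagonal terms contribute to products of their
linear combinations. -/
lemma strictNull_sum_sum {l : Filter ι} {f : (G →* Circle) → ι → B}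
    (ho : ∀ χ τ, χ ≠ τ → StrictNull l fun i => f χ i * f τ i)
    (c : (G →* Circle) → (G →* Circle) → ℂ) (hc : ∀ χ, c χ χ = 0) :
    StrictNull l fun i => ∑ χ, ∑ τ, c χ τ • (f χ i * f τ i) := by
  intro b
  have h : ∀ χ τ, Tendsto (fun i => c χ τ • (f χ i * f τ i * b)) l (𝓝 0) := by
    intro χ τ
    by_cases hne : χ = τ
    · subst hne
      simp only [hc, zero_smul]
      exact tendsto_const_nhds
    · have := (ho χ τ hne b).const_smul (c χ τ)
      rwa [smul_zero] at this
  have h1 := tendsto_finsetSum Finset.univ fun χ _ =>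
    tendsto_finsetSum Finset.univ fun τ _ => h χ τ
  simp only [Finset.sum_const_zero] at h1
  refine h1.congr fun i => ?_
  simp only [Finset.sum_mul, smul_mul_assoc]

lemma strictNull_charNet_mul {l : Filter ι} {f : (G →* Circle) → ι → B}
    (ho : ∀ χ τ, χ ≠ τ → StrictNull l fun i => f χ i * f τ i) (g h : G) :
    StrictNull l fun i => charNet f g i * charNet f h i - charNet f 1 i * charNet f (g * h) i := by
  have h1 := strictNull_sum_sum ho (fun χ τ => (χ g : ℂ) * (τ h : ℂ) - (τ (g * h) : ℂ))
    fun χ => by simp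
  intro b
  refine (h1 b).congr fun i => ?_
  congr 1
  simp only [charNet, Finset.sum_mul_sum]
  rw [← Finset.sum_sub_distrib]
  refine Finset.sum_congr rfl fun χ _ => ?_
  rw [← Finset.sum_sub_distrib]
  refine Finset.sum_congr rfl fun τ _ => ?_
  rw [smul_mul_smul_comm, smul_mul_smul_comm, sub_smul, MonoidHom.map_one, Circle.coe_one, one_mul]

lemma asympRep_charNet {l : Filter ι} {f : (G →* Circle) → ι → B}
    (hb : ∀ χ i, ‖f χ i‖ ≤ 1) (hs : ∀ χ i, star (f χ i) = f χ i) (hc : ∀ χ, AsympCentral l (f χ))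
    (ho : ∀ χ τ, χ ≠ τ → StrictNull l fun i => f χ i * f τ i) : AsympRep l (charNet f) where
  bdd g := ⟨_, norm_charNet_le hb g⟩
  central g := AsympCentral.sum fun χ _ => (hc χ).smul _
  star_one i := by rw [star_charNet hs, inv_one]
  mul := strictNull_charNet_mul ho
  normal g := by
    intro b
    have h := (strictNull_charNet_mul ho g⁻¹ g b).sub (strictNull_charNet_mul ho g g⁻¹ b)
    rw [sub_zero] at h
    refine h.congr fun i => ?_
    simp only [star_charNet hs, inv_mul_cancel, mul_inv_cancel]
    noncomm_ring

/-- The nets `v_g` are asymptotically contractive, as `v_g⋆ v_g ≈ v_1² ≈ ∑_χ f_χ² ≤ v_1`. -/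
lemma eventually_norm_charNet_mul_lt {l : Filter ι} {f : (G →* Circle) → ι → B}
    (hb : ∀ χ i, ‖f χ i‖ ≤ 1) (hp : ∀ χ i, ∃ b, f χ i = star b * b)
    (ho : ∀ χ τ, χ ≠ τ → StrictNull l fun i => f χ i * f τ i) (g : G) {e : B}
    (hes : star e = e) (he : ‖e‖ ≤ 1) {η : ℝ} (hη : 0 < η) :
    ∀ᶠ i in l, ‖charNet f g i * e‖ < 1 + η := by
  let := CStarAlgebra.spectralOrder B
  have := CStarAlgebra.spectralOrderedRing B
  classical
  have hf0 : ∀ χ i, 0 ≤ f χ i := fun χ i => by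
    obtain ⟨b, hb⟩ := hp χ i
    rw [hb]
    exact star_mul_self_nonneg b
  have hs : ∀ χ i, star (f χ i) = f χ i := fun χ i => (IsSelfAdjoint.of_nonneg (hf0 χ i)).star_eq
  -- the norm of `(v_g e)⋆ (v_g e)` is almost that of `(v_1 e)⋆ (v_1 e)`
  have h1 := (strictNull_charNet_mul ho g⁻¹ g e).norm
  rw [norm_zero] at h1
  -- the off-diagonal part of `v_1²`
  have h2 := (strictNull_sum_sum ho (fun χ τ => if χ = τ then 0 else 1)
    (fun χ => if_pos rfl) e).norm
  rw [norm_zero] at h2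
  have hη3 : 0 < η / 3 := by positivity
  filter_upwards [h1.eventually_lt_const hη3, h2.eventually_lt_const hη3] with i hi1 hi2
  set v := charNet f g i
  set w := charNet f (1 : G) i with hw
  have hws : star w = w := by rw [hw, star_charNet hs, inv_one]
  have hnorm : ∀ x : B, ‖x * e‖ * ‖x * e‖ = ‖e * (star x * x * e)‖ := fun x => by
    rw [← CStarRing.norm_star_mul_self, star_mul, hes]
    simp only [mul_assoc]
  have heX : ∀ x : B, ‖e * x‖ ≤ ‖x‖ := fun x =>
    (norm_mul_le _ _).trans (mul_le_of_le_one_left (norm_nonneg _) he)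
  have a1 : ‖v * e‖ * ‖v * e‖ ≤ η / 3 + ‖w * e‖ * ‖w * e‖ := by
    rw [hnorm, hnorm, hws]
    rw [inv_mul_cancel] at hi1
    have e1 : e * (star v * v * e) = e * ((charNet f g⁻¹ i * v - w * w) * e) + e * (w * w * e) := by
      rw [star_charNet hs]; noncomm_ring
    rw [e1]
    exact (norm_add_le _ _).trans (add_le_add ((heX _).trans hi1.le) le_rfl)
  have a2 : ‖w * e‖ * ‖w * e‖ ≤ η / 3 + ‖w * e‖ := by
    rw [hnorm, hws]
    set o := ∑ χ, ∑ τ, (if χ = τ then (0 : ℂ) else 1) • (f χ i * f τ i) with ho'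
    have e1 : w * w = o + ∑ χ, f χ i * f χ i := by
      rw [hw, charNet_one, Finset.sum_mul_sum, ho', ← Finset.sum_add_distrib]
      refine Finset.sum_congr rfl fun χ _ => ?_
      rw [← Finset.add_sum_erase _ _ (Finset.mem_univ χ),
        ← Finset.add_sum_erase Finset.univ
          (fun τ => (if χ = τ then (0 : ℂ) else 1) • (f χ i * f τ i)) (Finset.mem_univ χ),
        if_pos rfl, zero_smul, zero_add, add_comm]
      congr 1
      refine Finset.sum_congr rfl fun τ hτ => ?_
      rw [if_neg (Finset.ne_of_mem_erase hτ).symm, one_smul]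
    have e2 : e * (w * w * e) = e * (o * e) + e * (∑ χ, f χ i * f χ i) * e := by
      rw [e1]; noncomm_ring
    have e3 : ∀ χ, f χ i * f χ i ≤ f χ i := fun χ => by
      obtain ⟨b, hb'⟩ := hp χ i
      have h0 : 0 ≤ star b * b := star_mul_self_nonneg b
      have h3 : ‖b * star b‖ ≤ 1 := by
        rw [CStarRing.norm_self_mul_star, ← CStarRing.norm_star_mul_self, ← hb']
        exact hb χ i
      have h4 := CStarAlgebra.star_left_conjugate_le_norm_smul (a := b) (b := b * star b)
      rw [hb']
      calc star b * b * (star b * b) = star b * (b * star b) * b := by simp only [mul_assoc]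
        _ ≤ ‖b * star b‖ • (star b * b) := h4
        _ ≤ (1 : ℝ) • (star b * b) := smul_le_smul_of_nonneg_right h3 h0
        _ = star b * b := one_smul _ _
    have e4 : ‖e * (∑ χ, f χ i * f χ i) * e‖ ≤ ‖e * w * e‖ := by
      refine CStarAlgebra.norm_le_norm_of_nonneg_of_le ?_ ?_
      · refine (show IsSelfAdjoint e from hes).conjugate_nonneg (Finset.sum_nonneg fun χ _ => ?_)
        have := star_mul_self_nonneg (f χ i)
        rwa [hs] at this
      · refine (show IsSelfAdjoint e from hes).conjugate_le_conjugate ?_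
        rw [hw, charNet_one]
        exact Finset.sum_le_sum fun χ _ => e3 χ
    rw [e2]
    refine (norm_add_le _ _).trans (add_le_add ((heX _).trans hi2.le) (e4.trans ?_))
    rw [mul_assoc]
    exact heX _
  have n1 := norm_nonneg (v * e)
  have n2 := norm_nonneg (w * e)
  have a3 : ‖w * e‖ ≤ 1 + η / 3 := by nlinarith
  nlinarith

end CharNet

/-! ### The elements `a u_g` of the crossed product -/

namespace PartialAction

namespace CrossedProduct

variable {G : Type*} {A : Type*} [Group G] [NonUnitalCStarAlgebra A]
  {α : PartialAction G A}

lemma single_sub (g : G) {a b : A} (ha : a ∈ α.ideal g) (hb : b ∈ α.ideal g) :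
    single g a ha - single g b hb = single g (a - b) (sub_mem ha hb) := by
  ext k
  rcases eq_or_ne k g with rfl | hne
  · simp only [coeff_sub, coeff_single_same]
  · simp only [coeff_sub, coeff_single_of_ne hne, sub_zero]

lemma single_congr {g h : G} (hgh : g = h) {a b : A} (hab : a = b) (ha : a ∈ α.ideal g) :
    single g a ha = single h b (hgh ▸ hab ▸ ha) := by
  subst hgh hab
  rfl

lemma star_single {g : G} {a : A} (ha : a ∈ α.ideal g) :
    star (single g a ha) = single g⁻¹ (α.act g⁻¹ (star a)) (α.act_mem _ _) := by
  ext k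
  rw [coeff_star]
  rcases eq_or_ne k g⁻¹ with rfl | hne
  · rw [coeff_single_same, inv_inv, coeff_single_same]
  · rw [coeff_single_of_ne hne, coeff_single_of_ne, star_zero, act_zero]
    exact fun h0 => hne (inv_eq_iff_eq_inv.1 h0)

variable [Fintype G]

lemma norm_coeff_le (x : CrossedProduct α) (g : G) : ‖x.coeff g‖ ≤ ‖x‖ :=
  isCStarNorm_univNorm.coeff_le x g

lemma coeff_sum {κ : Type*} (s : Finset κ) (x : κ → CrossedProduct α) (g : G) :
    (∑ k ∈ s, x k).coeff g = ∑ k ∈ s, (x k).coeff g := by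
  classical
  induction s using Finset.induction_on with
  | empty => simp
  | insert k s hk ih => rw [Finset.sum_insert hk, Finset.sum_insert hk, coeff_add, ih]

lemma sum_single_coeff (x : CrossedProduct α) :
    ∑ g, single g (x.coeff g) (x.coeff_mem g) = x := by
  ext k
  rw [coeff_sum, Finset.sum_eq_single k]
  · rw [coeff_single_same]
  · intro g _ hne
    rw [coeff_single_of_ne hne.symm]
  · simp

lemma single_mul_single {g h : G} {a b : A} (ha : a ∈ α.ideal g) (hb : b ∈ α.ideal h) :
    single g a ha * single h b hb = single (g * h) (α.conv g a b) (α.conv_mem g h a hb) := by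
  ext k
  rw [coeff_mul, Finset.sum_eq_single g]
  · rw [coeff_single_same]
    rcases eq_or_ne k (g * h) with rfl | hne
    · rw [inv_mul_cancel_left, coeff_single_same, coeff_single_same]
    · rw [coeff_single_of_ne hne, coeff_single_of_ne, conv_zero_right]
      exact fun h0 => hne (inv_mul_eq_iff_eq_mul.1 h0)
  · intro k' _ hne
    rw [coeff_single_of_ne hne, conv_zero_left]
  · simp

variable (α) in
/-- The embedding `a ↦ a u_e` of `A` into the crossed product. -/
noncomputable def embed : A →⋆ₙₐ[ℂ] CrossedProduct α where
  toFun a := single 1 a (α.mem_one a)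
  map_smul' c a := by
    ext k
    rcases eq_or_ne k 1 with rfl | hne
    · simp [coeff_single_same]
    · simp [coeff_single_of_ne hne]
  map_zero' := by
    ext k
    rcases eq_or_ne k 1 with rfl | hne
    · simp [coeff_single_same]
    · simp [coeff_single_of_ne hne]
  map_add' a b := by
    ext k
    rcases eq_or_ne k 1 with rfl | hne
    · simp [coeff_single_same]
    · simp [coeff_single_of_ne hne]
  map_mul' a b := by
    rw [single_mul_single]
    exact single_congr (mul_one 1).symm (α.conv_one a b).symm _
  map_star' a := by
    rw [star_single]
    exact single_congr inv_one.symm (by rw [inv_one, act_one]) _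

lemma embed_apply (a : A) : embed α a = single 1 a (α.mem_one a) := rfl

lemma embed_mul_single {g : G} (a : A) {b : A} (hb : b ∈ α.ideal g) :
    embed α a * single g b hb = single g (a * b) (α.mul_mem_left _ _ _ hb) := by
  rw [embed_apply, single_mul_single]
  exact single_congr (one_mul g) (α.conv_one a b) _

lemma single_mul_embed {g : G} {a : A} (ha : a ∈ α.ideal g) (b : A) :
    single g a ha * embed α b = single g (α.conv g a b) (α.conv_mem_left _ _ _) := by
  rw [embed_apply, single_mul_single]
  exact single_congr (mul_one g) rfl _

lemma norm_single {g : G} {a : A} (ha : a ∈ α.ideal g) : ‖single g a ha‖ = ‖a‖ := by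
  refine le_antisymm ?_ ?_
  · have h1 : single g a ha * star (single g a ha) = embed α (a * star a) := by
      rw [star_single, single_mul_single]
      exact single_congr (mul_inv_cancel g) (α.conv_act_star ha ha) _
    have h2 : ‖single g a ha‖ * ‖single g a ha‖ ≤ ‖a‖ * ‖a‖ := by
      rw [← CStarRing.norm_self_mul_star, h1, ← CStarRing.norm_self_mul_star (x := a)]
      exact NonUnitalStarAlgHom.norm_apply_le (embed α) _
    exact (mul_self_le_mul_self_iff (norm_nonneg _) (norm_nonneg _)).2 h2
  · have := norm_coeff_le (single g a ha) g
    rwa [coeff_single_same] at this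

/-- A family of maps that depends additively on an element of the crossed product tends to zero as
soon as it does so on the elements `a u_g`. -/
lemma tendsto_zero_of_forall_single {ι : Type*} {l : Filter ι}
    (T : ι → CrossedProduct α →+ CrossedProduct α)
    (h : ∀ g a (ha : a ∈ α.ideal g), Tendsto (fun i => T i (single g a ha)) l (𝓝 0))
    (x : CrossedProduct α) : Tendsto (fun i => T i x) l (𝓝 0) := by
  have h1 := tendsto_finsetSum Finset.univ fun g _ => h g (x.coeff g) (x.coeff_mem g)
  rw [Finset.sum_const_zero] at h1
  refine h1.congr fun i => ?_
  rw [← map_sum, sum_single_coeff]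

lemma tendsto_single_zero {ι : Type*} {l : Filter ι} {g : G} {z : ι → A}
    (hz : ∀ i, z i ∈ α.ideal g) (h : Tendsto z l (𝓝 0)) :
    Tendsto (fun i => single g (z i) (hz i)) l (𝓝 0) := by
  rw [tendsto_zero_iff_norm_tendsto_zero] at h ⊢
  simpa only [norm_single] using h

/-- The images of an approximate unit of `A` form an approximate unit of the crossed product. -/
lemma isApproximateUnit_map_embed {L : Filter A} (hL : L.IsApproximateUnit) :
    (L.map (embed α)).IsApproximateUnit where
  tendsto_mul_left x := by
    rw [tendsto_map'_iff]
    have h := tendsto_zero_of_forall_single (α := α) (l := L)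
      (fun e => AddMonoidHom.mulRight (embed α e) - AddMonoidHom.id _) (fun g a ha => ?_) x
    · have := h.add_const x
      rw [zero_add] at this
      exact this.congr fun e => sub_add_cancel _ _
    · have ha' : a ∈ α.ideal g⁻¹⁻¹ := by rwa [inv_inv]
      have h1 : ∀ e, α.conv g a e - a = α.act g (α.act g⁻¹ a * e - α.act g⁻¹ a) := fun e => by
        have e1 : α.act g⁻¹ a ∈ α.ideal g⁻¹ := α.act_mem _ _
        have e2 := α.act_add (g := g) (sub_mem (α.conv_dom g a e) e1) e1
        rw [sub_add_cancel, α.act_act_inv ha] at e2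
        exact sub_eq_of_eq_add e2
      have h2 : Tendsto (fun e => α.conv g a e - a) L (𝓝 0) := by
        rw [tendsto_zero_iff_norm_tendsto_zero]
        have h3 := ((hL.tendsto_mul_left (α.act g⁻¹ a)).sub_const (α.act g⁻¹ a)).norm
        rw [sub_self, norm_zero] at h3
        refine h3.congr fun e => ?_
        rw [h1, α.norm_act (sub_mem (α.conv_dom g a e) (α.act_mem _ _))]
      refine (tendsto_single_zero (fun e => sub_mem (α.conv_mem_left g a e) ha) h2).congr
        fun e => ?_
      change _ = single g a ha * embed α e - single g a ha
      rw [single_mul_embed, single_sub]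
  tendsto_mul_right x := by
    rw [tendsto_map'_iff]
    have h := tendsto_zero_of_forall_single (α := α) (l := L)
      (fun e => AddMonoidHom.mulLeft (embed α e) - AddMonoidHom.id _) (fun g a ha => ?_) x
    · have := h.add_const x
      rw [zero_add] at this
      exact this.congr fun e => sub_add_cancel _ _
    · have h2 := (hL.tendsto_mul_right a).sub_const a
      rw [sub_self] at h2
      refine (tendsto_single_zero (fun e => sub_mem (α.mul_mem_left g e a ha) ha) h2).congr
        fun e => ?_
      change _ = embed α e * single g a ha - single g a ha
      rw [embed_mul_single, single_sub]
  neBot := hL.neBot.map _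

/-- Strict nullity passes from the coefficient to `z u_g`. -/
lemma strictNull_single {ι : Type*} {l : Filter ι} {g : G} {z : ι → A}
    (hz : ∀ i, z i ∈ α.ideal g)
    (h : ∀ b, Tendsto (fun i => α.conv g (z i) b) l (𝓝 0)) :
    StrictNull l fun i => single g (z i) (hz i) := by
  refine tendsto_zero_of_forall_single (α := α) (l := l)
    (fun i => AddMonoidHom.mulLeft (single g (z i) (hz i))) fun k b hb => ?_
  refine (tendsto_single_zero (fun i => α.conv_mem g k (z i) hb) (h b)).congr fun i => ?_
  exact (single_mul_single _ _).symm

end CrossedProduct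

end PartialAction

namespace PartialAction

/-! ### Finite dimension forces the action to be global -/

section Global

variable {G : Type*} {A : Type*} [Group G] [NonUnitalCStarAlgebra A] (α : PartialAction G A)

/-- If `x⋆ x` is close to the ideal `A_g`, then so is `x`: cut down by an approximate unit of
`A_g`. -/
lemma exists_norm_sub_sq_le {g : G} (x : A) {n : A} (hn : n ∈ α.ideal g) {ε : ℝ} (hε : 0 < ε) :
    ∃ y ∈ α.ideal g, ‖x - y‖ * ‖x - y‖ ≤ 4 * ‖star x * x - n‖ + ε := by
  have hcl := α.isClosed_ideal g
  let := CStarAlgebra.spectralOrder (α.ideal g)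
  have := CStarAlgebra.spectralOrderedRing (α.ideal g)
  have hu := CStarAlgebra.increasingApproximateUnit (α.ideal g)
  have hu1 : Tendsto (fun u : α.ideal g => ‖(u : A) * n - n‖) (CStarAlgebra.approximateUnit _)
      (𝓝 0) := by
    have h := ((hu.tendsto_mul_right ⟨n, hn⟩).sub_const ⟨n, hn⟩).norm
    rw [sub_self, norm_zero] at h
    exact h
  have h2 := hu1.eventually_lt_const (half_pos hε)
  obtain ⟨u, ⟨⟨hu1, hus⟩, hun⟩⟩ :=
    (((h2.and hu.eventually_star_eq).and hu.eventually_norm)).exists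
  have hus' : star (u : A) = u := congrArg Subtype.val hus
  have hun' : ‖(u : A)‖ ≤ 1 := hun
  refine ⟨x * u, α.mul_mem_left _ _ _ u.2, ?_⟩
  set d := star x * x - n with hd
  have e1 : star (x - x * u) * (x - x * u) =
      (d - u * d - d * u + u * d * u) + (((u : A) * n - n) * u - ((u : A) * n - n)) := by
    rw [star_sub, star_mul, hus', hd]
    noncomm_ring
  have hd1 : ‖(u : A) * d‖ ≤ ‖d‖ :=
    (norm_mul_le _ _).trans (mul_le_of_le_one_left (norm_nonneg _) hun')
  have hd2 : ∀ y : A, ‖y * u‖ ≤ ‖y‖ := fun y =>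
    (norm_mul_le _ _).trans (mul_le_of_le_one_right (norm_nonneg _) hun')
  rw [← CStarRing.norm_star_mul_self, e1]
  have f1 : ‖d - u * d - d * u + u * d * u‖ ≤ 4 * ‖d‖ := by
    have a1 := norm_add_le (d - u * d - d * u) (u * d * u)
    have a2 := norm_sub_le (d - u * d) (d * u)
    have a3 := norm_sub_le d (u * d)
    linarith [hd2 d, (hd2 (u * d)).trans hd1]
  have f2 : ‖((u : A) * n - n) * u - ((u : A) * n - n)‖ ≤ ε := by
    refine (norm_sub_le _ _).trans ?_
    linarith [hd2 ((u : A) * n - n)]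
  exact (norm_add_le _ _).trans (add_le_add f1 f2)

/-- If `(∑_j q_j) b → b` and the `q_j² b` approach `A_g`, for self-adjoint `q_j`, then `b ∈ A_g`. -/
lemma mem_ideal_of_tendsto {ι J : Type*} [Fintype J] {l : Filter ι} [l.NeBot] {g : G} {b : A}
    {q : J → ι → A} (hq : ∀ j i, star (q j i) = q j i) {m : J → ι → A}
    (hm : ∀ j i, m j i ∈ α.ideal g) (h : ∀ j, Tendsto (fun i => q j i * q j i * b - m j i) l (𝓝 0))
    (hs : Tendsto (fun i => (∑ j, q j i) * b) l (𝓝 b)) : b ∈ α.ideal g := by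
  have key : ∀ j, ∀ δ > 0, ∀ᶠ i in l, ∃ y ∈ α.ideal g, ‖q j i * b - y‖ < δ := by
    intro j δ hδ
    have h1 := ((h j).norm).const_mul (4 * ‖b‖)
    rw [norm_zero, mul_zero] at h1
    have hδ2 : 0 < δ * δ / 2 := by positivity
    filter_upwards [h1.eventually_lt_const hδ2] with i hi
    obtain ⟨y, hy, hy'⟩ := α.exists_norm_sub_sq_le (q j i * b)
      (α.mul_mem_left g (star b) _ (hm j i)) (ε := δ * δ / 2) hδ2
    refine ⟨y, hy, ?_⟩
    have e1 : star (q j i * b) * (q j i * b) - star b * m j i =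
        star b * (q j i * q j i * b - m j i) := by
      rw [star_mul, hq]; noncomm_ring
    have h2 := norm_mul_le (star b) (q j i * q j i * b - m j i)
    rw [norm_star] at h2
    rw [e1] at hy'
    by_contra! hc
    nlinarith [norm_nonneg (q j i * b - y)]
  have hmem : b ∈ closure (α.ideal g : Set A) := by
    rw [Metric.mem_closure_iff]
    intro ε hε
    have hJ : 0 < ε / 2 / (Fintype.card J + 1) := by positivity
    have h1 := (tendsto_iff_norm_sub_tendsto_zero.1 hs).eventually_lt_const (half_pos hε)
    obtain ⟨i, hi, hi'⟩ := (h1.and (eventually_all.2 fun j => key j _ hJ)).exists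
    choose y hy hy' using hi'
    refine ⟨∑ j, y j, sum_mem fun j _ => hy j, ?_⟩
    rw [dist_eq_norm]
    have e1 : b - ∑ j, y j = (b - (∑ j, q j i) * b) + ∑ j, (q j i * b - y j) := by
      rw [Finset.sum_sub_distrib, Finset.sum_mul]; abel
    rw [e1]
    refine (norm_add_le _ _).trans_lt ?_
    rw [norm_sub_rev b]
    have e2 : ‖∑ j, (q j i * b - y j)‖ ≤ ε / 2 := by
      refine (norm_sum_le _ _).trans ((Finset.sum_le_sum fun j _ => (hy' j).le).trans ?_)
      rw [Finset.sum_const, Finset.card_univ, nsmul_eq_mul, mul_div_assoc',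
        div_le_iff₀ (by positivity)]
      nlinarith
    linarith
  exact (α.isClosed_ideal g).closure_subset hmem

variable {α}

variable (hα : ∀ g, α.ideal g = ⊤)
include hα

lemma mem_of_global (g : G) (x : A) : x ∈ α.ideal g := by rw [hα]; trivial

lemma act_act_of_global (g h : G) (x : A) : α.act g (α.act h x) = α.act (g * h) x :=
  (α.act_comp (mem_of_global hα _ x) (mem_of_global hα _ _)).2.symm

lemma conv_of_global (g : G) (x y : A) : α.conv g x y = x * α.act g y := by
  unfold conv
  rw [α.act_mul (mem_of_global hα _ _) (mem_of_global hα _ _),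
    α.act_act_inv (mem_of_global hα _ _)]

lemma act_mul_of_global (g : G) (x y : A) : α.act g (x * y) = α.act g x * α.act g y :=
  α.act_mul (mem_of_global hα _ _) (mem_of_global hα _ _)

lemma act_add_of_global (g : G) (x y : A) : α.act g (x + y) = α.act g x + α.act g y :=
  α.act_add (mem_of_global hα _ _) (mem_of_global hα _ _)

lemma act_sub_of_global (g : G) (x y : A) : α.act g (x - y) = α.act g x - α.act g y := by
  have := act_add_of_global hα g (x - y) y
  rw [sub_add_cancel] at this
  exact eq_sub_of_add_eq this.symm

lemma act_star_of_global (g : G) (x : A) : α.act g (star x) = star (α.act g x) :=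
  α.act_star (mem_of_global hα _ _)

lemma norm_act_of_global (g : G) (x : A) : ‖α.act g x‖ = ‖x‖ :=
  α.norm_act (mem_of_global hα _ _)

lemma tendsto_act_zero {ι : Type*} {l : Filter ι} {z : ι → A} (g : G) (h : Tendsto z l (𝓝 0)) :
    Tendsto (fun i => α.act g (z i)) l (𝓝 0) := by
  rw [tendsto_zero_iff_norm_tendsto_zero] at h ⊢
  simpa only [norm_act_of_global hα] using h

lemma tendsto_act {ι : Type*} {l : Filter ι} {z : ι → A} {a : A} (g : G) (h : Tendsto z l (𝓝 a)) :
    Tendsto (fun i => α.act g (z i)) l (𝓝 (α.act g a)) := by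
  rw [tendsto_iff_norm_sub_tendsto_zero] at h ⊢
  simpa only [← act_sub_of_global hα, norm_act_of_global hα] using h

end Global

end PartialAction

/-- Quantifying over a tolerance and a finite set of test elements amounts to a limit along
`ℕ × Finset A`. -/
lemma tendsto_zero_of_norm_lt {A E : Type*} [NormedAddCommGroup E] {y : ℕ × Finset A → E}
    (s : Finset A) (h : ∀ p : ℕ × Finset A, s ⊆ p.2 → ‖y p‖ < 1 / ((p.1 : ℝ) + 1)) :
    Tendsto y atTop (𝓝 0) := by
  have h1 : Tendsto (fun p : ℕ × Finset A => 1 / ((p.1 : ℝ) + 1)) atTop (𝓝 0) := by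
    rw [← prod_atTop_atTop_eq]
    exact tendsto_one_div_add_atTop_nhds_zero_nat.comp tendsto_fst
  refine squeeze_zero_norm' ?_ h1
  filter_upwards [eventually_ge_atTop (0, s)] with p hp
  exact (h p hp.2).le

namespace PartialAction

/-! ### Representability bounds the Rokhlin dimension of the dual action -/

section RepToRokhlin

variable {G : Type*} {A : Type*} [CommGroup G] [NonUnitalCStarAlgebra A]
  {α : PartialAction G A}

/-- Bounded nets `x_g` with `x_g b ≈ α_g(b) x_g` and `α_g(a x_h) ≈ α_g(a) x_h`. For a global action
this says that the elements `x_g u_{g⁻¹}` of the crossed product are asymptotically central. -/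
structure LimitCovariant {ι : Type*} (l : Filter ι) (x : G → ι → A) (α : PartialAction G A) :
    Prop where
  mem : ∀ g i, x g i ∈ α.ideal g⁻¹
  bdd : ∃ C : ℝ, ∀ g i, ‖x g i‖ ≤ C
  equivariant : ∀ g h, ∀ a ∈ α.ideal g⁻¹,
    StrictNull l fun i => α.act g (a * x h i) - α.act g a * x h i
  semicentral : ∀ g, ∀ b ∈ α.ideal g⁻¹, Tendsto (fun i => x g i * b - α.act g b * x g i) l (𝓝 0)

/-- The relations defining representability, satisfied in the limit by bounded nets `x_g` (for one
colour). -/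
structure LimitRep {ι : Type*} (l : Filter ι) (x : G → ι → A) (α : PartialAction G A) : Prop
    extends LimitCovariant l x α where
  pos : ∀ i, ∃ b, x 1 i = star b * b
  normal : ∀ g, StrictNull l fun i => star (x g i) * x g i - x g i * star (x g i)
  mul : ∀ g h, StrictNull l fun i => x g i * x h i - x 1 i * x (g * h) i

lemma exists_limitRep {d : ℕ} (h : α.ApproxRepresentable d) :
    ∃ x : Fin (d + 1) → G → (ℕ × Finset A) → A, (∀ j, LimitRep atTop (x j) α) ∧
      (∀ j g i, ‖x j g i‖ ≤ 1) ∧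
      ∀ b, Tendsto (fun i => (∑ j, x j 1 i) * b) atTop (𝓝 b) := by
  classical
  choose x hx using fun p : ℕ × Finset A => h (1 / ((p.1 : ℝ) + 1)) (by positivity) p.2
  refine ⟨fun j g p => x p j g, fun j => ?_,
    fun j g p => ((hx p).1 j g).2, ?_⟩
  · refine ⟨⟨fun g p => ((hx p).1 j g).1, ⟨1, fun g p => ((hx p).1 j g).2⟩,
      fun g h a ha b => ?_, fun g b hb => ?_⟩, fun p => (hx p).2.1 j, fun g b => ?_,
      fun g h b => ?_⟩
    · refine tendsto_zero_of_norm_lt {a, b} fun p hp => ?_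
      have := (hx p).2.2.2.2.1 j g h a (hp (by simp)) ha b (hp (by simp))
      rwa [mul_comm g h, mul_inv_cancel_right] at this
    · exact tendsto_zero_of_norm_lt {b} fun p hp => (hx p).2.2.2.2.2.2 j g b (hp (by simp)) hb
    · exact tendsto_zero_of_norm_lt {b} fun p hp => (hx p).2.2.1 j g b (hp (by simp))
    · exact tendsto_zero_of_norm_lt {b} fun p hp => (hx p).2.2.2.1 j g h b (hp (by simp))
  · intro b
    have : Tendsto (fun p => (∑ j, x p j 1) * b - b) atTop (𝓝 0) :=
      tendsto_zero_of_norm_lt {b} fun p hp => (hx p).2.2.2.2.2.1 b (hp (by simp))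
    have h1 := this.add_const b
    rw [zero_add] at h1
    exact h1.congr fun p => sub_add_cancel _ _

/-- A finite representability dimension forces all ideals to be the whole algebra: `x_1² b` is close
to `x_{g⁻¹} x_g b ∈ A_g`. -/
lemma global_of_limitRep {ι J : Type*} [Fintype J] {l : Filter ι} [l.NeBot] {x : J → G → ι → A}
    (hx : ∀ j, LimitRep l (x j) α) (hs : ∀ b, Tendsto (fun i => (∑ j, x j 1 i) * b) l (𝓝 b))
    (g : G) : α.ideal g = ⊤ := by
  refine NonUnitalStarAlgebra.eq_top_iff.2 fun b => ?_
  refine α.mem_ideal_of_tendsto (q := fun j => x j 1)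
    (m := fun j i => x j g⁻¹ i * x j g i * b) ?_ ?_ ?_ (hs b)
  · intro j i
    obtain ⟨c, hc⟩ := (hx j).pos i
    rw [hc, star_mul, star_star]
  · intro j i
    have := (hx j).mem g⁻¹ i
    rw [inv_inv] at this
    exact α.mul_mem_right _ _ _ (α.mul_mem_right _ _ _ this)
  · intro j
    have := ((hx j).mul g⁻¹ g b).neg
    rw [neg_zero] at this
    refine this.congr fun i => ?_
    rw [inv_mul_cancel]
    noncomm_ring

namespace LimitCovariant

variable {ι : Type*} {l : Filter ι} {x : G → ι → A} (hx : LimitCovariant l x α)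
  (hα : ∀ g, α.ideal g = ⊤)

include hx hα

lemma tendsto_act_sub_semicentral (g h : G) (b : A) :
    Tendsto (fun i => (α.act g (x h i) - x h i) * b - α.act h b * (α.act g (x h i) - x h i)) l
      (𝓝 0) := by
  have h1 := tendsto_act_zero hα g (hx.semicentral h (α.act g⁻¹ b) (mem_of_global hα _ _))
  have h2 := h1.sub (hx.semicentral h b (mem_of_global hα _ _))
  rw [sub_zero] at h2
  refine h2.congr fun i => ?_
  have e1 : α.act g (α.act g⁻¹ b) = b := α.act_act_inv (mem_of_global hα _ _)
  have e2 : α.act g (α.act h (α.act g⁻¹ b)) = α.act h b := by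
    rw [act_act_of_global hα, act_act_of_global hα, mul_comm g h, mul_inv_cancel_right]
  rw [act_sub_of_global hα, act_mul_of_global hα, act_mul_of_global hα, e1, e2]
  noncomm_ring

lemma exists_norm_act_sub_le (g h : G) : ∃ C : ℝ, ∀ i, ‖α.act g (x h i) - x h i‖ ≤ C := by
  obtain ⟨C, hC⟩ := hx.bdd
  refine ⟨2 * C, fun i => (norm_sub_le _ _).trans ?_⟩
  rw [norm_act_of_global hα]
  linarith [hC h i]

lemma strictNull_act_sub (g h : G) : StrictNull l fun i => α.act g (x h i) - x h i := by
  obtain ⟨C, hC⟩ := hx.exists_norm_act_sub_le hα g h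
  refine tendsto_zero_of_forall_mul (T := fun i b => (α.act g (x h i) - x h i) * b) (C := C) ?_ ?_
  · intro i b c
    rw [← mul_sub]
    exact (norm_mul_le _ _).trans (mul_le_mul_of_nonneg_right (hC i) (norm_nonneg _))
  · intro b c
    have h1 := tendsto_mul_bdd_zero (x := fun _ : ι => c) (fun _ => le_rfl)
      (hx.tendsto_act_sub_semicentral hα g h b)
    have h2 := hx.equivariant g h (α.act g⁻¹ (α.act h b)) (mem_of_global hα _ _) c
    have h3 := h1.add h2
    rw [zero_add] at h3
    refine h3.congr fun i => ?_
    have e1 : α.act g (α.act g⁻¹ (α.act h b)) = α.act h b := α.act_act_inv (mem_of_global hα _ _)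
    simp only [act_mul_of_global hα, e1]
    noncomm_ring

lemma tendsto_mul_act_sub (g h : G) (c : A) :
    Tendsto (fun i => c * (α.act g (x h i) - x h i)) l (𝓝 0) := by
  have h1 := (hx.strictNull_act_sub hα g h (α.act h⁻¹ c)).sub
    (hx.tendsto_act_sub_semicentral hα g h (α.act h⁻¹ c))
  rw [sub_zero] at h1
  refine h1.congr fun i => ?_
  have e1 : α.act h (α.act h⁻¹ c) = c := α.act_act_inv (mem_of_global hα _ _)
  rw [e1]
  noncomm_ring

/-- The coefficients of `v_g⋆ v_g` and `x_g⋆ x_g` agree in the limit, for `v_g = x_g u_{g⁻¹}`. -/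
lemma strictNull_act_star_mul_self_sub (g : G) :
    StrictNull l fun i => α.act g (star (x g i) * x g i) - star (x g i) * x g i := by
  intro b
  obtain ⟨C, hC⟩ := hx.bdd
  obtain ⟨C', hC'⟩ := hx.exists_norm_act_sub_le hα g g
  have h1 := tendsto_bdd_mul_zero (x := fun i => α.act g (star (x g i))) (C := C)
    (fun i => by rw [norm_act_of_global hα, norm_star]; exact hC g i)
    (hx.strictNull_act_sub hα g g b)
  have h2 := tendsto_bdd_mul_zero (x := fun i => star (α.act g (x g i) - x g i)) (C := C')
    (fun i => by rw [norm_star]; exact hC' i) (hx.semicentral g b (mem_of_global hα _ _))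
  have h3 := (hx.tendsto_mul_act_sub hα g g (star (α.act g b))).star
  rw [star_zero] at h3
  have h5 := (h1.add h2).add (tendsto_mul_bdd_zero (x := x g) (hC g) h3)
  simp only [add_zero] at h5
  refine h5.congr fun i => ?_
  simp only [act_mul_of_global hα, act_star_of_global hα, star_mul, star_sub, star_star]
  noncomm_ring

end LimitCovariant

namespace LimitRep

variable [Fintype G] {ι : Type*} {l : Filter ι} {x : G → ι → A} (hx : LimitRep l x α)
  (hα : ∀ g, α.ideal g = ⊤)

include hx hα

/-- The elements `x_g u_{g⁻¹}` form an asymptotic representation in the crossed product: twisting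
by `u_{g⁻¹}` turns the relation `x_g b ≈ α_g(b) x_g` into centrality. -/
lemma asympRep_single :
    AsympRep l fun g i => CrossedProduct.single g⁻¹ (x g i) (hx.mem g i) where
  bdd g := by
    obtain ⟨C, hC⟩ := hx.bdd
    exact ⟨C, fun i => by rw [CrossedProduct.norm_single]; exact hC g i⟩
  star_one i := by
    obtain ⟨b, hb⟩ := hx.pos i
    rw [CrossedProduct.star_single]
    refine CrossedProduct.single_congr (inv_inv _ |>.trans inv_one.symm) ?_ _
    rw [inv_inv, act_one, hb, star_mul, star_star]
  central g := by
    refine CrossedProduct.tendsto_zero_of_forall_single (α := α) (l := l)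
      (fun i => AddMonoidHom.mulLeft (CrossedProduct.single g⁻¹ (x g i) (hx.mem g i)) -
        AddMonoidHom.mulRight (CrossedProduct.single g⁻¹ (x g i) (hx.mem g i))) fun k c hc => ?_
    have h1 := hx.semicentral g (α.act g⁻¹ c) (mem_of_global hα _ _)
    have h2 := h1.sub (hx.tendsto_mul_act_sub hα k g c)
    rw [sub_zero] at h2
    refine (CrossedProduct.tendsto_single_zero (α := α) (g := g⁻¹ * k)
      (fun i => mem_of_global hα _ _) h2).congr fun i => ?_
    change _ = CrossedProduct.single g⁻¹ (x g i) (hx.mem g i) * CrossedProduct.single k c hc -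
      CrossedProduct.single k c hc * CrossedProduct.single g⁻¹ (x g i) (hx.mem g i)
    have e1 : α.act g (α.act g⁻¹ c) = c := α.act_act_inv (mem_of_global hα _ _)
    rw [CrossedProduct.single_mul_single, CrossedProduct.single_mul_single,
      CrossedProduct.single_congr (mul_comm k g⁻¹) rfl, CrossedProduct.single_sub]
    refine CrossedProduct.single_congr rfl ?_ _
    rw [conv_of_global hα, conv_of_global hα, e1]
    noncomm_ring
  mul g h := by
    have h1 : StrictNull l fun i => x g i * α.act g⁻¹ (x h i) - x 1 i * x (g * h) i := by
      intro b
      obtain ⟨C, hC⟩ := hx.bdd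
      have h2 := (tendsto_bdd_mul_zero (hC g) (hx.strictNull_act_sub hα g⁻¹ h b)).add
        (hx.mul g h b)
      rw [add_zero] at h2
      refine h2.congr fun i => ?_
      noncomm_ring
    have h3 := CrossedProduct.strictNull_single (α := α) (g := (g * h)⁻¹)
      (z := fun i => x g i * α.act g⁻¹ (x h i) - x 1 i * x (g * h) i)
      (fun i => mem_of_global hα _ _) (fun b => by
        refine (h1 (α.act (g * h)⁻¹ b)).congr fun i => ?_
        rw [conv_of_global hα])
    intro y
    refine (h3 y).congr fun i => ?_
    congr 1
    dsimp only
    rw [CrossedProduct.single_mul_single, CrossedProduct.single_mul_single,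
      CrossedProduct.single_congr (show g⁻¹ * h⁻¹ = (g * h)⁻¹ by rw [mul_inv]) rfl,
      CrossedProduct.single_congr (show (1 : G)⁻¹ * (g * h)⁻¹ = (g * h)⁻¹ by
        rw [inv_one, one_mul]) rfl,
      CrossedProduct.single_sub]
    refine CrossedProduct.single_congr rfl ?_ _
    rw [conv_of_global hα, conv_of_global hα, inv_one, act_one]
  normal g := by
    have h3 := CrossedProduct.strictNull_single (α := α) (g := 1)
      (z := fun i => α.act g (star (x g i) * x g i) - x g i * star (x g i))
      (fun i => mem_of_global hα _ _) (fun b => by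
        have h1 := (hx.strictNull_act_star_mul_self_sub hα g b).add (hx.normal g b)
        rw [add_zero] at h1
        refine h1.congr fun i => ?_
        rw [conv_one]
        noncomm_ring)
    intro y
    refine (h3 y).congr fun i => ?_
    congr 1
    dsimp only
    rw [CrossedProduct.star_single, CrossedProduct.single_mul_single,
      CrossedProduct.single_mul_single,
      CrossedProduct.single_congr (inv_mul_cancel g⁻¹) rfl,
      CrossedProduct.single_congr (mul_inv_cancel g⁻¹) rfl,
      CrossedProduct.single_sub]
    refine CrossedProduct.single_congr rfl ?_ _
    rw [conv_of_global hα, conv_of_global hα, inv_inv, act_mul_of_global hα]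
    congr 2
    exact (α.act_inv_act (mem_of_global hα _ _)).symm

end LimitRep

variable [Fintype G]

lemma dualAut_single (χ : G →* Circle) {g : G} {a : A} (ha : a ∈ α.ideal g) :
    α.dualAut χ (CrossedProduct.single g a ha) = (χ g : ℂ) • CrossedProduct.single g a ha := by
  ext k
  rw [coeff_dualAut, CrossedProduct.coeff_smul]
  rcases eq_or_ne k g with rfl | hne
  · rfl
  · rw [CrossedProduct.coeff_single_of_ne hne, smul_zero, smul_zero]

lemma dualAut_dualAut (χ τ : G →* Circle) (x : CrossedProduct α) :
    α.dualAut χ (α.dualAut τ x) = α.dualAut (χ * τ) x := by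
  ext g
  simp [smul_smul]

/-- The towers are the orbits of the positive elements given by `exists_rokhlin_towers`, so that
almost equivariance holds exactly. -/
theorem rokhlinDimLE_of_approxRepresentable {d : ℕ} (h : α.ApproxRepresentable d) :
    α.dualAction.RokhlinDimLE d := by
  classical
  obtain ⟨x, hx, hn, hs⟩ := exists_limitRep h
  have hα := global_of_limitRep hx hs
  intro ε hε F
  let := CStarAlgebra.spectralOrder A
  have := CStarAlgebra.spectralOrderedRing A
  have hu := CStarAlgebra.increasingApproximateUnit A
  have hsum : ∀ a : CrossedProduct α, Tendsto
      (fun i => (∑ j, CrossedProduct.single (1 : G)⁻¹ (x j 1 i) ((hx j).mem 1 i)) * a) atTop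
      (𝓝 a) := by
    intro a
    have h1 := CrossedProduct.tendsto_zero_of_forall_single (α := α)
      (l := (atTop : Filter (ℕ × Finset A)))
      (fun i => AddMonoidHom.mulLeft (CrossedProduct.embed α (∑ j, x j 1 i)) -
        AddMonoidHom.id _) (fun k c hc => ?_) a
    · have h2 := h1.add_const a
      rw [zero_add] at h2
      refine h2.congr fun i => ?_
      change CrossedProduct.embed α (∑ j, x j 1 i) * a - a + a = _
      rw [sub_add_cancel, map_sum]
      congr 1
      exact Finset.sum_congr rfl fun j _ =>
        CrossedProduct.single_congr inv_one.symm rfl (α.mem_one _)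
    · have h2 := (hs c).sub_const c
      rw [sub_self] at h2
      refine (CrossedProduct.tendsto_single_zero (α := α) (g := k)
        (fun i => mem_of_global hα _ _) h2).congr fun i => ?_
      change _ = CrossedProduct.embed α (∑ j, x j 1 i) * CrossedProduct.single k c hc -
        CrossedProduct.single k c hc
      rw [CrossedProduct.embed_mul_single, CrossedProduct.single_sub]
  obtain ⟨f, hf1, hf2, hf3, hf4⟩ := exists_rokhlin_towers (l := atTop)
    (v := fun j g i => CrossedProduct.single g⁻¹ (x j g i) ((hx j).mem g i))
    (fun j => (hx j).asympRep_single hα)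
    (fun j g i => by rw [CrossedProduct.norm_single]; exact hn j g i)
    (fun j i => by
      obtain ⟨b, hb⟩ := (hx j).pos i
      refine ⟨CrossedProduct.embed α b, ?_⟩
      rw [← map_star, ← map_mul, ← hb]
      exact CrossedProduct.single_congr inv_one rfl _)
    hsum α.dualAut (fun j χ g i => dualAut_single χ _)
    (CrossedProduct.isApproximateUnit_map_embed hu.toIsApproximateUnit)
    (by
      rw [eventually_map]
      filter_upwards [hu.eventually_star_eq, hu.eventually_norm] with e he1 he2
      refine ⟨by rw [← map_star, he1], (NonUnitalStarAlgHom.norm_apply_le _ _).trans he2,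
        fun χ => ?_⟩
      rw [CrossedProduct.embed_apply, dualAut_single, map_one, Circle.coe_one, one_smul])
    hε F
  refine ⟨fun j χ => α.dualAut χ (f j), fun j χ => ⟨trivial, ?_, ?_⟩, hf2, hf3, hf4, ?_⟩
  · obtain ⟨b, hb⟩ := (hf1 j).1
    exact ⟨α.dualAut χ b, (congrArg (α.dualAut χ) hb).trans (by rw [map_mul, map_star])⟩
  · rw [StarAlgEquiv.norm_map]
    exact (hf1 j).2
  · intro j χ τ a _ y _ _
    rw [dualAction_act, dualAction_act, map_mul, dualAut_dualAut, sub_self, zero_mul, norm_zero]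
    exact hε

end RepToRokhlin

end PartialAction

namespace PartialAction

/-! ### The Rokhlin dimension of the dual action bounds representability -/

section RokhlinToRep

variable {G : Type*} {A : Type*} [CommGroup G] [Fintype G] [NonUnitalCStarAlgebra A]
  {α : PartialAction G A}

/-- Towers for the dual action in the limit. Almost equivariance allows one to replace each tower
by the orbit of its element at the trivial character. -/
lemma exists_limit_towers {d : ℕ} (h : α.dualAction.RokhlinDimLE d) :
    ∃ f : Fin (d + 1) → (ℕ × Finset (CrossedProduct α)) → CrossedProduct α,
      (∀ j i, (∃ b, f j i = star b * b) ∧ ‖f j i‖ ≤ 1) ∧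
      (∀ j χ, AsympCentral atTop fun i => α.dualAut χ (f j i)) ∧
      (∀ j χ τ, χ ≠ τ →
        StrictNull atTop fun i => α.dualAut χ (f j i) * α.dualAut τ (f j i)) ∧
      ∀ a, Tendsto (fun i => (∑ j, ∑ χ, α.dualAut χ (f j i)) * a) atTop (𝓝 a) := by
  classical
  choose f hf using fun p : ℕ × Finset (CrossedProduct α) =>
    h (1 / ((p.1 : ℝ) + 1)) (by positivity) p.2
  have hpos : ∀ j χ p, ∃ b, f p j χ = star b * b := fun j χ p => ((hf p).1 j χ).2.1
  have hn : ∀ j χ p, ‖f p j χ‖ ≤ 1 := fun j χ p => ((hf p).1 j χ).2.2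
  have hs : ∀ j χ p, star (f p j χ) = f p j χ := fun j χ p => by
    obtain ⟨b, hb⟩ := hpos j χ p
    rw [hb, star_mul, star_star]
  have horth : ∀ j χ τ, χ ≠ τ → StrictNull atTop fun p => f p j χ * f p j τ :=
    fun j χ τ hne a => tendsto_zero_of_norm_lt {a} fun p hp =>
      (hf p).2.1 j χ τ hne a (hp (by simp))
  have hcen : ∀ j χ, AsympCentral atTop fun p => f p j χ := fun j χ =>
    asympCentral_of_star_eq (hn j χ) (hs j χ) fun a b => tendsto_zero_of_norm_lt {a, b}
      fun p hp => (hf p).2.2.1 j χ a (hp (by simp)) b (hp (by simp))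
  have hadd : ∀ a, Tendsto (fun p => (∑ j, ∑ χ, f p j χ) * a) atTop (𝓝 a) := fun a => by
    have : Tendsto (fun p => (∑ j, ∑ χ, f p j χ) * a - a) atTop (𝓝 0) :=
      tendsto_zero_of_norm_lt {a} fun p hp => (hf p).2.2.2.1 a (hp (by simp))
    have h1 := this.add_const a
    rw [zero_add] at h1
    exact h1.congr fun p => sub_add_cancel _ _
  have hφn : ∀ j χ p, ‖α.dualAut χ (f p j 1)‖ ≤ 1 := fun j χ p => by
    rw [StarAlgEquiv.norm_map]; exact hn j 1 p
  have hinv : ∀ (χ : G →* Circle) (y : CrossedProduct α),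
      α.dualAut χ (α.dualAut χ⁻¹ y) = y := fun χ y => by
    rw [dualAut_dualAut, mul_inv_cancel]; ext g; simp
  have heq : ∀ j χ, StrictNull atTop fun p => α.dualAut χ (f p j 1) - f p j χ := by
    intro j χ
    refine tendsto_zero_of_forall_mul (T := fun p b => (α.dualAut χ (f p j 1) - f p j χ) * b)
      (C := 2) ?_ ?_
    · intro p b c
      rw [← mul_sub]
      refine (norm_mul_le _ _).trans (mul_le_mul_of_nonneg_right ?_ (norm_nonneg _))
      exact (norm_sub_le _ _).trans (by linarith [hφn j χ p, hn j χ p])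
    · intro y a
      refine tendsto_zero_of_norm_lt {α.dualAut χ⁻¹ y, a} fun p hp => ?_
      have h1 := (hf p).2.2.2.2 j χ 1 a (hp (by simp)) (α.dualAut χ⁻¹ y) (hp (by simp)) trivial
      rw [dualAction_act, dualAction_act, map_mul, hinv, mul_one, ← sub_mul] at h1
      rwa [← mul_assoc]
  refine ⟨fun j p => f p j 1, fun j p => ⟨hpos j 1 p, hn j 1 p⟩, ?_, ?_, ?_⟩
  · intro j χ b
    have h1 := tendsto_zero_iff_norm_tendsto_zero.1 (hcen j 1 (α.dualAut χ⁻¹ b))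
    rw [tendsto_zero_iff_norm_tendsto_zero]
    refine h1.congr fun p => ?_
    rw [← StarAlgEquiv.norm_map (α.dualAut χ), map_sub, map_mul, map_mul, hinv]
  · intro j χ τ hne b
    have h1 := tendsto_bdd_mul_zero (hφn j χ) (heq j τ b)
    have h2 := tendsto_bdd_mul_zero (x := fun p => α.dualAut χ (f p j 1) - f p j χ) (C := 2)
      (fun p => (norm_sub_le _ _).trans (by linarith [hφn j χ p, hn j χ p])) (hcen j τ b)
    have h3 := tendsto_mul_bdd_zero (hn j τ) (heq j χ b)
    have h4 := ((h1.add h2).add h3).add (horth j χ τ hne b)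
    simp only [add_zero] at h4
    refine h4.congr fun p => ?_
    noncomm_ring
  · intro a
    have h1 := tendsto_finsetSum Finset.univ fun j _ =>
      tendsto_finsetSum Finset.univ fun χ _ => heq j χ a
    simp only [Finset.sum_const_zero] at h1
    have h2 := h1.add (hadd a)
    rw [zero_add] at h2
    refine h2.congr fun p => ?_
    simp only [← Finset.sum_mul, Finset.sum_sub_distrib, sub_mul]
    abel

/-- The Fourier transform of an orbit of the dual action is homogeneous. -/
lemma charNet_dualAut {ι : Type*} (f : ι → CrossedProduct α) (g : G) (i : ι) :
    charNet (fun χ i => α.dualAut χ (f i)) g i =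
      CrossedProduct.single g⁻¹ ((charNet (fun χ i => α.dualAut χ (f i)) g i).coeff g⁻¹)
        (CrossedProduct.coeff_mem _ _) := by
  classical
  ext k
  rcases eq_or_ne k g⁻¹ with rfl | hne
  · rw [CrossedProduct.coeff_single_same]
  · rw [CrossedProduct.coeff_single_of_ne hne, charNet, CrossedProduct.coeff_sum]
    simp only [CrossedProduct.coeff_smul, coeff_dualAut, smul_smul, ← Circle.coe_mul, ← map_mul]
    rw [← Finset.sum_smul, sum_dual_apply_eq_ite, if_neg, zero_smul]
    exact fun h0 => hne (eq_inv_of_mul_eq_one_right h0)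

lemma CrossedProduct.coeff_single_mul {g : G} {a : A} (ha : a ∈ α.ideal g) (y : CrossedProduct α)
    (k : G) : (CrossedProduct.single g a ha * y).coeff k = α.conv g a (y.coeff (g⁻¹ * k)) := by
  rw [CrossedProduct.coeff_mul, Finset.sum_eq_single g]
  · rw [CrossedProduct.coeff_single_same]
  · intro k' _ hne
    rw [CrossedProduct.coeff_single_of_ne hne, conv_zero_left]
  · simp

/-- The coefficient at the unit of a positive element is positive. -/
lemma CrossedProduct.exists_coeff_one_eq_star_mul_self {y : CrossedProduct α}
    (hy : ∃ b, y = star b * b) : ∃ b : A, y.coeff 1 = star b * b := by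
  let := CStarAlgebra.spectralOrder A
  have := CStarAlgebra.spectralOrderedRing A
  obtain ⟨b, rfl⟩ := hy
  have h1 := CrossedProduct.coeff_mul_star_one (star b) (star b)
  rw [star_star] at h1
  rw [h1]
  exact CStarAlgebra.nonneg_iff_eq_star_mul_self.1
    (Finset.sum_nonneg fun g _ => mul_star_self_nonneg _)

lemma global_of_asympRep {ι J : Type*} [Fintype J] {l : Filter ι} [l.NeBot] {x : J → G → ι → A}
    (hmem : ∀ j g i, x j g i ∈ α.ideal g⁻¹)
    (hx : ∀ j, AsympRep l fun g i => CrossedProduct.single g⁻¹ (x j g i) (hmem j g i))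
    (hpos : ∀ j i, ∃ b, x j 1 i = star b * b)
    (hs : ∀ b, Tendsto (fun i => (∑ j, x j 1 i) * b) l (𝓝 b)) (g : G) : α.ideal g = ⊤ := by
  refine NonUnitalStarAlgebra.eq_top_iff.2 fun b => ?_
  refine α.mem_ideal_of_tendsto (q := fun j => x j 1)
    (m := fun j i => α.conv g (x j g⁻¹ i) (α.conv g⁻¹ (x j g i) b)) ?_ ?_ ?_ (hs b)
  · intro j i
    obtain ⟨c, hc⟩ := hpos j i
    rw [hc, star_mul, star_star]
  · exact fun j i => α.conv_mem_left _ _ _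
  · intro j
    have h1 := ((hx j).mul g⁻¹ g (CrossedProduct.embed α b)).neg
    rw [neg_zero, tendsto_zero_iff_norm_tendsto_zero] at h1
    refine squeeze_zero_norm (fun i => ?_) h1
    refine le_trans (le_of_eq ?_) (CrossedProduct.norm_coeff_le _ 1)
    congr 1
    have e1 : CrossedProduct.single (1 : G)⁻¹ (x j 1 i) (hmem j 1 i) =
        CrossedProduct.embed α (x j 1 i) := CrossedProduct.single_congr inv_one rfl _
    have e2 : CrossedProduct.single (g⁻¹ * g)⁻¹ (x j (g⁻¹ * g) i) (hmem j (g⁻¹ * g) i) =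
        CrossedProduct.embed α (x j 1 i) :=
      CrossedProduct.single_congr (by rw [inv_mul_cancel, inv_one]) (by rw [inv_mul_cancel]) _
    dsimp only
    rw [e1, e2, sub_mul, neg_sub, CrossedProduct.coeff_sub, ← map_mul, ← map_mul,
      mul_assoc (CrossedProduct.single _ _ _), CrossedProduct.coeff_single_mul,
      CrossedProduct.coeff_single_mul,
      CrossedProduct.embed_apply, CrossedProduct.embed_apply, CrossedProduct.coeff_single_same]
    simp only [inv_inv, mul_one, mul_inv_cancel, CrossedProduct.coeff_single_same, mul_assoc]

lemma limitCovariant_of_asympCentral {ι : Type*} {l : Filter ι} {x : G → ι → A}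
    (hα : ∀ g, α.ideal g = ⊤) (hmem : ∀ g i, x g i ∈ α.ideal g⁻¹)
    (hb : ∃ C : ℝ, ∀ g i, ‖x g i‖ ≤ C)
    (hc : ∀ g, AsympCentral l fun i => CrossedProduct.single g⁻¹ (x g i) (hmem g i)) :
    LimitCovariant l x α := by
  have key : ∀ g k c, Tendsto (fun i => x g i * α.act g⁻¹ c - c * α.act k (x g i)) l (𝓝 0) := by
    intro g k c
    have h1 := tendsto_zero_iff_norm_tendsto_zero.1
      (hc g (CrossedProduct.single k c (mem_of_global hα _ _)))
    rw [tendsto_zero_iff_norm_tendsto_zero]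
    refine h1.congr fun i => ?_
    dsimp only
    rw [CrossedProduct.single_mul_single, CrossedProduct.single_mul_single,
      CrossedProduct.single_congr (mul_comm k g⁻¹) rfl, CrossedProduct.single_sub,
      CrossedProduct.norm_single, conv_of_global hα, conv_of_global hα]
  have hsemi : ∀ g b, Tendsto (fun i => x g i * b - α.act g b * x g i) l (𝓝 0) := by
    intro g b
    refine (key g 1 (α.act g b)).congr fun i => ?_
    rw [act_one, α.act_inv_act (mem_of_global hα _ _)]
  refine ⟨hmem, hb, fun g h a _ b => ?_, fun g b _ => hsemi g b⟩
  have h1 := (hsemi h (α.act h⁻¹ (α.act g a))).sub (key h g (α.act g a))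
  rw [sub_zero] at h1
  refine (tendsto_mul_bdd_zero (x := fun _ : ι => b) (fun _ => le_rfl) h1).congr fun i => ?_
  dsimp only
  rw [act_mul_of_global hα, α.act_act_inv (mem_of_global hα _ _)]
  noncomm_ring

lemma limitRep_of_asympRep {ι : Type*} {l : Filter ι} {x : G → ι → A}
    (hα : ∀ g, α.ideal g = ⊤) (hmem : ∀ g i, x g i ∈ α.ideal g⁻¹)
    (hb : ∃ C : ℝ, ∀ g i, ‖x g i‖ ≤ C)
    (hv : AsympRep l fun g i => CrossedProduct.single g⁻¹ (x g i) (hmem g i))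
    (hpos : ∀ i, ∃ b, x 1 i = star b * b) : LimitRep l x α := by
  have hcov := limitCovariant_of_asympCentral hα hmem hb hv.central
  obtain ⟨C, hC⟩ := hb
  refine ⟨hcov, hpos, fun g b => ?_, fun g h b => ?_⟩
  · have h1 : Tendsto (fun i => (α.act g (star (x g i) * x g i) - x g i * star (x g i)) * b) l
        (𝓝 0) := by
      have h2 := tendsto_zero_iff_norm_tendsto_zero.1 (hv.normal g (CrossedProduct.embed α b))
      rw [tendsto_zero_iff_norm_tendsto_zero]
      refine h2.congr fun i => ?_
      dsimp only
      rw [CrossedProduct.star_single, CrossedProduct.single_mul_single,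
        CrossedProduct.single_mul_single,
        CrossedProduct.single_congr (inv_mul_cancel g⁻¹) rfl,
        CrossedProduct.single_congr (mul_inv_cancel g⁻¹) rfl,
        CrossedProduct.single_sub, CrossedProduct.single_mul_embed, CrossedProduct.norm_single,
        conv_one, conv_of_global hα, conv_of_global hα, inv_inv, act_mul_of_global hα,
        α.act_inv_act (mem_of_global hα _ _)]
    have h2 := h1.sub (hcov.strictNull_act_star_mul_self_sub hα g b)
    rw [sub_zero] at h2
    refine h2.congr fun i => ?_
    noncomm_ring
  · have h1 : Tendsto (fun i => (x g i * α.act g⁻¹ (x h i) - x 1 i * x (g * h) i) *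
        α.act (g * h)⁻¹ (α.act (g * h) b)) l (𝓝 0) := by
      have h2 := tendsto_zero_iff_norm_tendsto_zero.1
        (hv.mul g h (CrossedProduct.embed α (α.act (g * h) b)))
      rw [tendsto_zero_iff_norm_tendsto_zero]
      refine h2.congr fun i => ?_
      dsimp only
      rw [CrossedProduct.single_mul_single, CrossedProduct.single_mul_single,
        CrossedProduct.single_congr (show g⁻¹ * h⁻¹ = (g * h)⁻¹ by rw [mul_inv]) rfl,
        CrossedProduct.single_congr (show (1 : G)⁻¹ * (g * h)⁻¹ = (g * h)⁻¹ by
          rw [inv_one, one_mul]) rfl,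
        CrossedProduct.single_sub, CrossedProduct.single_mul_embed, CrossedProduct.norm_single,
        conv_of_global hα, conv_of_global hα, conv_of_global hα, inv_one, act_one]
    have h2 := h1.sub (tendsto_bdd_mul_zero (hC g) (hcov.strictNull_act_sub hα g⁻¹ h b))
    rw [sub_zero] at h2
    refine h2.congr fun i => ?_
    rw [α.act_inv_act (mem_of_global hα _ _)]
    noncomm_ring

/-- For a global action of a finite group, averaging an approximate unit yields an invariant one. -/
lemma exists_invariant_approximateUnit (hα : ∀ g, α.ideal g = ⊤) :
    ∃ L : Filter A, L.IsApproximateUnit ∧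
      ∀ᶠ e in L, star e = e ∧ ‖e‖ ≤ 1 ∧ ∀ g, α.act g e = e := by
  let := CStarAlgebra.spectralOrder A
  have := CStarAlgebra.spectralOrderedRing A
  have hu := CStarAlgebra.increasingApproximateUnit A
  set n : ℂ := (Fintype.card G : ℂ) with hn
  have hn0 : n ≠ 0 := Nat.cast_ne_zero.2 Fintype.card_ne_zero
  set m : A → A := fun e => n⁻¹ • ∑ g, α.act g e with hm
  have hsum : ∀ b : A, n⁻¹ • ∑ _g : G, b = b := fun b => by
    rw [Finset.sum_const, Finset.card_univ, ← Nat.cast_smul_eq_nsmul ℂ, smul_smul,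
      inv_mul_cancel₀ hn0, one_smul]
  have hcancel : ∀ g b, α.act g (α.act g⁻¹ b) = b := fun g b =>
    α.act_act_inv (mem_of_global hα _ _)
  refine ⟨(CStarAlgebra.approximateUnit A).map m, ⟨fun b => ?_, fun b => ?_⟩, ?_⟩
  · rw [tendsto_map'_iff]
    have h1 := (tendsto_finsetSum Finset.univ fun g _ =>
      tendsto_act hα g (hu.tendsto_mul_left (α.act g⁻¹ b))).const_smul n⁻¹
    simp only [hcancel, hsum] at h1
    refine h1.congr fun e => ?_
    simp only [Function.comp_apply, hm, mul_smul_comm, Finset.mul_sum, act_mul_of_global hα,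
      hcancel]
  · rw [tendsto_map'_iff]
    have h1 := (tendsto_finsetSum Finset.univ fun g _ =>
      tendsto_act hα g (hu.tendsto_mul_right (α.act g⁻¹ b))).const_smul n⁻¹
    simp only [hcancel, hsum] at h1
    refine h1.congr fun e => ?_
    simp only [Function.comp_apply, hm, smul_mul_assoc, Finset.sum_mul, act_mul_of_global hα,
      hcancel]
  · rw [eventually_map]
    filter_upwards [hu.eventually_star_eq, hu.eventually_norm] with e he1 he2
    refine ⟨?_, ?_, fun g => ?_⟩
    · simp only [hm, star_smul, star_sum, ← act_star_of_global hα, he1]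
      congr 1
      simp [hn]
    · have h0 : (0 : ℝ) < Fintype.card G := by exact_mod_cast Fintype.card_pos
      have h1 : ‖∑ g, α.act g e‖ ≤ Fintype.card G := by
        refine (norm_sum_le _ _).trans ((Finset.sum_le_sum (g := fun _ => (1 : ℝ))
          fun g _ => ?_).trans ?_)
        · rw [norm_act_of_global hα]; exact he2
        · simp
      have h2 : ‖n⁻¹‖ = (Fintype.card G : ℝ)⁻¹ := by simp [hn]
      rw [hm, norm_smul, h2, inv_mul_le_iff₀ h0, mul_one]
      exact h1
    · rw [hm, α.act_smul _ (mem_of_global hα _ _),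
        α.act_sum _ _ fun h => mem_of_global hα _ _]
      simp only [act_act_of_global hα]
      exact congrArg _ (Equiv.sum_comp (Equiv.mulLeft g) (fun h => α.act h e))

/-- Nets satisfying the relations of representability in the limit yield exact contractions, if
their cut-downs by invariant contractions `e` are asymptotically contractive: take
`(1 + η)⁻¹ e x_g e`, with `e` far out in an invariant approximate unit and `η` small. -/
lemma approxRepresentable_of_limitRep {ι : Type*} {l : Filter ι} [l.NeBot] {d : ℕ}
    (hα : ∀ g, α.ideal g = ⊤) {x : Fin (d + 1) → G → ι → A} (hx : ∀ j, LimitRep l (x j) α)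
    (hs : ∀ b, Tendsto (fun i => (∑ j, x j 1 i) * b) l (𝓝 b))
    (hn : ∀ e : A, star e = e → ‖e‖ ≤ 1 → (∀ g, α.act g e = e) → ∀ η > 0, ∀ j g,
      ∀ᶠ i in l, ‖x j g i * e‖ < 1 + η) : α.ApproxRepresentable d := by
  intro ε hε F
  obtain ⟨L, hL, hL'⟩ := exists_invariant_approximateUnit hα
  have := hL.neBot
  have hbd : ∃ C : ℝ, ∀ j g i, ‖x j g i‖ ≤ C := by
    choose C hC using fun j => (hx j).bdd
    refine ⟨∑ j, |C j|, fun j g i => (hC j g i).trans ?_⟩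
    have := Finset.single_le_sum (f := fun j => |C j|) (fun j _ => abs_nonneg _)
      (Finset.mem_univ j)
    linarith [le_abs_self (C j)]
  obtain ⟨C, hC⟩ := hbd
  -- first `e` is fixed, then `η`; only then does the net index move
  have hL1 : ∀ᶠ e in L, ‖e‖ ≤ 1 := hL'.mono fun e he => he.2.1
  have hl1 := tendsto_mul_self_mul hL hL1
  have hl2 := tendsto_mul_mul_self hL hL1
  obtain ⟨e, ⟨hes, hen, heα⟩, he1, he2⟩ : ∃ e : A, (star e = e ∧ ‖e‖ ≤ 1 ∧ ∀ g, α.act g e = e) ∧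
      (∀ b ∈ F, ‖e * e * b - b‖ < ε / 2) ∧
      (∀ g, ∀ b ∈ F, ‖e * e * α.act g b - α.act g b * e * e‖ * C < ε) := by
    refine (hL'.and (((Finset.eventually_all F).2 fun a _ => ?_).and
      (eventually_all.2 fun g => (Finset.eventually_all F).2 fun b _ => ?_))).exists
    · have h1 := ((hl1 a).sub_const a).norm
      rw [sub_self, norm_zero] at h1
      exact h1.eventually_lt_const (half_pos hε)
    · have h1 := (((hl1 (α.act g b)).sub (hl2 (α.act g b))).norm).mul_const C
      rw [sub_self, norm_zero, zero_mul] at h1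
      exact h1.eventually_lt_const hε
  obtain ⟨η, hη0, hη⟩ : ∃ η : ℝ, 0 < η ∧ ∀ b ∈ F, η * ‖b‖ < ε / 2 := by
    have h1 : ∀ᶠ η in 𝓝[>] (0 : ℝ), ∀ b ∈ F, η * ‖b‖ < ε / 2 := by
      refine (Finset.eventually_all F).2 fun b _ => ?_
      have h2 : Tendsto (fun η : ℝ => η * ‖b‖) (𝓝[>] 0) (𝓝 (0 * ‖b‖)) :=
        (tendsto_nhdsWithin_of_tendsto_nhds tendsto_id).mul_const _
      rw [zero_mul] at h2
      exact h2.eventually_lt_const (half_pos hε)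
    obtain ⟨η, h3, h4⟩ := (h1.and self_mem_nhdsWithin).exists
    exact ⟨η, h4, h3⟩
  set t : ℝ := (1 + η)⁻¹ with ht
  have ht0 : 0 < t := by positivity
  have ht1 : t ≤ 1 := inv_le_one_of_one_le₀ (by linarith)
  have htη : 1 - t ≤ η := by
    have : t * (1 + η) = 1 := inv_mul_cancel₀ (by positivity)
    nlinarith
  set c : ℂ := (t : ℂ) with hc
  have hcs : star c = c := Complex.conj_ofReal t
  have hcn : ‖c‖ = t := by rw [hc, Complex.norm_real, Real.norm_of_nonneg ht0.le]
  set z : Fin (d + 1) → G → ι → A := fun j g i => c • (e * x j g i * e) with hz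
  have hxe : ∀ j g, Tendsto (fun i => e * e * x j g i - x j g i * (e * e)) l (𝓝 0) := by
    intro j g
    have h1 := ((hx j).semicentral g (e * e) (mem_of_global hα _ _)).neg
    rw [neg_zero] at h1
    refine h1.congr fun i => ?_
    rw [act_mul_of_global hα, heα, neg_sub]
  have hxe' : ∀ j g, Tendsto (fun i => e * e * star (x j g i) - star (x j g i) * (e * e)) l
      (𝓝 0) := by
    intro j g
    have h1 := (hxe j g).star.neg
    rw [star_zero, neg_zero] at h1
    refine h1.congr fun i => ?_
    simp only [star_sub, star_mul, hes]
    noncomm_ring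
  have hCe : ∀ j g i, ‖e * x j g i‖ ≤ C := fun j g i =>
    (norm_mul_le _ _).trans ((mul_le_of_le_one_left (norm_nonneg _) hen).trans (hC j g i))
  have hCe' : ∀ j g i, ‖e * star (x j g i)‖ ≤ C := fun j g i => by
    refine (norm_mul_le _ _).trans ((mul_le_of_le_one_left (norm_nonneg _) hen).trans ?_)
    rw [norm_star]
    exact hC j g i
  -- commuting `e²` past the `x_h`, all relations reduce to those of the `x_g` applied to `e³ b`
  have ev0 : ∀ᶠ i in l, ∀ j g, ‖z j g i‖ ≤ 1 := by
    simp only [eventually_all]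
    intro j g
    filter_upwards [hn e hes hen heα η hη0 j g] with i hi
    rw [hz, norm_smul, hcn, ht, inv_mul_le_iff₀ (by positivity), mul_one, mul_assoc]
    exact (norm_mul_le _ _).trans ((mul_le_of_le_one_left (norm_nonneg _) hen).trans hi.le)
  have ev1 : ∀ᶠ i in l, ∀ j g, ∀ b ∈ F,
      ‖(star (z j g i) * z j g i - z j g i * star (z j g i)) * b‖ < ε := by
    simp only [eventually_all, Finset.eventually_all]
    intro j g b _
    have h1 := tendsto_mul_bdd_zero (x := fun _ : ι => e * b) (fun _ => le_rfl)
      (tendsto_bdd_mul_zero (hCe' j g) (hxe j g))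
    have h2 := tendsto_mul_bdd_zero (x := fun _ : ι => e * b) (fun _ => le_rfl)
      (tendsto_bdd_mul_zero (hCe j g) (hxe' j g))
    have h3 := tendsto_bdd_mul_zero (x := fun _ : ι => e) (fun _ => le_rfl)
      ((hx j).normal g (e * e * e * b))
    have h4 := (((h1.sub h2).add h3).const_smul (c * c)).norm
    simp only [sub_zero, add_zero, smul_zero, norm_zero] at h4
    refine (h4.congr fun i => ?_).eventually_lt_const hε
    congr 1
    simp only [hz, star_smul, star_mul, hes, hcs, smul_mul_assoc, mul_smul_comm, smul_smul,
      ← smul_sub]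
    congr 1
    noncomm_ring
  have ev2 : ∀ᶠ i in l, ∀ j g h, ∀ b ∈ F,
      ‖(z j g i * z j h i - z j 1 i * z j (g * h) i) * b‖ < ε := by
    simp only [eventually_all, Finset.eventually_all]
    intro j g h b _
    have h1 := tendsto_mul_bdd_zero (x := fun _ : ι => e * b) (fun _ => le_rfl)
      (tendsto_bdd_mul_zero (hCe j g) (hxe j h))
    have h2 := tendsto_mul_bdd_zero (x := fun _ : ι => e * b) (fun _ => le_rfl)
      (tendsto_bdd_mul_zero (hCe j 1) (hxe j (g * h)))
    have h3 := tendsto_bdd_mul_zero (x := fun _ : ι => e) (fun _ => le_rfl)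
      ((hx j).mul g h (e * e * e * b))
    have h4 := (((h1.sub h2).add h3).const_smul (c * c)).norm
    simp only [sub_zero, add_zero, smul_zero, norm_zero] at h4
    refine (h4.congr fun i => ?_).eventually_lt_const hε
    congr 1
    simp only [hz, smul_mul_assoc, mul_smul_comm, smul_smul, ← smul_sub]
    congr 1
    noncomm_ring
  have ev3 : ∀ᶠ i in l, ∀ j g h, ∀ a ∈ F, a ∈ α.ideal g⁻¹ → ∀ b ∈ F,
      ‖(α.act g (a * z j h i) - α.act g a * z j (g * h * g⁻¹) i) * b‖ < ε := by
    simp only [eventually_all, Finset.eventually_all]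
    intro j g h a _ _ b _
    have h1 := tendsto_bdd_mul_zero (x := fun _ : ι => α.act g a * e) (fun _ => le_rfl)
      ((hx j).toLimitCovariant.strictNull_act_sub hα g h (e * b))
    have h4 := (h1.const_smul c).norm
    simp only [smul_zero, norm_zero] at h4
    refine (h4.congr fun i => ?_).eventually_lt_const hε
    congr 1
    simp only [hz, mul_comm g h, mul_inv_cancel_right, mul_smul_comm,
      α.act_smul c (mem_of_global hα _ _), act_mul_of_global hα, heα, ← smul_sub, smul_mul_assoc]
    congr 1
    noncomm_ring
  have ev4 : ∀ᶠ i in l, ∀ b ∈ F, ‖(∑ j, z j 1 i) * b - b‖ < ε := by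
    rw [Finset.eventually_all]
    intro b hb
    have h1 : ∀ j, Tendsto (fun i => e * (x j 1 i * (e * b)) - x j 1 i * (e * e * b)) l
        (𝓝 0) := by
      intro j
      have h2 := ((hx j).semicentral 1 e (mem_of_global hα _ _)).neg
      rw [neg_zero] at h2
      refine (tendsto_mul_bdd_zero (x := fun _ : ι => e * b) (fun _ => le_rfl) h2).congr
        fun i => ?_
      rw [act_one]
      noncomm_ring
    have h2 := tendsto_finsetSum Finset.univ fun j _ => h1 j
    rw [Finset.sum_const_zero] at h2
    have h3 := (((h2.add (hs (e * e * b))).const_smul c).sub_const b).norm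
    rw [zero_add] at h3
    have h5 : ‖c • (e * e * b) - b‖ < ε := by
      have e1 : c • (e * e * b) - b = c • (e * e * b - b) - ((1 - t : ℝ) : ℂ) • b := by
        rw [smul_sub, hc, Complex.ofReal_sub, sub_smul, Complex.ofReal_one, one_smul]
        abel
      have e2 : ‖((1 - t : ℝ) : ℂ) • b‖ ≤ η * ‖b‖ := by
        rw [norm_smul, Complex.norm_real, Real.norm_of_nonneg (by linarith)]
        exact mul_le_mul_of_nonneg_right htη (norm_nonneg _)
      have e3 : ‖c • (e * e * b - b)‖ ≤ ‖e * e * b - b‖ := by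
        rw [norm_smul, hcn]
        exact mul_le_of_le_one_left (norm_nonneg _) ht1
      rw [e1]
      refine (norm_sub_le _ _).trans_lt ?_
      linarith [he1 b hb, hη b hb]
    refine (h3.congr fun i => ?_).eventually_lt_const h5
    congr 2
    simp only [hz, ← Finset.smul_sum, smul_mul_assoc, Finset.sum_mul, Finset.sum_sub_distrib]
    congr 1
    simp only [mul_assoc]
    abel
  have ev5 : ∀ᶠ i in l, ∀ j g, ∀ b ∈ F, b ∈ α.ideal g⁻¹ →
      ‖z j g i * b - α.act g b * z j g i‖ < ε := by
    simp only [eventually_all, Finset.eventually_all]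
    intro j g b hb _
    have h1 := tendsto_bdd_mul_zero (x := fun _ : ι => e) (fun _ => le_rfl)
      ((hx j).semicentral g (e * b) (mem_of_global hα _ _))
    have h2 := tendsto_bdd_mul_zero (x := fun _ : ι => α.act g b * e) (fun _ => le_rfl)
      ((hx j).semicentral g e (mem_of_global hα _ _))
    have h3 := (h1.sub h2).norm
    rw [sub_zero, norm_zero] at h3
    filter_upwards [h3.eventually_lt_const (sub_pos.2 (he2 g b hb))] with i hi
    have e1 : z j g i * b - α.act g b * z j g i =
        c • ((e * (x j g i * (e * b) - α.act g (e * b) * x j g i) -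
          α.act g b * e * (x j g i * e - α.act g e * x j g i)) +
          (e * e * α.act g b - α.act g b * e * e) * x j g i) := by
      simp only [hz, smul_mul_assoc, mul_smul_comm, ← smul_sub, act_mul_of_global hα, heα]
      congr 1
      noncomm_ring
    have e2 : ‖(e * e * α.act g b - α.act g b * e * e) * x j g i‖ ≤
        ‖e * e * α.act g b - α.act g b * e * e‖ * C :=
      (norm_mul_le _ _).trans (mul_le_mul_of_nonneg_left (hC j g i) (norm_nonneg _))
    rw [e1, norm_smul, hcn]
    refine (mul_le_of_le_one_left (norm_nonneg _) ht1).trans_lt ((norm_add_le _ _).trans_lt ?_)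
    linarith
  obtain ⟨i, h0, h1, h2, h3, h4, h5⟩ :=
    (ev0.and (ev1.and (ev2.and (ev3.and (ev4.and ev5))))).exists
  refine ⟨fun j g => z j g i, fun j g => ⟨mem_of_global hα _ _, h0 j g⟩, fun j => ?_, h1, h2, h3,
    h4, h5⟩
  obtain ⟨b, hb⟩ := (hx j).pos i
  refine ⟨((√t : ℝ) : ℂ) • (b * e), ?_⟩
  have e1 : star ((√t : ℝ) : ℂ) * ((√t : ℝ) : ℂ) = c := by
    rw [show star ((√t : ℝ) : ℂ) = ((√t : ℝ) : ℂ) from Complex.conj_ofReal _,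
      ← Complex.ofReal_mul, Real.mul_self_sqrt ht0.le]
  rw [star_smul, smul_mul_smul_comm, e1, star_mul, hes]
  simp only [hz, hb, mul_assoc]

/-- The representation consists of the coefficients at `g⁻¹` of the Fourier transforms of the
towers. -/
theorem approxRepresentable_of_rokhlinDimLE {d : ℕ} (h : α.dualAction.RokhlinDimLE d) :
    α.ApproxRepresentable d := by
  classical
  obtain ⟨f, hf, hc, ho, hs⟩ := exists_limit_towers h
  set φ : Fin (d + 1) → (G →* Circle) → (ℕ × Finset (CrossedProduct α)) → CrossedProduct α :=
    fun j χ i => α.dualAut χ (f j i) with hφ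
  have hφpos : ∀ j χ i, ∃ b, φ j χ i = star b * b := fun j χ i => by
    obtain ⟨b, hb⟩ := (hf j i).1
    exact ⟨α.dualAut χ b, (congrArg (α.dualAut χ) hb).trans (by rw [map_mul, map_star])⟩
  have hφn : ∀ j χ i, ‖φ j χ i‖ ≤ 1 := fun j χ i => by
    rw [hφ, StarAlgEquiv.norm_map]; exact (hf j i).2
  have hφs : ∀ j χ i, star (φ j χ i) = φ j χ i := fun j χ i => by
    obtain ⟨b, hb⟩ := hφpos j χ i
    rw [hb, star_mul, star_star]
  set x : Fin (d + 1) → G → (ℕ × Finset (CrossedProduct α)) → A :=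
    fun j g i => (charNet (φ j) g i).coeff g⁻¹ with hx
  have hmem : ∀ j g i, x j g i ∈ α.ideal g⁻¹ := fun j g i => CrossedProduct.coeff_mem _ _
  have hsingle : ∀ j g i, charNet (φ j) g i = CrossedProduct.single g⁻¹ (x j g i) (hmem j g i) :=
    fun j g i => charNet_dualAut (f j) g i
  have hv : ∀ j, AsympRep atTop fun g i => CrossedProduct.single g⁻¹ (x j g i) (hmem j g i) :=
    fun j => by
      have h1 := asympRep_charNet (hφn j) (hφs j) (hc j) (ho j)
      have h2 : charNet (φ j) = fun g i => CrossedProduct.single g⁻¹ (x j g i) (hmem j g i) :=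
        funext fun g => funext fun i => hsingle j g i
      rwa [h2] at h1
  have hxpos : ∀ j i, ∃ b, x j 1 i = star b * b := by
    intro j i
    have h1 : x j 1 i = ∑ χ, (φ j χ i).coeff 1 := by
      simp only [hx, charNet_one, inv_one, CrossedProduct.coeff_sum]
    let := CStarAlgebra.spectralOrder A
    have := CStarAlgebra.spectralOrderedRing A
    rw [h1]
    refine CStarAlgebra.nonneg_iff_eq_star_mul_self.1 (Finset.sum_nonneg fun χ _ => ?_)
    exact CStarAlgebra.nonneg_iff_eq_star_mul_self.2
      (CrossedProduct.exists_coeff_one_eq_star_mul_self (hφpos j χ i))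
  have hxs : ∀ b, Tendsto (fun i => (∑ j, x j 1 i) * b) atTop (𝓝 b) := by
    intro b
    have h1 := ((hs (CrossedProduct.embed α b)).sub_const (CrossedProduct.embed α b)).norm
    rw [sub_self, norm_zero] at h1
    rw [tendsto_iff_norm_sub_tendsto_zero]
    refine h1.congr fun i => ?_
    have h2 : ∑ j, ∑ χ, α.dualAut χ (f j i) = CrossedProduct.embed α (∑ j, x j 1 i) := by
      rw [map_sum]
      refine Finset.sum_congr rfl fun j _ => ?_
      have h3 := hsingle j 1 i
      rw [charNet_one] at h3
      exact h3.trans (CrossedProduct.single_congr inv_one rfl _)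
    rw [h2, ← map_mul, ← map_sub, CrossedProduct.embed_apply, CrossedProduct.norm_single]
  have hα := global_of_asympRep hmem hv hxpos hxs
  have hbd : ∀ j g i, ‖x j g i‖ ≤ Fintype.card (G →* Circle) := fun j g i => by
    rw [← CrossedProduct.norm_single (hmem j g i), ← hsingle]
    exact norm_charNet_le (hφn j) g i
  refine approxRepresentable_of_limitRep hα
    (fun j => limitRep_of_asympRep hα (hmem j) ⟨_, hbd j⟩ (hv j) (hxpos j)) hxs ?_
  intro e hes hen heα η hη j g
  filter_upwards [eventually_norm_charNet_mul_lt (hφn j) (hφpos j) (ho j) g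
    (e := CrossedProduct.embed α e) (by rw [← map_star, hes])
    ((NonUnitalStarAlgHom.norm_apply_le _ _).trans hen) hη] with i hi
  rwa [hsingle, CrossedProduct.single_mul_embed, CrossedProduct.norm_single, conv_of_global hα,
    heα] at hi

end RokhlinToRep

end PartialAction

/-- The Rokhlin dimension of the dual action of a partial action of a finite abelian group on a
separable C⋆-algebra equals the representability dimension of the partial action. -/
theorem theoremB {G : Type*} {A : Type*} [CommGroup G] [Fintype G] [NonUnitalCStarAlgebra A]
    [TopologicalSpace.SeparableSpace A] (α : PartialAction G A) :
    α.dualAction.rokhlinDim = α.reprDim := by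
  have h : ∀ d, α.dualAction.RokhlinDimLE d ↔ α.ApproxRepresentable d := fun d =>
    ⟨PartialAction.approxRepresentable_of_rokhlinDimLE,
      PartialAction.rokhlinDimLE_of_approxRepresentable⟩
  simp only [PartialAction.rokhlinDim, PartialAction.reprDim, h]
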